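/- Notation. For $n\ge 1$ let $\mathfrak S_n$ be the group of permutations of $[n]=\{1,\dots,n\}$, and for $\sigma\in\mathfrak S_n$ let $\#(\sigma)$ be the number of cycles of $\sigma$, fixed points included. A vincular pattern of size $p\ge 1$ is a couple $(\tau,X)$ with $\tau\in\mathfrak S_p$ and $X\subset[p-1]$. An occurrence of $(\tau,X)$ in $\sigma\in\mathfrak S_n$ is a list $1\le i_1<\dots<i_p\le n$ such that $i_{x+1}=i_x+1$ for every $x\in X$ and such that $(\sigma(i_1),\dots,\sigma(i_p))$ is in the same relative order as $(\tau(1),\dots,\tau(p))$. Let $\mathcal N_{(\tau,X)}(\sigma)$ be the number of occurrences of $(\tau,X)$ in $\sigma$, and let $q=\mathrm{card}(X)$. Proposition. Let $p\ge 1$, $\tau\in\mathfrak S_p$ and $X\subset[p-1]$. There is a constant $V_{\tau,X}\ge 0$, depending only on $(\tau,X)$, with $V_{\tau,X}>0$ if $p\ge 2$, such that the following holds. Let $(\sigma_n)_{n\ge1}$ be any sequence of random permutations, $\sigma_n$ with values in $\mathfrak S_n$, such that (i) for every $n\ge 1$ and every $\pi\in\mathfrak S_n$, $\pi^{-1}\sigma_n\pi$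 has the same law as $\sigma_n$; (ii) $\#(\sigma_n)/\sqrt n\to 0$ in probability as $n\to\infty$. Then, as $n\to\infty$, $$\frac{\mathcal N_{(\tau,X)}(\sigma_n)-\frac{n^{p-q}}{p!\,(p-q)!}}{n^{p-q-\frac12}}\ \xrightarrow{\ d\ }\ \mathcal N(0,V_{\tau,X}),$$ where $\mathcal N(0,0)$ denotes the Dirac mass at $0$. Moreover, $V_{\tau,X}$ is the constant for which the same convergence holds when $\sigma_n$ is uniformly distributed on $\mathfrak S_n$. -/

import Mathlib

open MeasureTheory ProbabilityTheory Filter Topology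

/-- Permutations of `Fin n` (the set `[n]`, shifted by one) form a finite set, so every subset is
measurable. -/
instance permFinMeasurableSpace (n : ℕ) : MeasurableSpace (Equiv.Perm (Fin n)) := ⊤

instance permFinDiscrete (n : ℕ) : DiscreteMeasurableSpace (Equiv.Perm (Fin n)) :=
  ⟨fun _ => trivial⟩

/-- The number `#(σ)` of cycles of `σ`, fixed points included: the number of classes of the
relation "belonging to the same cycle of `σ`". -/
noncomputable def numCycles {n : ℕ} (σ : Equiv.Perm (Fin n)) : ℕ :=
  Nat.card (Quotient (Equiv.Perm.SameCycle.setoid σ))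

/-- A sequence of random permutations `σ n` of `[n]` (each on its own probability space) is
conjugation invariant: `σ n` has the same law as `π⁻¹ (σ n) π`, for all `n ≥ 1` and every
deterministic permutation `π` of `[n]`. -/
def ConjInvariant {Ω : ℕ → Type*} [∀ n, MeasurableSpace (Ω n)] (P : ∀ n, Measure (Ω n))
    (σ : ∀ n, Ω n → Equiv.Perm (Fin n)) : Prop :=
  ∀ n, 1 ≤ n → ∀ π : Equiv.Perm (Fin n),
    IdentDistrib (σ n) (fun ω => π⁻¹ * σ n ω * π) (P n) (P n)

/-- Conjugation invariance together with `#(σ n) / n ^ (1 / α) → 0` in probability. -/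
def HInvProb (α : ℝ) {Ω : ℕ → Type*} [∀ n, MeasurableSpace (Ω n)] (P : ∀ n, Measure (Ω n))
    (σ : ∀ n, Ω n → Equiv.Perm (Fin n)) : Prop :=
  ConjInvariant P σ ∧
    ∀ ε : ℝ, 0 < ε → Tendsto
      (fun n : ℕ => P n {ω | ε ≤ |(numCycles (σ n ω) : ℝ) / (n : ℝ) ^ (1 / α)|}) atTop (𝓝 0)

/-- A vincular pattern `(τ, X)` of size `p`: a permutation `τ` of `[p]` and a subset `X` of
`[p - 1] = {1, …, p - 1}`. -/
structure VincularPattern (p : ℕ) where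
  /-- the permutation `τ` -/
  perm : Equiv.Perm (Fin p)
  /-- the set `X`, with its elements numbered from `1` -/
  adj : Finset ℕ
  adj_subset : adj ⊆ Finset.Icc 1 (p - 1)

/-- `i 0 < ⋯ < i (p - 1)` is an occurrence of `(τ, X)` in `σ`. The element `a : Fin p` stands for
the index `a + 1` of `[p]`; so for `x = a + 1 ∈ X` and `b = a + 1` the second condition reads
`i_{x + 1} = i_x + 1`. -/
def IsOccurrence {p n : ℕ} (v : VincularPattern p) (σ : Equiv.Perm (Fin n))
    (i : Fin p → Fin n) : Prop :=
  (∀ a b : Fin p, a < b → i a < i b) ∧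
  (∀ a b : Fin p, (a : ℕ) + 1 ∈ v.adj → (b : ℕ) = a + 1 → (i b : ℕ) = i a + 1) ∧
  (∀ a b : Fin p, σ (i a) < σ (i b) ↔ v.perm a < v.perm b)

instance decidableIsOccurrence {p n : ℕ} (v : VincularPattern p) (σ : Equiv.Perm (Fin n))
    (i : Fin p → Fin n) : Decidable (IsOccurrence v σ i) := by
  unfold IsOccurrence; infer_instance

/-- The number of occurrences of the vincular pattern `v` in `σ`. -/
def numOccurrences {p n : ℕ} (v : VincularPattern p) (σ : Equiv.Perm (Fin n)) : ℕ :=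
  (Finset.univ.filter (fun i : Fin p → Fin n => IsOccurrence v σ i)).card

/-- The centred and scaled number of occurrences of `v = (τ, X)` in `σ`, where `q = |X|`:
`(N(σ) - n ^ (p - q) / (p! (p - q)!)) / n ^ (p - q - 1 / 2)`. Here `q ≤ p - 1` when `1 ≤ p`, so that
the natural number subtraction `p - q` is the usual one. -/
noncomputable def normalizedOccurrences {p n : ℕ} (v : VincularPattern p)
    (σ : Equiv.Perm (Fin n)) : ℝ :=
  ((numOccurrences v σ : ℝ) -
      (n : ℝ) ^ (p - v.adj.card) / ((p.factorial : ℝ) * ((p - v.adj.card).factorial : ℝ))) /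
    (n : ℝ) ^ ((p : ℝ) - (v.adj.card : ℝ) - 1 / 2)

/-!
The argument has two independent halves: a central limit theorem for uniform permutations, and a
comparison of an arbitrary conjugation invariant permutation with few cycles to a uniform one.

**Uniform permutations.** The number of occurrences of `(τ, X)` is the sum over the position words
`i` (increasing words of length `p`, with the adjacencies prescribed by `X`) of the indicator that
the permutation has the relative order `τ` along `i`. The relative order of a uniform permutation
on a set `A` of positions is independent of every statistic that is unchanged when the positions in
`A` are permuted (`expect_mul_of_orderDet`), so that indicators of disjoint words are independent
and the sum is locally dependent. Put `m = p - |X|`, the number of blocks into which the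
adjacencies tie the letters. There are about `n ^ m / m!` words, and every word meets
`O(n ^ (m - 1))` others. Stein's method, applied to the characteristic function `φ`, shows that
`φ' (t) = -t v φ(t)` up to an explicit error, `v` being the variance; integration gives a
quantitative normal approximation (`norm_expect_cis_sub_gaussian_le`).

The variance converges on the scale `n ^ (2 m - 1)`. Indeed, grouping the pairs of words in the
second moment according to their relative position writes it as a finite sum of constants times
binomial coefficients (`expect_occ_sq`), so that the variance is eventually a polynomial in `n`;
and it is `O(n ^ (2 m - 1))` since only the pairs of words that meet contribute
(`exists_tendsto_occVar`).

The limit is positive for `p ≥ 2` (`occVar_limit_pos`). By the Cauchy-Schwarz inequality it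
suffices to find a centred statistic that is sufficiently correlated with the number of
occurrences.
* If `m ≥ 2`, the statistic counts the points of the graph of the permutation in a corner: the
  positions below `s` with values below `t`. For a word with exactly its first block left of `s`,
  the covariance has a fixed sign: among the letters of a pattern, only the smallest one has a
  non-negligible probability of being very small, and the covariances of all letters sum to zero
  (`exists_sign_le_sum_lowCov`).
* If `m = 1`, the pattern is consecutive, and by reflection it may be assumed not to be increasing.
  The positions are cut into windows of length `3 p`. Rearranging the middle third of an increasing
  window according to `τ` creates an occurrence and destroys none (`occ_add_one_le_of_increasing`);
  the statistic counts the rearranged windows minus the increasing ones.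

**Conjugation invariant permutations.** The mean of a statistic under a conjugation invariant law
is the mean of its averages over conjugacy classes. Multiplication by a transposition alters
`O(n ^ (m - 1))` occurrences, hence alters the normalized count by `O(1 / √n)`, and a transposition
of points of different cycles merges these cycles. So the average over the conjugacy class of a
permutation with `k` cycles is at distance `O(k / √n)` from the average over the class of the long
cycles (`norm_conjMean_sub_le`), and every conjugation invariant permutation with `o(√n)` cycles
has asymptotically the same characteristic function as a uniform long cycle
(`tendsto_integral_sub_conjMean`). This applies in particular to uniform permutations, whose mean
number of cycles is at most a harmonic number (`expect_numCycles_le_harmonic`).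
-/

open scoped BigOperators

/-! ### Relative orders of a uniform permutation on disjoint sets of positions -/

theorem perm_eq_of_lt_iff {k : ℕ} {u w : Equiv.Perm (Fin k)}
    (h : ∀ a b, u a < u b ↔ w a < w b) : u = w := by
  let e : Fin k ≃o Fin k :=
    { toEquiv := u.symm.trans w
      map_rel_iff' := by
        intro a b
        have := h (u.symm b) (u.symm a)
        simp only [Equiv.apply_symm_apply] at this
        simp only [Equiv.trans_apply]
        rw [← not_lt, ← this, not_lt] }
  have he : e = OrderIso.refl _ := Subsingleton.elim _ _
  ext a
  have := congrArg (fun f : Fin k ≃o Fin k => f (u a)) he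
  simp [e] at this
  rw [this]

/-- The standardization of a word `h` with distinct letters: the permutation of `Fin k` in the same
relative order. -/
def pat {k n : ℕ} (h : Fin k → Fin n) : Equiv.Perm (Fin k) := (Tuple.sort h)⁻¹

theorem pat_lt_iff {k n : ℕ} {h : Fin k → Fin n} (hinj : Function.Injective h) (a b : Fin k) :
    pat h a < pat h b ↔ h a < h b := by
  have hm : StrictMono (h ∘ Tuple.sort h) :=
    (Tuple.monotone_sort h).strictMono_of_injective (hinj.comp (Tuple.sort h).injective)
  have := hm.lt_iff_lt (a := pat h a) (b := pat h b)
  simpa [pat] using this.symm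

theorem pat_eq_iff {k n : ℕ} {h : Fin k → Fin n} (hinj : Function.Injective h)
    (v : Equiv.Perm (Fin k)) : pat h = v ↔ ∀ a b, h a < h b ↔ v a < v b := by
  constructor
  · rintro rfl a b
    exact (pat_lt_iff hinj a b).symm
  · intro hv
    exact perm_eq_of_lt_iff fun a b => (pat_lt_iff hinj a b).trans (hv a b)

theorem pat_comp_perm {k n : ℕ} {h : Fin k → Fin n} (hinj : Function.Injective h)
    (w : Equiv.Perm (Fin k)) : pat (h ∘ w) = pat h * w :=
  (pat_eq_iff (hinj.comp w.injective) _).2 fun a b => (pat_lt_iff hinj (w a) (w b)).symm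

theorem expect_perm_mul_right {𝕜 : Type*} [AddCommMonoid 𝕜] [Module ℚ≥0 𝕜] {n : ℕ}
    (f : Equiv.Perm (Fin n) → 𝕜) (ρ : Equiv.Perm (Fin n)) :
    𝔼 σ, f (σ * ρ) = 𝔼 σ, f σ :=
  Fintype.expect_equiv (Equiv.mulRight ρ) _ _ fun _ => rfl

theorem expect_perm_mul_left {𝕜 : Type*} [AddCommMonoid 𝕜] [Module ℚ≥0 𝕜] {n : ℕ}
    (f : Equiv.Perm (Fin n) → 𝕜) (ρ : Equiv.Perm (Fin n)) :
    𝔼 σ, f (ρ * σ) = 𝔼 σ, f σ :=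
  Fintype.expect_equiv (Equiv.mulLeft ρ) _ _ fun _ => rfl

/-- The relative order of a uniform permutation on the positions `i` is uniform, and independent of
every statistic that is unchanged when these positions are permuted. -/
theorem expect_pat_mul {𝕜 : Type*} [RCLike 𝕜] {k n : ℕ} (i : Fin k ↪ Fin n)
    (F : Equiv.Perm (Fin k) → 𝕜) (g : Equiv.Perm (Fin n) → 𝕜)
    (hg : ∀ (σ : Equiv.Perm (Fin n)) (w : Equiv.Perm (Fin k)),
      g (σ * w.viaFintypeEmbedding i) = g σ) :
    𝔼 σ : Equiv.Perm (Fin n), F (pat (σ ∘ i)) * g σ = (𝔼 w, F w) * 𝔼 σ, g σ := by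
  have hinj : ∀ σ : Equiv.Perm (Fin n), Function.Injective (σ ∘ i) := fun σ =>
    σ.injective.comp i.injective
  have key : ∀ w : Equiv.Perm (Fin k), 𝔼 σ : Equiv.Perm (Fin n), F (pat (σ ∘ i)) * g σ =
      𝔼 σ : Equiv.Perm (Fin n), F (pat (σ ∘ i) * w) * g σ := by
    intro w
    rw [← expect_perm_mul_right _ (w.viaFintypeEmbedding i)]
    refine Finset.expect_congr rfl fun σ _ => ?_
    rw [hg, ← pat_comp_perm (hinj σ)]
    congr 3
    ext a
    simp [Equiv.Perm.viaFintypeEmbedding_apply_image]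
  rw [← Fintype.expect_const (ι := Equiv.Perm (Fin k))
    (𝔼 σ : Equiv.Perm (Fin n), F (pat (σ ∘ i)) * g σ), Finset.expect_congr rfl fun w _ => key w,
    Finset.expect_comm, Finset.mul_expect]
  refine Finset.expect_congr rfl fun σ _ => ?_
  rw [← Finset.expect_mul, expect_perm_mul_left]

theorem expect_pat {𝕜 : Type*} [RCLike 𝕜] {k n : ℕ} (i : Fin k ↪ Fin n)
    (F : Equiv.Perm (Fin k) → 𝕜) :
    𝔼 σ : Equiv.Perm (Fin n), F (pat (σ ∘ i)) = 𝔼 w, F w := by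
  simpa using expect_pat_mul i F (fun _ => 1) (fun _ _ => rfl)

/-- `f σ` depends only on the relative order of the values of `σ` at the positions in `A`. -/
def OrderDet {E : Type*} {n : ℕ} (A : Finset (Fin n)) (f : Equiv.Perm (Fin n) → E) : Prop :=
  ∀ σ σ' : Equiv.Perm (Fin n),
    (∀ a ∈ A, ∀ b ∈ A, (σ a < σ b ↔ σ' a < σ' b)) → f σ = f σ'

/-- Independence of the relative order on `A` from every statistic that is unchanged when the
positions in `A` are permuted. -/
theorem expect_mul_of_orderDet {𝕜 : Type*} [RCLike 𝕜] {n : ℕ} {A : Finset (Fin n)}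
    {f g : Equiv.Perm (Fin n) → 𝕜} (hf : OrderDet A f)
    (hg : ∀ σ ρ : Equiv.Perm (Fin n), (∀ x ∉ A, ρ x = x) → g (σ * ρ) = g σ) :
    𝔼 σ, f σ * g σ = (𝔼 σ, f σ) * 𝔼 σ, g σ := by
  let i : Fin A.card ↪o Fin n := A.orderEmbOfFin rfl
  have hmem : ∀ a, i a ∈ A := fun a => Finset.orderEmbOfFin_mem A rfl a
  have hrange : ∀ x ∈ A, ∃ a, i a = x := by
    intro x hx
    have : x ∈ Set.range (A.orderEmbOfFin rfl) := by
      rw [Finset.range_orderEmbOfFin]; exact hx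
    exact this
  let F : Equiv.Perm (Fin A.card) → 𝕜 := fun w => f (w.viaFintypeEmbedding i.toEmbedding)
  have hF : ∀ σ, f σ = F (pat (σ ∘ i.toEmbedding)) := by
    intro σ
    refine hf _ _ fun x hx y hy => ?_
    obtain ⟨a, rfl⟩ := hrange x hx
    obtain ⟨b, rfl⟩ := hrange y hy
    have h1 := Equiv.Perm.viaFintypeEmbedding_apply_image (pat (σ ∘ i.toEmbedding))
      i.toEmbedding
    have h2 := pat_lt_iff (h := σ ∘ i.toEmbedding) (σ.injective.comp i.injective) a b
    have ha := h1 a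
    have hb := h1 b
    simp only [RelEmbedding.coe_toEmbedding] at ha hb h2 ⊢
    rw [ha, hb, i.lt_iff_lt, h2]
    rfl
  have h := expect_pat_mul i.toEmbedding F g (fun σ w => hg _ _ fun x hx => by
    apply Equiv.Perm.viaFintypeEmbedding_apply_notMem_range
    rintro ⟨a, rfl⟩
    exact hx (hmem a))
  have h' := expect_pat i.toEmbedding F
  simp only [← hF] at h h'
  rw [h, h']

theorem OrderDet.mul_right {E : Type*} {n : ℕ} {A B : Finset (Fin n)}
    {f : Equiv.Perm (Fin n) → E} (hf : OrderDet B f) (hAB : Disjoint A B)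
    (σ ρ : Equiv.Perm (Fin n)) (hρ : ∀ x ∉ A, ρ x = x) : f (σ * ρ) = f σ :=
  hf _ _ fun a ha b hb => by
    simp [hρ a (Finset.disjoint_right.1 hAB ha), hρ b (Finset.disjoint_right.1 hAB hb)]

theorem expect_mul_of_disjoint {𝕜 : Type*} [RCLike 𝕜] {n : ℕ} {A B : Finset (Fin n)}
    {f g : Equiv.Perm (Fin n) → 𝕜} (hf : OrderDet A f) (hg : OrderDet B g)
    (hAB : Disjoint A B) : 𝔼 σ, f σ * g σ = (𝔼 σ, f σ) * 𝔼 σ, g σ :=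
  expect_mul_of_orderDet hf fun σ ρ hρ => hg.mul_right hAB σ ρ hρ

/-! ### Counting position words -/

/-- The position words of a vincular pattern of size `p` with adjacency set `X`: strictly
increasing, with consecutive entries wherever `X` requires it. -/
def Pos (X : Finset ℕ) (p n : ℕ) : Finset (Fin p → Fin n) :=
  Finset.univ.filter fun i => (∀ a b : Fin p, a < b → i a < i b) ∧
    ∀ a b : Fin p, (a : ℕ) + 1 ∈ X → (b : ℕ) = a + 1 → (i b : ℕ) = i a + 1

theorem mem_Pos {X : Finset ℕ} {p n : ℕ} {i : Fin p → Fin n} :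
    i ∈ Pos X p n ↔ (∀ a b : Fin p, a < b → i a < i b) ∧
      ∀ a b : Fin p, (a : ℕ) + 1 ∈ X → (b : ℕ) = a + 1 → (i b : ℕ) = i a + 1 := by
  simp [Pos]

theorem Pos.strictMono {X : Finset ℕ} {p n : ℕ} {i : Fin p → Fin n} (hi : i ∈ Pos X p n) :
    StrictMono i := fun a b h => (mem_Pos.1 hi).1 a b h

/-- The words of `Pos X p n` with their letters read as natural numbers. -/
def PosN (X : Finset ℕ) (p n : ℕ) : Finset (Fin p → ℕ) :=
  (Fintype.piFinset fun _ => Finset.range n).filter fun i => (∀ a b : Fin p, a < b → i a < i b) ∧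
    ∀ a b : Fin p, (a : ℕ) + 1 ∈ X → (b : ℕ) = a + 1 → i b = i a + 1

theorem mem_PosN {X : Finset ℕ} {p n : ℕ} {i : Fin p → ℕ} :
    i ∈ PosN X p n ↔ (∀ a, i a < n) ∧ (∀ a b : Fin p, a < b → i a < i b) ∧
      ∀ a b : Fin p, (a : ℕ) + 1 ∈ X → (b : ℕ) = a + 1 → i b = i a + 1 := by
  simp [PosN]

theorem card_Pos_eq_card_PosN (X : Finset ℕ) (p n : ℕ) : (Pos X p n).card = (PosN X p n).card := by
  refine Finset.card_bij (fun i _ a => (i a : ℕ)) ?_ ?_ ?_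
  · intro i hi
    rw [mem_Pos] at hi
    exact mem_PosN.2 ⟨fun a => (i a).2, fun a b h => hi.1 a b h, hi.2⟩
  · intro i _ j _ h
    ext a
    exact congrFun h a
  · intro j hj
    rw [mem_PosN] at hj
    exact ⟨fun a => ⟨j a, hj.1 a⟩, mem_Pos.2 ⟨fun a b h => hj.2.1 a b h, hj.2.2⟩, rfl⟩

theorem mem_PosN_succ {X : Finset ℕ} {p n : ℕ} {i : Fin (p + 1) → ℕ} :
    i ∈ PosN X (p + 1) n ↔ Fin.init i ∈ PosN X p (i (Fin.last p)) ∧ i (Fin.last p) < n ∧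
      ∀ a : Fin p, (a : ℕ) + 1 = p → p ∈ X → i (Fin.last p) = Fin.init i a + 1 := by
  rw [mem_PosN, mem_PosN]
  constructor
  · rintro ⟨h1, h2, h3⟩
    refine ⟨⟨fun a => h2 _ _ (Fin.castSucc_lt_last a), fun a b h => h2 _ _ (by simpa using h),
      fun a b ha hb => h3 _ _ (by simpa using ha) (by simpa using hb)⟩, h1 _, fun a ha hp => ?_⟩
    exact h3 a.castSucc (Fin.last p) (by simpa [ha] using hp) (by simp [ha])
  · rintro ⟨⟨h1, h2, h3⟩, h4, h5⟩
    refine ⟨fun a => ?_, fun a b => ?_, fun a b => ?_⟩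
    · induction a using Fin.lastCases with
      | last => exact h4
      | cast a => exact (h1 a).trans h4
    · induction b using Fin.lastCases with
      | last =>
        induction a using Fin.lastCases with
        | last => simp
        | cast a => exact fun _ => h1 a
      | cast b =>
        induction a using Fin.lastCases with
        | last => intro h; exact absurd (h.trans (Fin.castSucc_lt_last b)) (lt_irrefl _)
        | cast a => exact fun h => h2 a b (by simpa using h)
    · induction b using Fin.lastCases with
      | last =>
        induction a using Fin.lastCases with
        | last => intro _ h; simp at h
        | cast a =>
          intro ha hb
          simp only [Fin.val_last, Fin.val_castSucc] at ha hb
          exact h5 a hb.symm (by rwa [hb])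
      | cast b =>
        induction a using Fin.lastCases with
        | last => intro _ h; have := b.2; simp at h; omega
        | cast a => exact fun ha hb => h3 a b (by simpa using ha) (by simpa using hb)

theorem init_injective_of_last {p : ℕ} {i j : Fin (p + 1) → ℕ} (h : Fin.init i = Fin.init j)
    (hl : i (Fin.last p) = j (Fin.last p)) : i = j := by
  rw [← Fin.snoc_init_self i, ← Fin.snoc_init_self j, h, hl]

theorem sum_range_choose_sub (q m n : ℕ) (h : 0 < m ∨ q = 0) :
    ∑ y ∈ Finset.range n, (y - q).choose m = (n - q).choose (m + 1) := by
  induction n with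
  | zero => simp
  | succ n ih =>
    rw [Finset.sum_range_succ, ih]
    rcases le_or_gt q n with hq | hq
    · rw [Nat.succ_sub hq, Nat.choose_succ_succ, add_comm]
    · have h1 : n - q = 0 := by omega
      have h2 : n + 1 - q = 0 := by omega
      rcases h with h | h
      · rw [h1, h2, Nat.choose_eq_zero_of_lt h]
        simp
      · omega

/-- Contracting the adjacencies in `X` turns the words into the increasing words of length
`p - X.card` in `n - X.card` letters. The induction is on the last letter of the word, which is
either tied to the preceding letter or free. -/
theorem card_PosN (p : ℕ) : ∀ (X : Finset ℕ) (n : ℕ), X ⊆ Finset.Icc 1 (p - 1) →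
    (PosN X p n).card = (n - X.card).choose (p - X.card) := by
  induction p with
  | zero =>
    intro X n hX
    have : X = ∅ := by
      rw [← Finset.subset_empty]; exact hX
    subst this
    have : PosN ∅ 0 n = Finset.univ := by
      ext i; simp [mem_PosN, eq_iff_true_of_subsingleton]
    rw [this]; simp
  | succ p ih =>
    intro X n hX
    simp only [Nat.add_sub_cancel] at hX
    by_cases hp : p ∈ X
    · have hp1 : 1 ≤ p := (Finset.mem_Icc.1 (hX hp)).1
      obtain ⟨r, rfl⟩ : ∃ r, p = r + 1 := ⟨p - 1, by omega⟩
      have hX' : X.erase (r + 1) ⊆ Finset.Icc 1 (r + 1 - 1) := by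
        intro x hx
        rw [Finset.mem_erase] at hx
        have := Finset.mem_Icc.1 (hX hx.2)
        rw [Finset.mem_Icc]; omega
      have hE : ∀ y, PosN (X.erase (r + 1)) (r + 1) y = PosN X (r + 1) y := by
        intro y
        ext i
        rw [mem_PosN, mem_PosN]
        refine and_congr_right fun _ => and_congr_right fun _ => ?_
        refine forall_congr' fun a => forall_congr' fun b => ?_
        constructor
        · intro h ha hb
          exact h (Finset.mem_erase.2 ⟨by have := b.2; omega, ha⟩) hb
        · intro h ha hb
          exact h (Finset.mem_erase.1 ha).2 hb
      have hcard : (PosN X (r + 1 + 1) n).card = (PosN X (r + 1) (n - 1)).card := by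
        refine Finset.card_bij (fun i _ => Fin.init i) ?_ ?_ ?_
        · intro i hi
          rw [mem_PosN_succ] at hi
          obtain ⟨h1, h2, h3⟩ := hi
          rw [mem_PosN] at h1 ⊢
          have hl := h3 (Fin.last r) (by simp) hp
          refine ⟨fun a => ?_, h1.2⟩
          have : Fin.init i a ≤ Fin.init i (Fin.last r) := by
            rcases (Fin.le_last a).lt_or_eq with h | h
            · exact (h1.2.1 _ _ h).le
            · rw [h]
          omega
        · intro i hi j hj h
          rw [mem_PosN_succ] at hi hj
          have h1 := hi.2.2 (Fin.last r) (by simp) hp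
          have h2 := hj.2.2 (Fin.last r) (by simp) hp
          exact init_injective_of_last h (by rw [h1, h2, h])
        · intro j hj
          refine ⟨Fin.snoc j (j (Fin.last r) + 1), ?_, by simp⟩
          rw [mem_PosN_succ, Fin.init_snoc, Fin.snoc_last]
          rw [mem_PosN] at hj ⊢
          refine ⟨⟨fun a => ?_, hj.2⟩, ?_, fun a ha _ => ?_⟩
          · rcases (Fin.le_last a).lt_or_eq with h | h
            · have := hj.2.1 _ _ h; omega
            · rw [h]; omega
          · have := hj.1 (Fin.last r); omega
          · have : a = Fin.last r := by ext; simp; omega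
            rw [this]
      have hc : (X.erase (r + 1)).card + 1 = X.card := Finset.card_erase_add_one hp
      rw [hcard, ← hE, ih _ _ hX', ← hc]
      congr 1 <;> omega
    · have hX' : X ⊆ Finset.Icc 1 (p - 1) := by
        intro x hx
        have := Finset.mem_Icc.1 (hX hx)
        have : x ≠ p := fun h => hp (h ▸ hx)
        rw [Finset.mem_Icc]; omega
      have hq : X.card ≤ p - 1 := by simpa using Finset.card_le_card hX'
      rw [Finset.card_eq_sum_card_fiberwise (f := fun i => i (Fin.last p)) (t := Finset.range n)]
      · rw [Nat.sub_add_comm (by omega), ← sum_range_choose_sub _ _ _ (by omega)]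
        refine Finset.sum_congr rfl fun y hy => ?_
        rw [← ih X y hX']
        refine Finset.card_bij (fun i _ => Fin.init i) ?_ ?_ ?_
        · intro i hi
          rw [Finset.mem_filter, mem_PosN_succ] at hi
          rw [← hi.2]; exact hi.1.1
        · intro i hi j hj h
          rw [Finset.mem_filter] at hi hj
          exact init_injective_of_last h (hi.2.trans hj.2.symm)
        · intro j hj
          refine ⟨Fin.snoc j y, ?_, by simp⟩
          rw [Finset.mem_filter, mem_PosN_succ, Fin.init_snoc, Fin.snoc_last]
          exact ⟨⟨hj, Finset.mem_range.1 hy, fun a _ h => absurd h hp⟩, rfl⟩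
      · intro i hi
        have := (mem_PosN_succ.1 hi).2.1
        simpa using this

theorem card_Pos {X : Finset ℕ} {p : ℕ} (hX : X ⊆ Finset.Icc 1 (p - 1)) (n : ℕ) :
    (Pos X p n).card = (n - X.card).choose (p - X.card) := by
  rw [card_Pos_eq_card_PosN, card_PosN p X n hX]

/-- The first positions of the blocks into which the adjacencies in `X` tie `Fin p`. -/
def blockStarts (X : Finset ℕ) (p : ℕ) : Finset (Fin p) :=
  Finset.univ.filter fun a => (a : ℕ) ∉ X

theorem card_blockStarts {X : Finset ℕ} {p : ℕ} (hX : X ⊆ Finset.Icc 1 (p - 1)) :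
    (blockStarts X p).card = p - X.card := by
  have h1 : X ⊆ Finset.range p := fun x hx => by
    have := Finset.mem_Icc.1 (hX hx)
    rw [Finset.mem_range]; omega
  have h2 : (blockStarts X p).map Fin.valEmbedding = Finset.range p \ X := by
    ext x
    simp only [blockStarts, Finset.mem_map, Finset.mem_filter, Finset.mem_univ, true_and,
      Fin.valEmbedding_apply, Finset.mem_sdiff, Finset.mem_range]
    constructor
    · rintro ⟨a, ha, rfl⟩; exact ⟨a.2, ha⟩
    · rintro ⟨h, h'⟩; exact ⟨⟨x, h⟩, h', rfl⟩
  rw [← Finset.card_map, h2, Finset.card_sdiff_of_subset h1, Finset.card_range]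

/-- The first letter of a block determines the other letters of this block. -/
theorem exists_blockStart {X : Finset ℕ} {p : ℕ} (hX : X ⊆ Finset.Icc 1 (p - 1)) (a : Fin p) :
    ∃ s ∈ blockStarts X p, ∀ n, ∀ i ∈ Pos X p n, (i a : ℕ) = i s + (a - s : ℕ) := by
  obtain ⟨a, ha⟩ := a
  induction a with
  | zero =>
    refine ⟨⟨0, ha⟩, ?_, by simp⟩
    simp only [blockStarts, Finset.mem_filter, Finset.mem_univ, true_and]
    intro h
    have := Finset.mem_Icc.1 (hX h)
    omega
  | succ a ih =>
    by_cases h : a + 1 ∈ X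
    · obtain ⟨s, hs, hs'⟩ := ih (by omega)
      refine ⟨s, hs, fun n i hi => ?_⟩
      have h1 := hs' n i hi
      have h2 := (mem_Pos.1 hi).2 ⟨a, by omega⟩ ⟨a + 1, ha⟩ h rfl
      have h3 : (s : ℕ) ≤ a := by
        by_contra h3
        have h4 := (mem_Pos.1 hi).1 ⟨a, by omega⟩ s (by rw [Fin.lt_def]; simpa using h3)
        rw [Fin.lt_def] at h4
        simp only at h1
        omega
      simp only at h1 ⊢
      omega
    · exact ⟨⟨a + 1, ha⟩, by simpa [blockStarts] using h, by simp⟩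

theorem Pos_ext {X : Finset ℕ} {p n : ℕ} (hX : X ⊆ Finset.Icc 1 (p - 1)) {i j : Fin p → Fin n}
    (hi : i ∈ Pos X p n) (hj : j ∈ Pos X p n) (h : ∀ s ∈ blockStarts X p, i s = j s) : i = j := by
  ext a
  obtain ⟨s, hs, hs'⟩ := exists_blockStart hX a
  rw [hs' n i hi, hs' n j hj, h s hs]

theorem card_le_prod_of_restrict {p n : ℕ} (G : Finset (Fin p → Fin n)) (S : Finset (Fin p))
    (c : Fin p → Finset (Fin n)) (hc : ∀ i ∈ G, ∀ a ∈ S, i a ∈ c a)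
    (hinj : ∀ i ∈ G, ∀ j ∈ G, (∀ a ∈ S, i a = j a) → i = j) :
    G.card ≤ ∏ a ∈ S, (c a).card := by
  have := Finset.card_le_card_of_injOn (s := G) (t := Fintype.piFinset fun a : S => c a)
    (fun i a => i a) (fun i hi => by
      simp only [Finset.mem_coe, Fintype.mem_piFinset]
      exact fun a => hc i hi a a.2) (fun i hi j hj h => hinj i hi j hj fun a ha =>
        congrFun h ⟨a, ha⟩)
  rw [Fintype.card_piFinset, Finset.prod_coe_sort S fun a => (c a).card] at this
  exact this

theorem card_Pos_le {X : Finset ℕ} {p : ℕ} (hX : X ⊆ Finset.Icc 1 (p - 1)) (n : ℕ) :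
    (Pos X p n).card ≤ n ^ (p - X.card) := by
  have := card_le_prod_of_restrict (Pos X p n) (blockStarts X p) (fun _ => Finset.univ)
    (by simp) (fun i hi j hj h => Pos_ext hX hi hj h)
  simpa [card_blockStarts hX] using this

theorem card_Pos_apply_eq_le {X : Finset ℕ} {p : ℕ} (hX : X ⊆ Finset.Icc 1 (p - 1)) {n : ℕ}
    (a : Fin p) (x : Fin n) :
    ((Pos X p n).filter fun i => i a = x).card ≤ n ^ (p - X.card - 1) := by
  obtain ⟨s, hs, hs'⟩ := exists_blockStart hX a
  have := card_le_prod_of_restrict ((Pos X p n).filter fun i => i a = x)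
    ((blockStarts X p).erase s) (fun _ => Finset.univ) (by simp) (fun i hi j hj h => by
      rw [Finset.mem_filter] at hi hj
      refine Pos_ext hX hi.1 hj.1 fun r hr => ?_
      by_cases hrs : r = s
      · have h1 := hs' n i hi.1
        have h2 := hs' n j hj.1
        rw [hi.2] at h1
        rw [hj.2] at h2
        rw [hrs]; ext; omega
      · exact h r (Finset.mem_erase.2 ⟨hrs, hr⟩))
  simpa [Finset.card_erase_of_mem hs, card_blockStarts hX] using this

/-- Asking a position word to meet a fixed set costs one degree of freedom, that is a factor `n`. -/
theorem card_Pos_meet_le {X : Finset ℕ} {p : ℕ} (hX : X ⊆ Finset.Icc 1 (p - 1)) {n : ℕ}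
    (A : Finset (Fin n)) :
    ((Pos X p n).filter fun i => ∃ a, i a ∈ A).card ≤ A.card * p * n ^ (p - X.card - 1) := by
  have hsub : ((Pos X p n).filter fun i => ∃ a, i a ∈ A) ⊆
      (A ×ˢ (Finset.univ : Finset (Fin p))).biUnion fun z =>
        (Pos X p n).filter fun i => i z.2 = z.1 := by
    intro i hi
    rw [Finset.mem_filter] at hi
    obtain ⟨hi, a, ha⟩ := hi
    rw [Finset.mem_biUnion]
    exact ⟨(i a, a), by simpa using ha, by simpa using hi⟩
  refine (Finset.card_le_card hsub).trans ((Finset.card_biUnion_le_card_mul _ _ _ fun z _ =>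
    card_Pos_apply_eq_le hX z.2 z.1).trans ?_)
  simp

theorem card_Pos_two_lt_le {X : Finset ℕ} {p : ℕ} (hX : X ⊆ Finset.Icc 1 (p - 1)) {n : ℕ}
    {a b : Fin p} (ha : a ∈ blockStarts X p) (hb : b ∈ blockStarts X p) (hab : a ≠ b) (s : ℕ) :
    ((Pos X p n).filter fun i => (i a : ℕ) < s ∧ (i b : ℕ) < s).card ≤
      s ^ 2 * n ^ (p - X.card - 2) := by
  have hlt : (Finset.univ.filter fun x : Fin n => (x : ℕ) < s).card ≤ s := by
    rw [← Finset.card_map Fin.valEmbedding]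
    refine (Finset.card_le_card (t := Finset.range s) fun x hx => ?_).trans (by simp)
    simp only [Finset.mem_map, Finset.mem_filter, Finset.mem_univ, true_and,
      Fin.valEmbedding_apply] at hx
    obtain ⟨y, hy, rfl⟩ := hx
    simpa using hy
  have := card_le_prod_of_restrict
    ((Pos X p n).filter fun i => (i a : ℕ) < s ∧ (i b : ℕ) < s)
    (blockStarts X p) (fun r => if r = a ∨ r = b then
      Finset.univ.filter fun x : Fin n => (x : ℕ) < s else Finset.univ)
    (fun i hi r _ => by
      rw [Finset.mem_filter] at hi
      split_ifs with h
      · rcases h with rfl | rfl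
        · simpa using hi.2.1
        · simpa using hi.2.2
      · simp)
    (fun i hi j hj h => Pos_ext hX (Finset.mem_filter.1 hi).1 (Finset.mem_filter.1 hj).1 h)
  refine this.trans ?_
  have hb' : b ∈ (blockStarts X p).erase a := Finset.mem_erase.2 ⟨hab.symm, hb⟩
  rw [← Finset.mul_prod_erase _ _ ha, ← Finset.mul_prod_erase _ _ hb']
  rw [Finset.prod_congr rfl (g := fun _ => n) (fun r hr => by
    have h1 := (Finset.mem_erase.1 hr).1
    have h2 := (Finset.mem_erase.1 (Finset.mem_erase.1 hr).2).1
    simp [h1, h2])]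
  rw [Finset.prod_const, Finset.card_erase_of_mem hb', Finset.card_erase_of_mem ha,
    card_blockStarts hX, pow_two, mul_assoc]
  simp only [true_or, or_true, if_true]
  have : p - X.card - 1 - 1 = p - X.card - 2 := by omega
  rw [this]
  gcongr

/-! ### Normal approximation for locally dependent sums -/

/-- The point `exp (i x)` of the unit circle. -/
noncomputable def cis (x : ℝ) : ℂ := Complex.exp (Complex.I * x)

theorem norm_cis (x : ℝ) : ‖cis x‖ = 1 := Complex.norm_exp_I_mul_ofReal x

theorem cis_add (x y : ℝ) : cis (x + y) = cis x * cis y := by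
  simp [cis, mul_add, Complex.exp_add]

theorem cis_zero : cis 0 = 1 := by simp [cis]

theorem norm_cis_sub_one_le (x : ℝ) : ‖cis x - 1‖ ≤ |x| :=
  Real.norm_exp_I_mul_ofReal_sub_one_le

theorem norm_cis_sub_cis_le (x y : ℝ) : ‖cis x - cis y‖ ≤ |x - y| := by
  have h : cis x - cis y = cis y * (cis (x - y) - 1) := by
    rw [mul_sub, ← cis_add]; simp
  rw [h, norm_mul, norm_cis, one_mul]
  exact norm_cis_sub_one_le _

theorem norm_cis_sub_one_sub_le (x : ℝ) : ‖cis x - 1 - Complex.I * x‖ ≤ 2 * x ^ 2 := by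
  have hn : ‖Complex.I * (x : ℂ)‖ = |x| := by simp
  rcases le_or_gt |x| 1 with h | h
  · have := Complex.norm_exp_sub_one_sub_id_le (x := Complex.I * x) (by rwa [hn])
    rw [hn, sq_abs] at this
    refine this.trans ?_
    nlinarith [sq_nonneg x]
  · refine (norm_sub_le _ _).trans ?_
    rw [hn, ← sq_abs]
    nlinarith [norm_cis_sub_one_le x]

theorem norm_expect_le_of_forall_le {Ω : Type*} [Fintype Ω] [Nonempty Ω] {f : Ω → ℂ} {c : ℝ}
    (h : ∀ ω, ‖f ω‖ ≤ c) : ‖𝔼 ω, f ω‖ ≤ c :=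
  (RCLike.norm_expect_le (K := ℂ)).trans
    (Finset.expect_le Finset.univ_nonempty fun ω _ => h ω)

theorem norm_expect_sub_expect_le {Ω : Type*} [Fintype Ω] [Nonempty Ω] {f g : Ω → ℂ} {c : ℝ}
    (h : ∀ ω, ‖f ω - g ω‖ ≤ c) : ‖𝔼 ω, f ω - 𝔼 ω, g ω‖ ≤ c := by
  rw [← Finset.expect_sub_distrib]
  exact norm_expect_le_of_forall_le h

section Stein

variable {Ω ι : Type*} [Fintype Ω] (s : Finset ι) (Y : ι → Ω → ℝ)
  (r : ι → ι → Prop) [DecidableRel r]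

/-- A finite family of bounded centred variables on a finite uniform probability space with local
dependence: `r a b` says that `b` is in the dependency neighbourhood of `a`; `δ` bounds the
variables and `D` the sizes of the neighbourhoods. Only the consequences of independence used by
Stein's method are recorded: `Y a`, and the product `Y a * Y b`, are uncorrelated with the
exponentials of the sum of the `Y c` over the `c` outside the neighbourhoods involved. -/
structure LocallyDependent (δ D : ℝ) : Prop where
  abs_le : ∀ a ∈ s, ∀ ω, |Y a ω| ≤ δ
  card_le : ∀ a ∈ s, ((s.filter fun b => r a b).card : ℝ) ≤ D
  expect_one : ∀ a ∈ s, ∀ t : ℝ,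
    𝔼 ω, (Y a ω : ℂ) * cis (t * ∑ c ∈ s with ¬ r a c, Y c ω) = 0
  expect_two : ∀ a ∈ s, ∀ b ∈ s, ∀ t : ℝ,
    𝔼 ω, ((Y a ω * Y b ω : ℝ) : ℂ) * cis (t * ∑ c ∈ s with ¬ r a c ∧ ¬ r b c, Y c ω) =
      ((𝔼 ω, Y a ω * Y b ω : ℝ) : ℂ) * 𝔼 ω, cis (t * ∑ c ∈ s with ¬ r a c ∧ ¬ r b c, Y c ω)
  expect_zero : ∀ a ∈ s, ∀ b ∈ s, ¬ r a b → 𝔼 ω, Y a ω * Y b ω = 0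

variable {s Y r} {δ D : ℝ}

theorem abs_sum_le_of_subset (h : LocallyDependent s Y r δ D) {u : Finset ι} {a : ι} (ha : a ∈ s)
    (hu : ∀ b ∈ u, b ∈ s ∧ r a b) (hδ : 0 ≤ δ) (ω : Ω) : |∑ b ∈ u, Y b ω| ≤ D * δ := by
  refine (Finset.abs_sum_le_sum_abs _ _).trans ?_
  refine (Finset.sum_le_card_nsmul _ _ δ fun b hb => h.abs_le b (hu b hb).1 ω).trans ?_
  rw [nsmul_eq_mul]
  refine mul_le_mul_of_nonneg_right (le_trans ?_ (h.card_le a ha)) hδ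
  exact_mod_cast Finset.card_le_card fun b hb => Finset.mem_filter.2 (hu b hb)

/-- The second moment of the sum of a locally dependent family. -/
theorem expect_sq_sum (h : LocallyDependent s Y r δ D) :
    𝔼 ω, (∑ a ∈ s, Y a ω) ^ 2 = ∑ a ∈ s, ∑ b ∈ s with r a b, 𝔼 ω, Y a ω * Y b ω := by
  have h1 : ∀ ω, (∑ a ∈ s, Y a ω) ^ 2 = ∑ a ∈ s, ∑ b ∈ s, Y a ω * Y b ω := fun ω => by
    rw [sq, Finset.sum_mul_sum]
  simp only [h1, Finset.expect_sum_comm]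
  refine Finset.sum_congr rfl fun a ha => ?_
  rw [Finset.sum_filter]
  refine Finset.sum_congr rfl fun b hb => ?_
  split_ifs with hab
  · rfl
  · exact h.expect_zero a ha b hb hab

theorem hasDerivAt_expect_cis (W : Ω → ℝ) (t : ℝ) :
    HasDerivAt (fun t : ℝ => 𝔼 ω, cis (t * W ω))
      (Complex.I * 𝔼 ω, (W ω : ℂ) * cis (t * W ω)) t := by
  have h : ∀ ω, HasDerivAt (fun t : ℝ => cis (t * W ω))
      (Complex.I * ((W ω : ℂ) * cis (t * W ω))) t := by
    intro ω
    have h1 : HasDerivAt (fun t : ℝ => Complex.I * ((t * W ω : ℝ) : ℂ))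
        (Complex.I * ((1 * W ω : ℝ) : ℂ)) t :=
      (((hasDerivAt_id t).mul_const (W ω)).ofReal_comp).const_mul Complex.I
    have h2 := h1.cexp
    refine h2.congr_deriv ?_
    simp only [cis, one_mul]
    ring
  simp only [Fintype.expect_eq_sum_div_card]
  refine ((HasDerivAt.fun_sum fun ω _ => h ω).div_const _).congr_deriv ?_
  rw [← Finset.mul_sum, mul_div_assoc]

variable [Nonempty Ω]

/-- The contribution of one summand to the differential equation for the characteristic function:
the summand `Y a` is decoupled from the variables outside its neighbourhood, and the exponential of
the variables inside is expanded to first order. -/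
theorem stein_single (h : LocallyDependent s Y r δ D) (hδ : 0 ≤ δ) {a : ι} (ha : a ∈ s) (t : ℝ) :
    ‖𝔼 ω, (Y a ω : ℂ) * cis (t * ∑ c ∈ s, Y c ω) -
      Complex.I * t * ((∑ b ∈ s with r a b, 𝔼 ω, Y a ω * Y b ω : ℝ) : ℂ) *
        𝔼 ω, cis (t * ∑ c ∈ s, Y c ω)‖ ≤ 5 * t ^ 2 * D ^ 2 * δ ^ 3 := by
  set U : Ω → ℝ := fun ω => ∑ c ∈ s with ¬ r a c, Y c ω with hU
  set R : Ω → ℝ := fun ω => ∑ c ∈ s with r a c, Y c ω with hR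
  set V : ι → Ω → ℝ := fun b ω => ∑ c ∈ s with ¬ r a c ∧ ¬ r b c, Y c ω with hV
  have hD : 0 ≤ D := (Nat.cast_nonneg _).trans (h.card_le a ha)
  have hW : ∀ ω, ∑ c ∈ s, Y c ω = R ω + U ω := fun ω =>
    (Finset.sum_filter_add_sum_filter_not s _ _).symm
  have hRb : ∀ ω, |R ω| ≤ D * δ := fun ω =>
    abs_sum_le_of_subset h ha (fun b hb => Finset.mem_filter.1 hb) hδ ω
  have hUV : ∀ b ∈ s, ∀ ω, |U ω - V b ω| ≤ D * δ := by
    intro b hb ω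
    have : U ω - V b ω = ∑ c ∈ s with (¬ r a c) ∧ r b c, Y c ω := by
      simp only [hU, hV]
      rw [← Finset.filter_filter, ← Finset.filter_filter,
        ← Finset.sum_filter_add_sum_filter_not (s.filter fun c => ¬ r a c) (fun c => r b c)]
      ring
    rw [this]
    refine abs_sum_le_of_subset h hb (fun c hc => ?_) hδ ω
    rw [Finset.mem_filter] at hc
    exact ⟨hc.1, hc.2.2⟩
  -- first replacement: `Y a * cis (t W)` by `Y a * (i t R) * cis (t U)`
  have hA : ‖𝔼 ω, (Y a ω : ℂ) * cis (t * ∑ c ∈ s, Y c ω) -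
      𝔼 ω, (Y a ω : ℂ) * (Complex.I * (t * R ω : ℝ)) * cis (t * U ω)‖ ≤
        2 * t ^ 2 * D ^ 2 * δ ^ 3 := by
    have h0 : 𝔼 ω, (Y a ω : ℂ) * (Complex.I * (t * R ω : ℝ)) * cis (t * U ω) =
        𝔼 ω, ((Y a ω : ℂ) * (Complex.I * (t * R ω : ℝ)) * cis (t * U ω) +
          (Y a ω : ℂ) * cis (t * U ω)) := by
      rw [Finset.expect_add_distrib, h.expect_one a ha t, add_zero]
    rw [h0]
    refine norm_expect_sub_expect_le fun ω => ?_
    rw [hW ω, mul_add, cis_add]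
    have : (Y a ω : ℂ) * (cis (t * R ω) * cis (t * U ω)) -
        ((Y a ω : ℂ) * (Complex.I * (t * R ω : ℝ)) * cis (t * U ω) +
          (Y a ω : ℂ) * cis (t * U ω)) =
        (Y a ω : ℂ) * (cis (t * R ω) - 1 - Complex.I * (t * R ω : ℝ)) * cis (t * U ω) := by ring
    rw [this, norm_mul, norm_mul, norm_cis, mul_one, Complex.norm_real, Real.norm_eq_abs]
    have h1 := norm_cis_sub_one_sub_le (t * R ω)
    have h2 : (R ω) ^ 2 ≤ (D * δ) ^ 2 := sq_le_sq' (abs_le.1 (hRb ω)).1 (abs_le.1 (hRb ω)).2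
    calc |Y a ω| * ‖cis (t * R ω) - 1 - Complex.I * (t * R ω : ℝ)‖
        ≤ δ * (2 * (t ^ 2 * (D * δ) ^ 2)) := by
          refine mul_le_mul (h.abs_le a ha ω) (h1.trans ?_) (norm_nonneg _) hδ
          rw [mul_pow]
          gcongr
      _ = _ := by ring
  -- second replacement, term by term: decouple `Y a * Y b` from the rest
  have hB : ∀ b ∈ s, ‖𝔼 ω, ((Y a ω * Y b ω : ℝ) : ℂ) * cis (t * U ω) -
      ((𝔼 ω, Y a ω * Y b ω : ℝ) : ℂ) * 𝔼 ω, cis (t * ∑ c ∈ s, Y c ω)‖ ≤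
        3 * |t| * D * δ ^ 3 := by
    intro b hb
    have hyy : ∀ ω, |Y a ω * Y b ω| ≤ δ ^ 2 := fun ω => by
      rw [abs_mul, sq]
      exact mul_le_mul (h.abs_le a ha ω) (h.abs_le b hb ω) (abs_nonneg _) hδ
    have e1 : ‖𝔼 ω, ((Y a ω * Y b ω : ℝ) : ℂ) * cis (t * U ω) -
        𝔼 ω, ((Y a ω * Y b ω : ℝ) : ℂ) * cis (t * V b ω)‖ ≤ δ ^ 2 * (|t| * (D * δ)) := by
      refine norm_expect_sub_expect_le fun ω => ?_
      rw [← mul_sub, norm_mul, Complex.norm_real, Real.norm_eq_abs]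
      refine mul_le_mul (hyy ω) ((norm_cis_sub_cis_le _ _).trans ?_) (norm_nonneg _)
        (by positivity)
      rw [← mul_sub, abs_mul]
      gcongr
      exact hUV b hb ω
    have e2 : ‖(𝔼 ω, cis (t * V b ω)) - 𝔼 ω, cis (t * ∑ c ∈ s, Y c ω)‖ ≤
        |t| * (2 * (D * δ)) := by
      refine norm_expect_sub_expect_le fun ω => (norm_cis_sub_cis_le _ _).trans ?_
      rw [← mul_sub, abs_mul, hW ω]
      gcongr
      have := abs_le.1 (hUV b hb ω)
      have := abs_le.1 (hRb ω)
      rw [abs_le]; constructor <;> linarith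
    have e3 : ‖((𝔼 ω, Y a ω * Y b ω : ℝ) : ℂ)‖ ≤ δ ^ 2 := by
      rw [Complex.norm_real, Real.norm_eq_abs]
      exact (Finset.abs_expect_le _ _).trans
        (Finset.expect_le Finset.univ_nonempty fun ω _ => hyy ω)
    rw [h.expect_two a ha b hb t] at e1
    have e4 : ‖((𝔼 ω, Y a ω * Y b ω : ℝ) : ℂ) * (𝔼 ω, cis (t * V b ω)) -
        ((𝔼 ω, Y a ω * Y b ω : ℝ) : ℂ) * 𝔼 ω, cis (t * ∑ c ∈ s, Y c ω)‖ ≤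
        δ ^ 2 * (|t| * (2 * (D * δ))) := by
      rw [← mul_sub, norm_mul]
      exact mul_le_mul e3 e2 (norm_nonneg _) (by positivity)
    refine (norm_sub_le_norm_sub_add_norm_sub _ _ _).trans ((add_le_add e1 e4).trans (le_of_eq ?_))
    ring
  have hC : 𝔼 ω, (Y a ω : ℂ) * (Complex.I * (t * R ω : ℝ)) * cis (t * U ω) =
      Complex.I * t * ∑ b ∈ s with r a b, 𝔼 ω, ((Y a ω * Y b ω : ℝ) : ℂ) * cis (t * U ω) := by
    rw [← Finset.expect_sum_comm, Finset.mul_expect]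
    refine Finset.expect_congr rfl fun ω _ => ?_
    simp only [hR]
    push_cast
    simp only [Finset.mul_sum, Finset.sum_mul]
    refine Finset.sum_congr rfl fun b _ => ?_
    ring
  have hE : ‖𝔼 ω, (Y a ω : ℂ) * (Complex.I * (t * R ω : ℝ)) * cis (t * U ω) -
      Complex.I * t * ((∑ b ∈ s with r a b, 𝔼 ω, Y a ω * Y b ω : ℝ) : ℂ) *
        𝔼 ω, cis (t * ∑ c ∈ s, Y c ω)‖ ≤ |t| * (D * (3 * |t| * D * δ ^ 3)) := by
    rw [hC, mul_assoc (Complex.I * (t : ℂ)), ← mul_sub, norm_mul, norm_mul, Complex.norm_I,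
      one_mul, Complex.norm_real, Real.norm_eq_abs, Complex.ofReal_sum, Finset.sum_mul,
      ← Finset.sum_sub_distrib]
    refine mul_le_mul_of_nonneg_left ?_ (abs_nonneg t)
    refine (norm_sum_le_of_le _ fun b hb => hB b (Finset.mem_filter.1 hb).1).trans ?_
    rw [Finset.sum_const, nsmul_eq_mul]
    exact mul_le_mul_of_nonneg_right (h.card_le a ha) (by positivity)
  refine (norm_sub_le_norm_sub_add_norm_sub _ _ _).trans ((add_le_add hA hE).trans (le_of_eq ?_))
  rw [← sq_abs t]
  ring

/-- Stein's method for characteristic functions: since `φ' = -t v φ` up to a small error, `φ` is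
close to the characteristic function of the Gaussian law with the same variance. -/
theorem norm_expect_cis_sub_gaussian_le (h : LocallyDependent s Y r δ D) (hδ : 0 ≤ δ) (t : ℝ) :
    ‖𝔼 ω, cis (t * ∑ c ∈ s, Y c ω) -
      Complex.exp (-((𝔼 ω, (∑ c ∈ s, Y c ω) ^ 2 : ℝ) : ℂ) * t ^ 2 / 2)‖ ≤
        5 * s.card * D ^ 2 * δ ^ 3 * |t| ^ 3 := by
  set φ : ℝ → ℂ := fun t => 𝔼 ω, cis (t * ∑ c ∈ s, Y c ω) with hφ
  set v : ℝ := 𝔼 ω, (∑ c ∈ s, Y c ω) ^ 2 with hv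
  have hv0 : 0 ≤ v := Finset.expect_nonneg fun ω _ => sq_nonneg _
  set φ' : ℝ → ℂ := fun t =>
    Complex.I * 𝔼 ω, ((∑ c ∈ s, Y c ω : ℝ) : ℂ) * cis (t * ∑ c ∈ s, Y c ω) with hφ'
  have hder : ∀ t, HasDerivAt φ (φ' t) t := hasDerivAt_expect_cis _
  set K : ℝ := 5 * s.card * D ^ 2 * δ ^ 3 with hK
  have hK0 : 0 ≤ K := by positivity
  have hode : ∀ u, ‖φ' u + v * u * φ u‖ ≤ K * u ^ 2 := by
    intro u
    have h1 : φ' u + v * u * φ u = Complex.I * ∑ a ∈ s,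
        (𝔼 ω, (Y a ω : ℂ) * cis (u * ∑ c ∈ s, Y c ω) -
        Complex.I * u * ((∑ b ∈ s with r a b, 𝔼 ω, Y a ω * Y b ω : ℝ) : ℂ) *
        𝔼 ω, cis (u * ∑ c ∈ s, Y c ω)) := by
      rw [Finset.sum_sub_distrib, ← Finset.sum_mul, ← Finset.mul_sum, ← Complex.ofReal_sum,
        ← expect_sq_sum h, ← Finset.expect_sum_comm, mul_sub]
      have h2 : Complex.I * (Complex.I * u * (v : ℂ) * φ u) = -(v * u * φ u) := by
        linear_combination (u * v * φ u : ℂ) * Complex.I_mul_I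
      rw [h2, sub_neg_eq_add]
      congr 1
      simp only [hφ']
      congr 1
      refine Finset.expect_congr rfl fun ω _ => ?_
      rw [Complex.ofReal_sum, Finset.sum_mul]
    rw [h1, norm_mul, Complex.norm_I, one_mul]
    refine (norm_sum_le_of_le _ fun a ha => stein_single h hδ ha u).trans (le_of_eq ?_)
    rw [Finset.sum_const, nsmul_eq_mul, hK]
    ring
  -- integrate along the segment from `0` to `t`
  set g : ℝ → ℂ := fun x => φ (x * t) * Complex.exp ((v * (x * t) ^ 2 / 2 : ℝ) : ℂ) with hg
  have hgder : ∀ x, HasDerivAt g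
      (t * (φ' (x * t) + v * (x * t : ℝ) * φ (x * t)) *
        Complex.exp ((v * (x * t) ^ 2 / 2 : ℝ) : ℂ)) x := by
    intro x
    have h1 : HasDerivAt (fun x : ℝ => φ (x * t)) (t * φ' (x * t)) x := by
      have := (hder (x * t)).scomp x ((hasDerivAt_id x).mul_const t)
      refine this.congr_deriv ?_
      simp
    have h2 : HasDerivAt (fun x : ℝ => v * (x * t) ^ 2 / 2) (v * (x * t) * t) x := by
      have := (((((hasDerivAt_id x).mul_const t).pow 2).const_mul v).div_const 2)
      refine this.congr_deriv ?_
      simp; ring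
    refine (h1.mul h2.ofReal_comp.cexp).congr_deriv ?_
    push_cast
    ring
  have hbound : ‖g 1 - g 0‖ ≤ |t| * (K * t ^ 2) * Real.exp (v * t ^ 2 / 2) := by
    refine norm_image_sub_le_of_norm_deriv_le_segment_01'
      (fun x _ => (hgder x).hasDerivWithinAt) fun x hx => ?_
    rw [norm_mul, norm_mul, Complex.norm_real, Real.norm_eq_abs, ← Complex.ofReal_exp,
      Complex.norm_real, Real.norm_eq_abs, Real.abs_exp]
    have hx2 : (x * t) ^ 2 ≤ t ^ 2 := by
      rw [mul_pow]
      exact mul_le_of_le_one_left (sq_nonneg t) (pow_le_one₀ hx.1 hx.2.le)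
    have h1 : ‖φ' (x * t) + v * (x * t : ℝ) * φ (x * t)‖ ≤ K * t ^ 2 :=
      (hode (x * t)).trans (by gcongr)
    gcongr
  have hg0 : g 0 = 1 := by simp [hg, hφ, cis_zero]
  have hg1 : φ t - Complex.exp (-(v : ℂ) * t ^ 2 / 2) =
      (g 1 - g 0) * Complex.exp (-(v : ℂ) * t ^ 2 / 2) := by
    rw [hg0, sub_mul, one_mul]
    congr 1
    simp only [hg, one_mul, mul_assoc, ← Complex.exp_add]
    push_cast
    rw [show (v : ℂ) * t ^ 2 / 2 + -(v : ℂ) * t ^ 2 / 2 = 0 by ring]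
    simp
  have hexp : ‖Complex.exp (-(v : ℂ) * t ^ 2 / 2)‖ = Real.exp (-(v * t ^ 2 / 2)) := by
    rw [show -(v : ℂ) * t ^ 2 / 2 = ((-(v * t ^ 2 / 2) : ℝ) : ℂ) by push_cast; ring,
      ← Complex.ofReal_exp, Complex.norm_real, Real.norm_eq_abs, Real.abs_exp]
  change ‖φ t - _‖ ≤ _
  rw [hg1, norm_mul, hexp]
  refine (mul_le_mul_of_nonneg_right hbound (Real.exp_pos _).le).trans (le_of_eq ?_)
  rw [mul_assoc, ← Real.exp_add, add_neg_cancel, Real.exp_zero, ← sq_abs t]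
  ring

end Stein

/-! ### Normal approximation for the number of occurrences -/

/-- The indicator, as a function of `σ`, that the values of `σ` at the positions `i` are in the same
relative order as `τ`. -/
def occInd {p n : ℕ} (τ : Equiv.Perm (Fin p)) (i : Fin p → Fin n) (σ : Equiv.Perm (Fin n)) : ℝ :=
  if ∀ a b : Fin p, σ (i a) < σ (i b) ↔ τ a < τ b then 1 else 0

/-- The number of occurrences in `σ` of the vincular pattern with permutation `τ` and adjacency
set `X`, as a real number. -/
def occ {p n : ℕ} (τ : Equiv.Perm (Fin p)) (X : Finset ℕ) (σ : Equiv.Perm (Fin n)) : ℝ :=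
  ∑ i ∈ Pos X p n, occInd τ i σ

theorem numOccurrences_eq_occ {p n : ℕ} (v : VincularPattern p) (σ : Equiv.Perm (Fin n)) :
    (numOccurrences v σ : ℝ) = occ v.perm v.adj σ := by
  simp only [numOccurrences, occ, occInd, Finset.sum_boole, Nat.cast_inj, Pos,
    Finset.filter_filter]
  congr 1
  ext i
  rw [Finset.mem_filter, Finset.mem_filter]
  simp only [IsOccurrence, and_assoc]

theorem occInd_nonneg {p n : ℕ} (τ : Equiv.Perm (Fin p)) (i : Fin p → Fin n)
    (σ : Equiv.Perm (Fin n)) : 0 ≤ occInd τ i σ := by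
  unfold occInd; split_ifs <;> simp

theorem occInd_le_one {p n : ℕ} (τ : Equiv.Perm (Fin p)) (i : Fin p → Fin n)
    (σ : Equiv.Perm (Fin n)) : occInd τ i σ ≤ 1 := by
  unfold occInd; split_ifs <;> simp

theorem occInd_eq_pat {p n : ℕ} (τ : Equiv.Perm (Fin p)) {i : Fin p → Fin n}
    (hi : Function.Injective i) (σ : Equiv.Perm (Fin n)) :
    occInd τ i σ = if pat (σ ∘ i) = τ then 1 else 0 := by
  unfold occInd
  simp only [pat_eq_iff (σ.injective.comp hi), Function.comp_apply]

theorem orderDet_occInd {p n : ℕ} (τ : Equiv.Perm (Fin p)) (i : Fin p → Fin n) :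
    OrderDet (Finset.univ.image i) (occInd τ i) := by
  intro σ σ' h
  have h' : ∀ a b, σ (i a) < σ (i b) ↔ σ' (i a) < σ' (i b) := fun a b =>
    h _ (Finset.mem_image_of_mem _ (Finset.mem_univ _)) _
      (Finset.mem_image_of_mem _ (Finset.mem_univ _))
  simp only [occInd, h']

theorem expect_occInd {p n : ℕ} (τ : Equiv.Perm (Fin p)) {i : Fin p → Fin n}
    (hi : Function.Injective i) :
    𝔼 σ : Equiv.Perm (Fin n), occInd τ i σ = 1 / (p.factorial : ℝ) := by
  simp only [occInd_eq_pat τ hi]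
  have := expect_pat (𝕜 := ℝ) ⟨i, hi⟩ (fun w => if w = τ then (1 : ℝ) else 0)
  simp only [Function.Embedding.coeFn_mk] at this
  rw [this, Fintype.expect_eq_sum_div_card]
  simp [Fintype.card_perm]

theorem expect_occ {p : ℕ} (τ : Equiv.Perm (Fin p)) {X : Finset ℕ}
    (hX : X ⊆ Finset.Icc 1 (p - 1)) (n : ℕ) :
    𝔼 σ : Equiv.Perm (Fin n), occ τ X σ =
      ((n - X.card).choose (p - X.card) : ℝ) / (p.factorial : ℝ) := by
  simp only [occ]
  rw [Finset.expect_sum_comm, Finset.sum_congr rfl fun i hi =>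
    expect_occInd τ (Pos.strictMono hi).injective, Finset.sum_const, card_Pos hX, nsmul_eq_mul]
  ring

/-- The variance of the number of occurrences in a uniform permutation of `Fin n`. -/
noncomputable def occVar {p : ℕ} (τ : Equiv.Perm (Fin p)) (X : Finset ℕ) (n : ℕ) : ℝ :=
  𝔼 σ : Equiv.Perm (Fin n), (occ τ X σ - 𝔼 σ' : Equiv.Perm (Fin n), occ τ X σ') ^ 2

section LocalDependence

variable {p n : ℕ} (τ : Equiv.Perm (Fin p)) (X : Finset ℕ) (c : ℝ)

/-- The centred indicator of an occurrence at `i`, scaled by `c`. -/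
noncomputable def centredInd (i : Fin p → Fin n) (σ : Equiv.Perm (Fin n)) : ℝ :=
  c * (occInd τ i σ - 1 / (p.factorial : ℝ))

theorem orderDet_centredInd (i : Fin p → Fin n) :
    OrderDet (Finset.univ.image i) (centredInd τ c i) := fun σ σ' h => by
  simp only [centredInd, orderDet_occInd τ i σ σ' h]

theorem sum_centredInd (hX : X ⊆ Finset.Icc 1 (p - 1)) (σ : Equiv.Perm (Fin n)) :
    ∑ i ∈ Pos X p n, centredInd τ c i σ =
      c * (occ τ X σ - 𝔼 σ' : Equiv.Perm (Fin n), occ τ X σ') := by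
  simp only [centredInd]
  rw [expect_occ τ hX, ← card_Pos hX, ← Finset.mul_sum, Finset.sum_sub_distrib, Finset.sum_const,
    nsmul_eq_mul, occ]
  ring

theorem expect_centredInd {i : Fin p → Fin n} (hi : Function.Injective i) :
    𝔼 σ, centredInd τ c i σ = 0 := by
  simp only [centredInd]
  rw [← Finset.mul_expect, Finset.expect_sub_distrib, expect_occInd τ hi, Fintype.expect_const]
  simp

theorem not_meet_iff {i j : Fin p → Fin n} :
    (¬ ∃ a, i a ∈ Finset.univ.image j) ↔
      Disjoint (Finset.univ.image i) (Finset.univ.image j) := by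
  rw [Finset.disjoint_left]
  simp

/-- Two indicators are neighbours if their position words meet. -/
theorem locallyDependent_centredInd (hX : X ⊆ Finset.Icc 1 (p - 1)) (hc : 0 ≤ c) :
    LocallyDependent (Pos X p n) (centredInd τ c (n := n))
      (fun i j => ∃ a, j a ∈ Finset.univ.image i) c (p * p * (n : ℝ) ^ (p - X.card - 1)) where
  abs_le i hi σ := by
    have h1 : (1 : ℝ) / p.factorial ≤ 1 := by
      rw [div_le_one (by positivity)]
      exact_mod_cast Nat.one_le_iff_ne_zero.2 p.factorial_ne_zero
    have h2 : (0 : ℝ) ≤ 1 / p.factorial := by positivity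
    rw [centredInd, abs_mul, abs_of_nonneg hc]
    refine mul_le_of_le_one_right hc ?_
    rw [abs_le]
    constructor <;> linarith [occInd_nonneg τ i σ, occInd_le_one τ i σ]
  card_le i hi := by
    have := card_Pos_meet_le hX (Finset.univ.image i)
    rw [Finset.card_image_of_injective _ (Pos.strictMono hi).injective, Finset.card_univ,
      Fintype.card_fin] at this
    exact_mod_cast this
  expect_one i hi t := by
    have hf : OrderDet (Finset.univ.image i) fun σ => (centredInd τ c i σ : ℂ) := fun σ σ' h => by
      simp only [orderDet_centredInd τ c i σ σ' h]
    rw [expect_mul_of_orderDet hf]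
    · rw [← Complex.ofReal_expect, expect_centredInd τ c (Pos.strictMono hi).injective]
      simp
    · intro σ ρ hρ
      congr 2
      refine Finset.sum_congr rfl fun j hj => ?_
      exact (orderDet_centredInd τ c j).mul_right
        (not_meet_iff.1 (Finset.mem_filter.1 hj).2).symm σ ρ hρ
  expect_two i hi j hj t := by
    have hf : OrderDet (Finset.univ.image i ∪ Finset.univ.image j)
        fun σ => ((centredInd τ c i σ * centredInd τ c j σ : ℝ) : ℂ) := fun σ σ' h => by
      simp only [orderDet_centredInd τ c i σ σ' fun a ha b hb => h a (Finset.mem_union_left _ ha)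
          b (Finset.mem_union_left _ hb),
        orderDet_centredInd τ c j σ σ' fun a ha b hb => h a (Finset.mem_union_right _ ha)
          b (Finset.mem_union_right _ hb)]
    rw [expect_mul_of_orderDet hf, Complex.ofReal_expect]
    intro σ ρ hρ
    congr 2
    refine Finset.sum_congr rfl fun k hk => ?_
    have hk' := (Finset.mem_filter.1 hk).2
    exact (orderDet_centredInd τ c k).mul_right (Finset.disjoint_union_left.2
      ⟨(not_meet_iff.1 hk'.1).symm, (not_meet_iff.1 hk'.2).symm⟩) σ ρ hρ
  expect_zero i hi j hj hij := by
    rw [expect_mul_of_disjoint (orderDet_centredInd τ c i) (orderDet_centredInd τ c j)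
      (not_meet_iff.1 hij).symm, expect_centredInd τ c (Pos.strictMono hi).injective, zero_mul]

/-- Quantitative normal approximation for the number of occurrences in a uniform permutation. -/
theorem norm_expect_cis_occ_sub_le (hX : X ⊆ Finset.Icc 1 (p - 1)) (hc : 0 ≤ c) (t : ℝ) :
    ‖𝔼 σ : Equiv.Perm (Fin n),
        cis (t * (c * (occ τ X σ - 𝔼 σ' : Equiv.Perm (Fin n), occ τ X σ'))) -
      Complex.exp (-((c ^ 2 * occVar τ X n : ℝ) : ℂ) * t ^ 2 / 2)‖ ≤
      5 * (n : ℝ) ^ (p - X.card) * (p * p * (n : ℝ) ^ (p - X.card - 1)) ^ 2 * c ^ 3 * |t| ^ 3 := by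
  have h := norm_expect_cis_sub_gaussian_le (locallyDependent_centredInd (n := n) τ X c hX hc) hc t
  simp only [sum_centredInd τ X c hX, mul_pow c] at h
  rw [← Finset.mul_expect] at h
  refine h.trans ?_
  have : ((Pos X p n).card : ℝ) ≤ (n : ℝ) ^ (p - X.card) := by exact_mod_cast card_Pos_le hX n
  gcongr

/-- Only the pairs of position words that meet contribute to the variance. -/
theorem occVar_le (hX : X ⊆ Finset.Icc 1 (p - 1)) :
    occVar τ X n ≤ (n : ℝ) ^ (p - X.card) * (p * p * (n : ℝ) ^ (p - X.card - 1)) := by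
  have h := locallyDependent_centredInd (n := n) τ X 1 hX zero_le_one
  have h1 := expect_sq_sum h
  simp only [sum_centredInd τ X 1 hX, one_mul] at h1
  rw [occVar, h1]
  have h2 : ∀ i ∈ Pos X p n, ∑ j ∈ Pos X p n with (∃ a, j a ∈ Finset.univ.image i),
      𝔼 σ, centredInd τ 1 i σ * centredInd τ 1 j σ ≤ p * p * (n : ℝ) ^ (p - X.card - 1) := by
    intro i hi
    refine (Finset.sum_le_card_nsmul _ _ 1 fun j hj => ?_).trans ?_
    · refine Finset.expect_le Finset.univ_nonempty fun σ _ => (le_abs_self _).trans ?_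
      rw [abs_mul]
      exact mul_le_one₀ (h.abs_le i hi σ) (abs_nonneg _)
        (h.abs_le j (Finset.mem_filter.1 hj).1 σ)
    · rw [nsmul_eq_mul, mul_one]
      exact h.card_le i hi
  refine (Finset.sum_le_card_nsmul _ _ _ h2).trans ?_
  rw [nsmul_eq_mul]
  have : ((Pos X p n).card : ℝ) ≤ (n : ℝ) ^ (p - X.card) := by exact_mod_cast card_Pos_le hX n
  gcongr

end LocalDependence

/-! ### Existence of the limiting variance -/

/-- The adjacencies that two position words `i`, `j` of a pattern with adjacency set `X` impose on
the positions they use. -/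
def linkSet {p u : ℕ} (X : Finset ℕ) (i j : Fin p → Fin u) : Finset ℕ :=
  ((Finset.univ.filter fun a : Fin p => (a : ℕ) + 1 ∈ X).image fun a => (i a : ℕ) + 1) ∪
    (Finset.univ.filter fun a : Fin p => (a : ℕ) + 1 ∈ X).image fun a => (j a : ℕ) + 1

theorem mem_linkSet {p u : ℕ} {X : Finset ℕ} {i j : Fin p → Fin u} {x : ℕ} :
    x ∈ linkSet X i j ↔ ∃ a : Fin p, (a : ℕ) + 1 ∈ X ∧ ((i a : ℕ) + 1 = x ∨ (j a : ℕ) + 1 = x) := by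
  simp only [linkSet, Finset.mem_union, Finset.mem_image, Finset.mem_filter, Finset.mem_univ,
    true_and]
  constructor
  · rintro (⟨a, h, h'⟩ | ⟨a, h, h'⟩)
    exacts [⟨a, h, Or.inl h'⟩, ⟨a, h, Or.inr h'⟩]
  · rintro ⟨a, h, h' | h'⟩
    exacts [Or.inl ⟨a, h, h'⟩, Or.inr ⟨a, h, h'⟩]

theorem linkSet_subset {p u : ℕ} {X : Finset ℕ} (hX : X ⊆ Finset.Icc 1 (p - 1))
    {i j : Fin p → Fin u} (hi : i ∈ Pos X p u) (hj : j ∈ Pos X p u) :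
    linkSet X i j ⊆ Finset.Icc 1 (u - 1) := by
  intro x hx
  obtain ⟨a, ha, h⟩ := mem_linkSet.1 hx
  have ha' := Finset.mem_Icc.1 (hX ha)
  have h1 := (mem_Pos.1 hi).2 a ⟨a + 1, by omega⟩ ha rfl
  have h2 := (mem_Pos.1 hj).2 a ⟨a + 1, by omega⟩ ha rfl
  have h3 := (i ⟨a + 1, by omega⟩).2
  have h4 := (j ⟨a + 1, by omega⟩).2
  rw [Finset.mem_Icc]
  omega

/-- The pairs of position words in `Fin u` that together use every position. -/
def coveringPairs (X : Finset ℕ) (p u : ℕ) : Finset ((Fin p → Fin u) × (Fin p → Fin u)) :=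
  (Pos X p u ×ˢ Pos X p u).filter fun t => ∀ y, (∃ a, t.1 a = y) ∨ ∃ a, t.2 a = y

/-- The set of positions used by a pair of position words. -/
def usedPos {p n : ℕ} (z : (Fin p → Fin n) × (Fin p → Fin n)) : Finset (Fin n) :=
  Finset.univ.image z.1 ∪ Finset.univ.image z.2

theorem Pos_comp {p u n : ℕ} {X L : Finset ℕ} {i : Fin p → Fin u} {e : Fin u → Fin n}
    (hi : i ∈ Pos X p u) (he : e ∈ Pos L u n)
    (hL : ∀ a : Fin p, (a : ℕ) + 1 ∈ X → (i a : ℕ) + 1 ∈ L) : e ∘ i ∈ Pos X p n :=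
  mem_Pos.2 ⟨fun a b h => (mem_Pos.1 he).1 _ _ ((mem_Pos.1 hi).1 a b h),
    fun a b ha hb => (mem_Pos.1 he).2 _ _ (hL a ha) ((mem_Pos.1 hi).2 a b ha hb)⟩

theorem Pos_of_comp {p u n : ℕ} {X : Finset ℕ} {i : Fin p → Fin u} {e : Fin u → Fin n}
    (he : StrictMono e) (hi : e ∘ i ∈ Pos X p n) : i ∈ Pos X p u := by
  refine mem_Pos.2 ⟨fun a b h => he.lt_iff_lt.1 ((mem_Pos.1 hi).1 a b h), fun a b ha hb => ?_⟩
  have h1 := (mem_Pos.1 hi).2 a b ha hb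
  have h2 : i a < i b := he.lt_iff_lt.1
    ((mem_Pos.1 hi).1 a b (by rw [Fin.lt_def]; omega))
  by_contra h3
  have hlt : (i a : ℕ) + 1 < i b := by rw [Fin.lt_def] at h2; omega
  have h4 : e (i a) < e ⟨i a + 1, by omega⟩ := he (by rw [Fin.lt_def]; simp)
  have h5 : e ⟨i a + 1, by omega⟩ < e (i b) := he (by rw [Fin.lt_def]; simpa using hlt)
  simp only [Function.comp_apply] at h1
  rw [Fin.lt_def] at h4 h5
  omega

theorem usedPos_comp {p u n : ℕ} {X : Finset ℕ} {t : (Fin p → Fin u) × (Fin p → Fin u)}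
    (ht : t ∈ coveringPairs X p u) (e : Fin u → Fin n) :
    usedPos (e ∘ t.1, e ∘ t.2) = Finset.univ.image e := by
  have h := (Finset.mem_filter.1 ht).2
  ext x
  simp only [usedPos, Finset.mem_union, Finset.mem_image, Finset.mem_univ, true_and,
    Function.comp_apply]
  constructor
  · rintro (⟨a, rfl⟩ | ⟨a, rfl⟩)
    exacts [⟨_, rfl⟩, ⟨_, rfl⟩]
  · rintro ⟨y, rfl⟩
    rcases h y with ⟨a, rfl⟩ | ⟨a, rfl⟩
    exacts [Or.inl ⟨a, rfl⟩, Or.inr ⟨a, rfl⟩]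

/-- A sum over the pairs of position words that use `u` positions, arranged by the relative
position of the two words. -/
theorem sum_pairs_of_card {p : ℕ} {X : Finset ℕ} (hX : X ⊆ Finset.Icc 1 (p - 1)) (n u : ℕ)
    (f : (Fin p → Fin n) × (Fin p → Fin n) → ℝ) :
    ∑ z ∈ (Pos X p n ×ˢ Pos X p n) with (usedPos z).card = u, f z =
      ∑ t ∈ coveringPairs X p u, ∑ e ∈ Pos (linkSet X t.1 t.2) u n, f (e ∘ t.1, e ∘ t.2) := by
  rw [Finset.sum_sigma']
  symm
  refine Finset.sum_bij (fun w _ => (w.2 ∘ w.1.1, w.2 ∘ w.1.2)) ?_ ?_ ?_ ?_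
  · rintro ⟨⟨i, j⟩, e⟩ hw
    obtain ⟨ht, he⟩ := Finset.mem_sigma.1 hw
    have ht' := Finset.mem_product.1 (Finset.mem_filter.1 ht).1
    rw [Finset.mem_filter, Finset.mem_product]
    refine ⟨⟨Pos_comp (i := i) (e := e) ht'.1 he fun a ha => mem_linkSet.2 ⟨a, ha, Or.inl rfl⟩,
      Pos_comp (i := j) (e := e) ht'.2 he fun a ha => mem_linkSet.2 ⟨a, ha, Or.inr rfl⟩⟩, ?_⟩
    rw [usedPos_comp ht, Finset.card_image_of_injective _ (Pos.strictMono he).injective]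
    simp
  · rintro ⟨⟨i, j⟩, e⟩ hw ⟨⟨i', j'⟩, e'⟩ hw' h
    obtain ⟨ht, he⟩ := Finset.mem_sigma.1 hw
    obtain ⟨ht', he'⟩ := Finset.mem_sigma.1 hw'
    -- an increasing `e` is determined by its range, which is the set of used positions
    have hee : e = e' := by
      have h1 := usedPos_comp ht e
      have h2 := usedPos_comp ht' e'
      simp only at h h1 h2
      rw [h, h2] at h1
      refine (StrictMono.range_inj (Pos.strictMono he) (Pos.strictMono he')).1 ?_
      ext x
      have := Finset.ext_iff.1 h1 x
      simpa using this.symm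
    subst hee
    have hinj := (Pos.strictMono he).injective
    simp only [Prod.mk.injEq] at h
    have h1 : i = i' := hinj.comp_left h.1
    have h2 : j = j' := hinj.comp_left h.2
    rw [h1, h2]
  · rintro ⟨i, j⟩ hz
    rw [Finset.mem_filter, Finset.mem_product] at hz
    obtain ⟨⟨hi, hj⟩, hu⟩ := hz
    simp only at hi hj
    let e := (usedPos (i, j)).orderEmbOfFin hu
    have he : StrictMono e := e.strictMono
    have hr : ∀ x, x ∈ usedPos (i, j) ↔ ∃ y, e y = x := by
      intro x
      have := Finset.range_orderEmbOfFin (usedPos (i, j)) hu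
      rw [← Finset.mem_coe, ← this]
      rfl
    have h1 : ∀ a, ∃ y, e y = i a := fun a => (hr _).1 (by simp [usedPos])
    have h2 : ∀ a, ∃ y, e y = j a := fun a => (hr _).1 (by simp [usedPos])
    choose i' hi' using h1
    choose j' hj' using h2
    have hi'' : e ∘ i' = i := funext hi'
    have hj'' : e ∘ j' = j := funext hj'
    have hiP : i' ∈ Pos X p u := Pos_of_comp he (hi''.symm ▸ hi)
    have hjP : j' ∈ Pos X p u := Pos_of_comp he (hj''.symm ▸ hj)
    refine ⟨⟨(i', j'), e⟩, ?_, by simp only [hi'', hj'']⟩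
    rw [Finset.mem_sigma]
    refine ⟨Finset.mem_filter.2 ⟨Finset.mem_product.2 ⟨hiP, hjP⟩, fun y => ?_⟩, ?_⟩
    · have := (hr (e y)).2 ⟨y, rfl⟩
      simp only [usedPos, Finset.mem_union, Finset.mem_image, Finset.mem_univ, true_and] at this
      rcases this with ⟨a, ha⟩ | ⟨a, ha⟩
      · exact Or.inl ⟨a, he.injective ((hi' a).trans ha)⟩
      · exact Or.inr ⟨a, he.injective ((hj' a).trans ha)⟩
    · refine mem_Pos.2 ⟨fun a b h => he h, fun y y' hy hyy => ?_⟩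
      obtain ⟨a, ha, h⟩ := mem_linkSet.1 hy
      have ha' := Finset.mem_Icc.1 (hX ha)
      have hap : (a : ℕ) + 1 < p := by omega
      rcases h with h | h
      · have hya : y = i' a := by ext; simp only at h; omega
        have hyb : y' = i' ⟨a + 1, hap⟩ := by
          ext
          have := (mem_Pos.1 hiP).2 a ⟨a + 1, hap⟩ ha rfl
          rw [this, hyy, hya]
        have := (mem_Pos.1 hi).2 a ⟨a + 1, hap⟩ ha rfl
        simp only [hya, hyb, hi', this]
      · have hya : y = j' a := by ext; simp only at h; omega
        have hyb : y' = j' ⟨a + 1, hap⟩ := by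
          ext
          have := (mem_Pos.1 hjP).2 a ⟨a + 1, hap⟩ ha rfl
          rw [this, hyy, hya]
        have := (mem_Pos.1 hj).2 a ⟨a + 1, hap⟩ ha rfl
        simp only [hya, hyb, hj', this]
  · intro w _
    rfl

theorem occInd_comp {p u n : ℕ} (τ : Equiv.Perm (Fin p)) (i : Fin p → Fin u) {e : Fin u → Fin n}
    (he : Function.Injective e) (σ : Equiv.Perm (Fin n)) :
    occInd τ (e ∘ i) σ = occInd τ i (pat (σ ∘ e)) := by
  simp only [occInd, pat_lt_iff (σ.injective.comp he), Function.comp_apply]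

theorem card_usedPos_le {p n : ℕ} (z : (Fin p → Fin n) × (Fin p → Fin n)) :
    (usedPos z).card ≤ 2 * p := by
  refine (Finset.card_union_le _ _).trans ?_
  have h1 := Finset.card_image_le (s := Finset.univ) (f := z.1)
  have h2 := Finset.card_image_le (s := Finset.univ) (f := z.2)
  simp only [Finset.card_univ, Fintype.card_fin] at h1 h2
  omega

/-- The second moment of the number of occurrences: the relative position `t` of two position words
determines the probability that both are occurrences, and the number of pairs of words with the
relative position `t` is a binomial coefficient. -/
theorem expect_occ_sq {p : ℕ} (τ : Equiv.Perm (Fin p)) {X : Finset ℕ}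
    (hX : X ⊆ Finset.Icc 1 (p - 1)) (n : ℕ) :
    𝔼 σ : Equiv.Perm (Fin n), occ τ X σ ^ 2 =
      ∑ u ∈ Finset.range (2 * p + 1), ∑ t ∈ coveringPairs X p u,
        (𝔼 w : Equiv.Perm (Fin u), occInd τ t.1 w * occInd τ t.2 w) *
          ((n - (linkSet X t.1 t.2).card).choose (u - (linkSet X t.1 t.2).card) : ℝ) := by
  have h1 : ∀ σ : Equiv.Perm (Fin n), occ τ X σ ^ 2 =
      ∑ z ∈ Pos X p n ×ˢ Pos X p n, occInd τ z.1 σ * occInd τ z.2 σ := fun σ => by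
    rw [sq, occ, Finset.sum_mul_sum, Finset.sum_product]
  simp only [h1, Finset.expect_sum_comm]
  rw [← Finset.sum_fiberwise_of_maps_to (t := Finset.range (2 * p + 1))
    (g := fun z => (usedPos z).card) fun z _ => by
      rw [Finset.mem_range]; have := card_usedPos_le z; omega]
  refine Finset.sum_congr rfl fun u _ => ?_
  rw [sum_pairs_of_card hX]
  refine Finset.sum_congr rfl fun t ht => ?_
  have ht' := Finset.mem_product.1 (Finset.mem_filter.1 ht).1
  rw [← card_Pos (linkSet_subset hX ht'.1 ht'.2), mul_comm, ← nsmul_eq_mul, ← Finset.sum_const]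
  refine Finset.sum_congr rfl fun e he => ?_
  have hinj := (Pos.strictMono he).injective
  have := expect_pat (𝕜 := ℝ) ⟨e, hinj⟩ fun w => occInd τ t.1 w * occInd τ t.2 w
  rw [← this]
  simp only [occInd_comp τ _ hinj, Function.Embedding.coeFn_mk]

/-- `f` agrees with a polynomial from some point on. -/
def EventuallyPolynomial (f : ℕ → ℝ) : Prop :=
  ∃ P : Polynomial ℝ, ∀ᶠ n : ℕ in atTop, f n = P.eval (n : ℝ)

theorem EventuallyPolynomial.sum {ι : Type*} {s : Finset ι} {f : ι → ℕ → ℝ}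
    (h : ∀ a ∈ s, EventuallyPolynomial (f a)) : EventuallyPolynomial fun n => ∑ a ∈ s, f a n := by
  choose! P hP using h
  refine ⟨∑ a ∈ s, P a, ?_⟩
  filter_upwards [(Filter.eventually_all_finset s).2 hP] with n hn
  rw [Polynomial.eval_finsetSum]
  exact Finset.sum_congr rfl hn

theorem EventuallyPolynomial.mul {f g : ℕ → ℝ} (hf : EventuallyPolynomial f)
    (hg : EventuallyPolynomial g) : EventuallyPolynomial fun n => f n * g n := by
  obtain ⟨P, hP⟩ := hf
  obtain ⟨Q, hQ⟩ := hg
  refine ⟨P * Q, ?_⟩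
  filter_upwards [hP, hQ] with n h1 h2
  rw [h1, h2, Polynomial.eval_mul]

theorem EventuallyPolynomial.sub {f g : ℕ → ℝ} (hf : EventuallyPolynomial f)
    (hg : EventuallyPolynomial g) : EventuallyPolynomial fun n => f n - g n := by
  obtain ⟨P, hP⟩ := hf
  obtain ⟨Q, hQ⟩ := hg
  refine ⟨P - Q, ?_⟩
  filter_upwards [hP, hQ] with n h1 h2
  rw [h1, h2, Polynomial.eval_sub]

theorem EventuallyPolynomial.const (c : ℝ) : EventuallyPolynomial fun _ => c :=
  ⟨Polynomial.C c, by simp⟩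

theorem eventuallyPolynomial_choose (q k : ℕ) :
    EventuallyPolynomial fun n => ((n - q).choose k : ℝ) := by
  refine ⟨Polynomial.C (1 / (k.factorial : ℝ)) *
    (descPochhammer ℝ k).comp (Polynomial.X - Polynomial.C (q : ℝ)), ?_⟩
  filter_upwards [eventually_ge_atTop q] with n hn
  rw [Polynomial.eval_mul, Polynomial.eval_comp, Polynomial.eval_C, Polynomial.eval_sub,
    Polynomial.eval_X, Polynomial.eval_C, ← Nat.cast_sub hn, descPochhammer_eval_eq_descFactorial,
    Nat.descFactorial_eq_factorial_mul_choose]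
  push_cast
  field_simp

theorem occVar_eq {p : ℕ} (τ : Equiv.Perm (Fin p)) (X : Finset ℕ) (n : ℕ) :
    occVar τ X n = 𝔼 σ : Equiv.Perm (Fin n), occ τ X σ ^ 2 -
      (𝔼 σ : Equiv.Perm (Fin n), occ τ X σ) ^ 2 := by
  unfold occVar
  set m := 𝔼 σ : Equiv.Perm (Fin n), occ τ X σ with hm
  have : ∀ σ : Equiv.Perm (Fin n), (occ τ X σ - m) ^ 2 =
      occ τ X σ ^ 2 - (2 * m * occ τ X σ - m ^ 2) := fun σ => by ring
  simp only [this]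
  rw [Finset.expect_sub_distrib, Finset.expect_sub_distrib, ← Finset.mul_expect,
    Fintype.expect_const, ← hm]
  ring

theorem eventuallyPolynomial_occVar {p : ℕ} (τ : Equiv.Perm (Fin p)) {X : Finset ℕ}
    (hX : X ⊆ Finset.Icc 1 (p - 1)) : EventuallyPolynomial (occVar τ X) := by
  have h1 : EventuallyPolynomial fun n => 𝔼 σ : Equiv.Perm (Fin n), occ τ X σ ^ 2 := by
    simp only [expect_occ_sq τ hX]
    exact EventuallyPolynomial.sum fun u _ => EventuallyPolynomial.sum fun t _ =>
      (EventuallyPolynomial.const _).mul (eventuallyPolynomial_choose _ _)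
  have h2 : EventuallyPolynomial fun n => 𝔼 σ : Equiv.Perm (Fin n), occ τ X σ := by
    simp only [expect_occ τ hX, div_eq_mul_inv]
    exact (eventuallyPolynomial_choose _ _).mul (EventuallyPolynomial.const _)
  have : occVar τ X = fun n => 𝔼 σ : Equiv.Perm (Fin n), occ τ X σ ^ 2 -
      (𝔼 σ : Equiv.Perm (Fin n), occ τ X σ) * (𝔼 σ : Equiv.Perm (Fin n), occ τ X σ) := by
    funext n
    rw [occVar_eq]
    ring
  rw [this]
  exact h1.sub (h2.mul h2)

/-- A polynomial sequence of order `n ^ d` is asymptotic to a constant multiple of `n ^ d`. -/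
theorem EventuallyPolynomial.tendsto_div_pow {f : ℕ → ℝ} (hf : EventuallyPolynomial f) {d : ℕ}
    {c : ℝ} (hc : ∀ n : ℕ, |f n| ≤ c * (n : ℝ) ^ d) :
    ∃ V : ℝ, Tendsto (fun n : ℕ => f n / (n : ℝ) ^ d) atTop (𝓝 V) := by
  obtain ⟨P, hP⟩ := hf
  have hev : (fun n : ℕ =>
      P.eval (n : ℝ) / (Polynomial.X ^ d : Polynomial ℝ).eval (n : ℝ)) =ᶠ[atTop]
      fun n : ℕ => f n / (n : ℝ) ^ d := by
    filter_upwards [hP] with n hn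
    rw [hn]; simp
  rcases lt_trichotomy P.degree (Polynomial.X ^ d : Polynomial ℝ).degree with h | h | h
  · exact ⟨0, ((P.div_tendsto_atTop_zero_of_degree_lt _ h).comp
      tendsto_natCast_atTop_atTop).congr' hev⟩
  · exact ⟨_, ((P.div_tendsto_atTop_leadingCoeff_div_of_degree_eq _ h).comp
      tendsto_natCast_atTop_atTop).congr' hev⟩
  · exfalso
    have h1 := (P.abs_div_tendsto_atTop_atTop_of_degree_gt _ h
      (pow_ne_zero d Polynomial.X_ne_zero)).comp tendsto_natCast_atTop_atTop
    obtain ⟨n, hn, hn', hn0⟩ := ((h1.eventually_gt_atTop c).and (hP.and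
      (eventually_gt_atTop 0))).exists
    have hpos : (0 : ℝ) < (n : ℝ) ^ d := by positivity
    simp only [Function.comp_apply, Polynomial.eval_pow, Polynomial.eval_X, ← hn', abs_div,
      abs_of_pos hpos] at hn
    rw [lt_div_iff₀ hpos] at hn
    exact absurd (hc n) (not_le.2 hn)

theorem occVar_nonneg {p : ℕ} (τ : Equiv.Perm (Fin p)) (X : Finset ℕ) (n : ℕ) :
    0 ≤ occVar τ X n := Finset.expect_nonneg fun _ _ => sq_nonneg _

/-- The variance is eventually a polynomial in `n` and of order `n ^ (2 m - 1)`, `m` being the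
number of blocks; hence it has a limit on this scale. -/
theorem exists_tendsto_occVar {p : ℕ} (τ : Equiv.Perm (Fin p)) {X : Finset ℕ}
    (hX : X ⊆ Finset.Icc 1 (p - 1)) :
    ∃ V : ℝ, Tendsto (fun n : ℕ => occVar τ X n / (n : ℝ) ^ (2 * (p - X.card) - 1))
      atTop (𝓝 V) := by
  refine (eventuallyPolynomial_occVar τ hX).tendsto_div_pow (c := p * p) fun n => ?_
  rw [abs_of_nonneg (occVar_nonneg τ X n)]
  refine (occVar_le τ X hX).trans (le_of_eq ?_)
  have hq : X.card ≤ p - 1 := by simpa using Finset.card_le_card hX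
  rw [show 2 * (p - X.card) - 1 = (p - X.card) + (p - X.card - 1) by omega, pow_add]
  ring

/-! ### Correlation of the pattern count with the content of a corner -/

/-- A centred statistic that is correlated with the number of occurrences bounds its variance from
below. -/
theorem sq_expect_mul_le_occVar_mul {p n : ℕ} (τ : Equiv.Perm (Fin p)) (X : Finset ℕ)
    {Z : Equiv.Perm (Fin n) → ℝ} (hZ : 𝔼 σ, Z σ = 0) :
    (𝔼 σ, occ τ X σ * Z σ) ^ 2 ≤ occVar τ X n * 𝔼 σ, Z σ ^ 2 := by
  set m := 𝔼 σ : Equiv.Perm (Fin n), occ τ X σ with hm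
  have h : 𝔼 σ, occ τ X σ * Z σ = 𝔼 σ, (occ τ X σ - m) * Z σ := by
    simp only [sub_mul]
    rw [Finset.expect_sub_distrib, ← Finset.mul_expect, hZ]
    simp
  rw [h]
  exact Finset.expect_mul_sq_le_sq_mul_sq _ _ _

section Linear

variable {n : ℕ}

theorem expect_apply (h : Fin n → ℝ) (x : Fin n) :
    𝔼 σ : Equiv.Perm (Fin n), h (σ x) = 𝔼 y, h y := by
  have : Nonempty (Fin n) := ⟨x⟩
  have h1 : ∀ x', 𝔼 σ : Equiv.Perm (Fin n), h (σ x') = 𝔼 σ : Equiv.Perm (Fin n), h (σ x) := by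
    intro x'
    rw [← expect_perm_mul_right _ (Equiv.swap x' x)]
    simp
  rw [← Fintype.expect_const (ι := Fin n) (𝔼 σ : Equiv.Perm (Fin n), h (σ x)),
    ← Finset.expect_congr rfl fun x' _ => h1 x', Finset.expect_comm]
  rw [Finset.expect_congr rfl fun σ _ => Fintype.expect_equiv σ (fun x' => h (σ x')) h fun _ => rfl]
  exact Fintype.expect_const _

/-- The values of a uniform permutation at two distinct points are negatively correlated. -/
theorem expect_apply_mul_apply_nonpos {h : Fin n → ℝ} (h0 : ∑ y, h y = 0) {x y : Fin n}
    (hxy : x ≠ y) : 𝔼 σ : Equiv.Perm (Fin n), h (σ x) * h (σ y) ≤ 0 := by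
  have h1 : ∀ z, z ≠ x → 𝔼 σ : Equiv.Perm (Fin n), h (σ x) * h (σ z) =
      𝔼 σ : Equiv.Perm (Fin n), h (σ x) * h (σ y) := by
    intro z hz
    rw [← expect_perm_mul_right _ (Equiv.swap z y)]
    simp [Equiv.swap_apply_of_ne_of_ne hz.symm hxy]
  have h2 : ∑ z, 𝔼 σ : Equiv.Perm (Fin n), h (σ x) * h (σ z) = 0 := by
    rw [← Finset.expect_sum_comm]
    refine Finset.expect_eq_zero fun σ _ => ?_
    rw [← Finset.mul_sum, Equiv.sum_comp σ h, h0, mul_zero]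
  rw [← Finset.add_sum_erase _ _ (Finset.mem_univ x),
    Finset.sum_congr rfl fun z hz => h1 z (Finset.mem_erase.1 hz).1, Finset.sum_const,
    nsmul_eq_mul] at h2
  have h3 : 0 ≤ 𝔼 σ : Equiv.Perm (Fin n), h (σ x) * h (σ x) :=
    Finset.expect_nonneg fun σ _ => mul_self_nonneg _
  have h4 : 0 < ((Finset.univ.erase x).card : ℝ) := by
    exact_mod_cast Finset.card_pos.2 ⟨y, Finset.mem_erase.2 ⟨hxy.symm, Finset.mem_univ _⟩⟩
  by_contra hc
  push Not at hc
  have := mul_pos h4 hc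
  linarith

/-- The indicator that a value lies among the `t` smallest of `Fin n`, centred. -/
noncomputable def lowInd (n t : ℕ) (y : Fin n) : ℝ := (if (y : ℕ) < t then 1 else 0) - t / n

theorem sum_ite_lt {t : ℕ} (ht : t ≤ n) :
    ∑ y : Fin n, (if (y : ℕ) < t then (1 : ℝ) else 0) = t := by
  rw [Fin.sum_univ_eq_sum_range (fun y => if y < t then (1 : ℝ) else 0), Finset.sum_boole]
  have : (Finset.range n).filter (fun y => y < t) = Finset.range t := by
    ext y; simp only [Finset.mem_filter, Finset.mem_range]; omega
  rw [this, Finset.card_range]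

theorem sum_lowInd {t : ℕ} (hn : 0 < n) (ht : t ≤ n) : ∑ y, lowInd n t y = 0 := by
  simp only [lowInd]
  rw [Finset.sum_sub_distrib, sum_ite_lt ht, Finset.sum_const, Finset.card_univ, Fintype.card_fin,
    nsmul_eq_mul]
  field_simp
  simp

theorem abs_lowInd_le {t : ℕ} (ht : t ≤ n) (y : Fin n) : |lowInd n t y| ≤ 1 := by
  have h1 : (t : ℝ) / n ≤ 1 := div_le_one_of_le₀ (by exact_mod_cast ht) (by positivity)
  have h2 : (0 : ℝ) ≤ t / n := by positivity
  unfold lowInd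
  rw [abs_le]
  split_ifs <;> constructor <;> linarith

theorem expect_lowInd {t : ℕ} (ht : t ≤ n) (x : Fin n) :
    𝔼 σ : Equiv.Perm (Fin n), lowInd n t (σ x) = 0 := by
  rw [expect_apply, Fintype.expect_eq_sum_div_card, sum_lowInd x.pos ht, zero_div]

/-- The first `s` elements of `Fin n`. -/
def below (n s : ℕ) : Finset (Fin n) := Finset.univ.filter fun x => (x : ℕ) < s

theorem mem_below {s : ℕ} {x : Fin n} : x ∈ below n s ↔ (x : ℕ) < s := by simp [below]

/-- The number of positions below `s` with a value below `t`, centred. -/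
noncomputable def cornerStat (n s t : ℕ) (σ : Equiv.Perm (Fin n)) : ℝ :=
  ∑ x ∈ below n s, lowInd n t (σ x)

theorem expect_cornerStat {s t : ℕ} (ht : t ≤ n) :
    𝔼 σ : Equiv.Perm (Fin n), cornerStat n s t σ = 0 := by
  simp only [cornerStat, Finset.expect_sum_comm, expect_lowInd ht, Finset.sum_const_zero]

/-- The negative correlations leave only the diagonal terms. -/
theorem expect_cornerStat_sq_le {s t : ℕ} (ht : t ≤ n) :
    𝔼 σ : Equiv.Perm (Fin n), cornerStat n s t σ ^ 2 ≤ n := by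
  have h1 : ∀ σ : Equiv.Perm (Fin n), cornerStat n s t σ ^ 2 =
      ∑ x ∈ below n s, ∑ y ∈ below n s,
        lowInd n t (σ x) * lowInd n t (σ y) := fun σ => by
    rw [cornerStat, sq, Finset.sum_mul_sum]
  simp only [h1, Finset.expect_sum_comm]
  have h2 : ∀ x ∈ below n s,
      ∑ y ∈ below n s,
        𝔼 σ : Equiv.Perm (Fin n), lowInd n t (σ x) * lowInd n t (σ y) ≤ 1 := by
    intro x hx
    rw [← Finset.add_sum_erase _ _ hx]
    have e1 : 𝔼 σ : Equiv.Perm (Fin n), lowInd n t (σ x) * lowInd n t (σ x) ≤ 1 :=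
      Finset.expect_le Finset.univ_nonempty fun σ _ => by
        rw [← abs_mul_abs_self]
        exact mul_le_one₀ (abs_lowInd_le ht _) (abs_nonneg _) (abs_lowInd_le ht _)
    have e2 : ∑ y ∈ (below n s).erase x,
        𝔼 σ : Equiv.Perm (Fin n), lowInd n t (σ x) * lowInd n t (σ y) ≤ 0 :=
      Finset.sum_nonpos fun y hy =>
        expect_apply_mul_apply_nonpos (sum_lowInd x.pos ht) (Finset.mem_erase.1 hy).1.symm
    linarith
  refine (Finset.sum_le_card_nsmul _ _ _ h2).trans ?_
  rw [nsmul_eq_mul, mul_one]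
  exact_mod_cast (Finset.card_le_univ _).trans (by simp)

end Linear

section Corner

variable {p n : ℕ} (τ : Equiv.Perm (Fin p))

/-- The covariance of an occurrence at `i` with the event that its letter number `a` is small. -/
noncomputable def lowCov (t : ℕ) (i : Fin p → Fin n) (a : Fin p) : ℝ :=
  𝔼 σ : Equiv.Perm (Fin n), occInd τ i σ * lowInd n t (σ (i a))

theorem expect_occInd_mul_lowInd_eq_zero {t : ℕ} (ht : t ≤ n) {i : Fin p → Fin n} {x : Fin n}
    (hx : ∀ a, i a ≠ x) : 𝔼 σ : Equiv.Perm (Fin n), occInd τ i σ * lowInd n t (σ x) = 0 := by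
  rw [expect_mul_of_orderDet (orderDet_occInd τ i), expect_lowInd ht, mul_zero]
  intro σ ρ hρ
  rw [Equiv.Perm.mul_apply, hρ x (by simpa using hx)]

/-- The number of small values at the positions `i` does not depend on their order. -/
theorem sum_lowCov {t : ℕ} (ht : t ≤ n) {i : Fin p → Fin n} (hi : Function.Injective i) :
    ∑ a, lowCov τ t i a = 0 := by
  simp only [lowCov]
  rw [← Finset.expect_sum_comm]
  simp only [← Finset.mul_sum]
  rw [expect_mul_of_orderDet (orderDet_occInd τ i) (g := fun σ => ∑ a, lowInd n t (σ (i a))),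
    Finset.expect_sum_comm]
  · simp only [expect_lowInd ht, Finset.sum_const_zero, mul_zero]
  · intro σ ρ hρ
    have h : ∀ σ : Equiv.Perm (Fin n), ∑ a, lowInd n t (σ (i a)) =
        ∑ x ∈ Finset.univ.image i, lowInd n t (σ x) := fun σ => by
      rw [Finset.sum_image fun a _ b _ h => hi h]
    rw [h, h]
    refine Finset.sum_equiv ρ (fun x => ?_) fun x _ => rfl
    constructor
    · intro hx
      by_contra hc
      have h1 := ρ.injective (hρ _ hc)
      rw [h1] at hc
      exact hc hx
    · intro hx
      by_contra hc
      rw [hρ x hc] at hx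
      exact hc hx

theorem abs_lowCov_le {t : ℕ} (ht : t ≤ n) (i : Fin p → Fin n) (a : Fin p) :
    |lowCov τ t i a| ≤ 1 :=
  (Finset.abs_expect_le _ _).trans <| Finset.expect_le Finset.univ_nonempty fun σ _ => by
    rw [abs_mul, abs_of_nonneg (occInd_nonneg τ i σ)]
    exact mul_le_one₀ (occInd_le_one τ i σ) (abs_nonneg _) (abs_lowInd_le ht _)

/-- A letter of the pattern that is not the smallest one is small only if the smallest one is small
as well, which has a probability of smaller order. -/
theorem lowCov_le {t : ℕ} (ht : t ≤ n) {i : Fin p → Fin n} (hi : Function.Injective i)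
    {a a₀ : Fin p} (ha : τ a₀ < τ a) :
    lowCov τ t i a ≤ ((t : ℝ) / n) ^ 2 - (t : ℝ) / n / p.factorial := by
  have hne : i a ≠ i a₀ := fun h => by
    have := hi h
    rw [this] at ha
    exact lt_irrefl _ ha
  have h1 : ∀ σ : Equiv.Perm (Fin n), occInd τ i σ * lowInd n t (σ (i a)) ≤
      (lowInd n t (σ (i a)) * lowInd n t (σ (i a₀)) +
        ((t : ℝ) / n * lowInd n t (σ (i a)) + (t : ℝ) / n * lowInd n t (σ (i a₀))) +
        ((t : ℝ) / n) ^ 2) - (t : ℝ) / n * occInd τ i σ := by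
    intro σ
    have h2 : (lowInd n t (σ (i a)) * lowInd n t (σ (i a₀)) +
        ((t : ℝ) / n * lowInd n t (σ (i a)) + (t : ℝ) / n * lowInd n t (σ (i a₀))) +
        ((t : ℝ) / n) ^ 2) = (if (σ (i a) : ℕ) < t then (1 : ℝ) else 0) *
          (if (σ (i a₀) : ℕ) < t then (1 : ℝ) else 0) := by
      simp only [lowInd]; ring
    rw [h2]
    have h3 : occInd τ i σ * (if (σ (i a) : ℕ) < t then (1 : ℝ) else 0) ≤
        (if (σ (i a) : ℕ) < t then (1 : ℝ) else 0) *
          (if (σ (i a₀) : ℕ) < t then (1 : ℝ) else 0) := by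
      unfold occInd
      split_ifs with h4 h5 h6 <;> norm_num
      have := (h4 a₀ a).2 ha
      rw [Fin.lt_def] at this
      omega
    simp only [lowInd] at *
    linarith
  refine (Finset.expect_le_expect fun σ _ => h1 σ).trans ?_
  simp only [Finset.expect_sub_distrib, Finset.expect_add_distrib, ← Finset.mul_expect,
    expect_lowInd ht, expect_occInd τ hi, Fintype.expect_const]
  have := expect_apply_mul_apply_nonpos (sum_lowInd (i a).pos ht) hne
  have e : (t : ℝ) / n * (1 / p.factorial) = (t : ℝ) / n / p.factorial := by ring
  rw [e]
  linarith

/-- The letters of a pattern that occupy a proper non-empty set `B` of places are, on the whole,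
correlated with the event of being small, with a sign that depends only on `B`. -/
theorem exists_sign_le_sum_lowCov (B : Finset (Fin p)) (hB : B.Nonempty) (hB' : B ≠ Finset.univ) :
    ∃ ε : ℝ, |ε| = 1 ∧ ∀ (n t : ℕ), t ≤ n → (t : ℝ) / n = 1 / (2 * p.factorial) →
      ∀ i : Fin p → Fin n, Function.Injective i →
        1 / (4 * (p.factorial : ℝ) ^ 2) ≤ ε * ∑ a ∈ B, lowCov τ t i a := by
  obtain ⟨b, hb⟩ := hB
  have hp : 0 < p := b.pos
  have : NeZero p := ⟨hp.ne'⟩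
  set a₀ : Fin p := τ.symm 0 with ha₀
  have hF : (0 : ℝ) < p.factorial := by exact_mod_cast p.factorial_pos
  -- a set of places that avoids the smallest letter
  have key : ∀ C : Finset (Fin p), C.Nonempty → a₀ ∉ C → ∀ (n t : ℕ), t ≤ n →
      (t : ℝ) / n = 1 / (2 * p.factorial) → ∀ i : Fin p → Fin n, Function.Injective i →
        ∑ a ∈ C, lowCov τ t i a ≤ -(1 / (4 * (p.factorial : ℝ) ^ 2)) := by
    intro C hC haC n t ht htn i hi
    have h1 : ∀ a ∈ C, lowCov τ t i a ≤ -(1 / (4 * (p.factorial : ℝ) ^ 2)) := by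
      intro a ha
      have hlt : τ a₀ < τ a := by
        rw [ha₀, Equiv.apply_symm_apply, Fin.pos_iff_ne_zero]
        intro h
        apply haC
        rw [ha₀, ← h, Equiv.symm_apply_apply]
        exact ha
      refine (lowCov_le τ ht hi hlt).trans (le_of_eq ?_)
      rw [htn]
      field_simp
      norm_num
    refine (Finset.sum_le_card_nsmul _ _ _ h1).trans ?_
    rw [nsmul_eq_mul]
    have hc1 : (1 : ℝ) ≤ C.card := by exact_mod_cast Finset.card_pos.2 hC
    have hδ : (0 : ℝ) ≤ 1 / (4 * (p.factorial : ℝ) ^ 2) := by positivity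
    nlinarith
  by_cases h : a₀ ∈ B
  · refine ⟨1, by simp, fun n t ht htn i hi => ?_⟩
    have hc : (Bᶜ).Nonempty := by
      rw [← Finset.compl_ne_univ_iff_nonempty]
      simpa using fun h => hB' h
    have h1 := key Bᶜ hc (by simpa using h) n t ht htn i hi
    have h2 := Finset.sum_add_sum_compl B fun a => lowCov τ t i a
    rw [sum_lowCov τ ht hi] at h2
    linarith
  · refine ⟨-1, by simp, fun n t ht htn i hi => ?_⟩
    have h1 := key B ⟨b, hb⟩ h n t ht htn i hi
    linarith

/-- Only the letters whose position lies left of the border `s` are correlated with the corner. -/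
theorem expect_occ_mul_cornerStat (X : Finset ℕ) {s t : ℕ} (ht : t ≤ n) :
    𝔼 σ : Equiv.Perm (Fin n), occ τ X σ * cornerStat n s t σ =
      ∑ i ∈ Pos X p n, ∑ a with (i a : ℕ) < s, lowCov τ t i a := by
  have h1 : ∀ σ : Equiv.Perm (Fin n), occ τ X σ * cornerStat n s t σ =
      ∑ i ∈ Pos X p n, ∑ x ∈ below n s, occInd τ i σ * lowInd n t (σ x) := fun σ => by
    rw [occ, cornerStat, Finset.sum_mul_sum]
  simp only [h1, Finset.expect_sum_comm]
  refine Finset.sum_congr rfl fun i hi => ?_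
  have hinj := (Pos.strictMono hi).injective
  symm
  have h2 : ∑ a with (i a : ℕ) < s, lowCov τ t i a =
      ∑ x ∈ (Finset.univ.filter fun a => (i a : ℕ) < s).image i,
        𝔼 σ : Equiv.Perm (Fin n), occInd τ i σ * lowInd n t (σ x) := by
    rw [Finset.sum_image fun a _ b _ h => hinj h]
    rfl
  rw [h2]
  refine Finset.sum_subset (fun x hx => ?_) fun x hx hx' => ?_
  · obtain ⟨a, ha, rfl⟩ := Finset.mem_image.1 hx
    exact mem_below.2 (Finset.mem_filter.1 ha).2
  · refine expect_occInd_mul_lowInd_eq_zero τ ht fun a ha => hx' ?_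
    subst ha
    exact Finset.mem_image_of_mem _ (Finset.mem_filter.2 ⟨Finset.mem_univ _, mem_below.1 hx⟩)

theorem Pos_apply_of_forall_mem {X : Finset ℕ} {i : Fin p → Fin n} (hi : i ∈ Pos X p n)
    (hp : 0 < p) (a : Fin p) (ha : ∀ x, 1 ≤ x → x ≤ (a : ℕ) → x ∈ X) :
    (i a : ℕ) = i ⟨0, hp⟩ + a := by
  obtain ⟨a, hap⟩ := a
  induction a with
  | zero => simp
  | succ a ih =>
    have h1 := ih (by omega) fun x h h' => ha x h (by simp only at h' ⊢; omega)
    have h2 := (mem_Pos.1 hi).2 ⟨a, by omega⟩ ⟨a + 1, hap⟩ (ha (a + 1) (by omega) (by simp)) rfl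
    rw [h2, h1]
    simp only
    omega

theorem card_Pos_le_apply_zero_le {X : Finset ℕ} (hX : X ⊆ Finset.Icc 1 (p - 1)) (hp : 0 < p)
    (s : ℕ) : ((Pos X p n).filter fun i => s ≤ (i ⟨0, hp⟩ : ℕ)).card ≤
      (n - s - X.card).choose (p - X.card) := by
  rw [← card_PosN p X (n - s) hX]
  have hle : ∀ i ∈ (Pos X p n).filter (fun i => s ≤ (i ⟨0, hp⟩ : ℕ)), ∀ a, s ≤ (i a : ℕ) := by
    intro i hi a
    rw [Finset.mem_filter] at hi
    refine hi.2.trans ?_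
    exact Fin.le_def.1 ((Pos.strictMono hi.1).monotone (Fin.le_def.2 (Nat.zero_le _)))
  refine Finset.card_le_card_of_injOn (fun i a => (i a : ℕ) - s) (fun i hi => ?_) ?_
  · have h1 := hle i hi
    have h2 := mem_Pos.1 (Finset.mem_filter.1 hi).1
    refine mem_PosN.2 ⟨fun a => ?_, fun a b h => ?_, fun a b ha hb => ?_⟩
    · have := h1 a; have := (i a).2; show (i a : ℕ) - s < n - s; omega
    · have := h1 a; have := Fin.lt_def.1 (h2.1 a b h); show (i a : ℕ) - s < (i b : ℕ) - s; omega
    · have := h1 a; have := h2.2 a b ha hb; show (i b : ℕ) - s = (i a : ℕ) - s + 1; omega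
  · intro i hi j hj h
    ext a
    have := congrFun h a
    have := hle i hi a
    have := hle j hj a
    simp only at *
    omega

end Corner

/-! ### Positivity of the limiting variance: at least two blocks -/

theorem abs_choose_sub_le (q m n : ℕ) :
    |((n - q).choose m : ℝ) - (n : ℝ) ^ m / m.factorial| ≤ m * (q + m) * (n : ℝ) ^ (m - 1) := by
  have hF : (1 : ℝ) ≤ m.factorial := by exact_mod_cast m.factorial_pos
  have h1 : ((n - q).descFactorial m : ℝ) = m.factorial * ((n - q).choose m : ℝ) := by
    exact_mod_cast Nat.descFactorial_eq_factorial_mul_choose (n - q) m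
  have h2 : ((n - q).descFactorial m : ℝ) ≤ (n : ℝ) ^ m := by
    exact_mod_cast (Nat.descFactorial_le_pow _ m).trans (Nat.pow_le_pow_left (Nat.sub_le n q) m)
  have h3 : ((n - q - m : ℕ) : ℝ) ^ m ≤ ((n - q).descFactorial m : ℝ) := by
    exact_mod_cast (Nat.pow_le_pow_left (by omega) m).trans (Nat.pow_sub_le_descFactorial (n - q) m)
  have h4 : (n : ℝ) ^ m - ((n - q - m : ℕ) : ℝ) ^ m ≤ m * (q + m) * (n : ℝ) ^ (m - 1) := by
    have h5 := abs_pow_sub_pow_le (n : ℝ) ((n - q - m : ℕ) : ℝ) m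
    have h6 : ((n - q - m : ℕ) : ℝ) ≤ n := by exact_mod_cast (by omega : n - q - m ≤ n)
    have h7 : (n : ℝ) ≤ ((n - q - m : ℕ) : ℝ) + (q + m) := by
      exact_mod_cast (by omega : n ≤ (n - q - m) + (q + m))
    rw [abs_of_nonneg (Nat.cast_nonneg n : (0 : ℝ) ≤ n),
      abs_of_nonneg (Nat.cast_nonneg _ : (0 : ℝ) ≤ ((n - q - m : ℕ) : ℝ)),
      max_eq_left h6, abs_of_nonneg (sub_nonneg.2 h6)] at h5
    refine (le_abs_self _).trans (h5.trans ?_)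
    rw [mul_comm (m : ℝ) (q + m)]
    gcongr
    linarith
  have h8 : (n : ℝ) ^ m / m.factorial - m * (q + m) * (n : ℝ) ^ (m - 1) ≤ (n - q).choose m := by
    have h9 : (n : ℝ) ^ m - m * (q + m) * (n : ℝ) ^ (m - 1) ≤
      m.factorial * ((n - q).choose m : ℝ) := by linarith
    have h10 : (0 : ℝ) ≤ m * (q + m) * (n : ℝ) ^ (m - 1) := by positivity
    rw [sub_le_iff_le_add, div_le_iff₀ (by positivity)]
    nlinarith
  have h11 : ((n - q).choose m : ℝ) ≤ (n : ℝ) ^ m / m.factorial := by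
    rw [le_div_iff₀ (by positivity)]
    linarith
  have h12 : (0 : ℝ) ≤ m * (q + m) * (n : ℝ) ^ (m - 1) := by positivity
  rw [abs_le]
  constructor <;> linarith

theorem tendsto_choose_div_pow (q : ℕ) {m : ℕ} (hm : 1 ≤ m) :
    Tendsto (fun n : ℕ => ((n - q).choose m : ℝ) / (n : ℝ) ^ m) atTop
      (𝓝 (1 / (m.factorial : ℝ))) := by
  have h0 : Tendsto (fun n : ℕ => (m * (q + m) : ℝ) / (n : ℝ)) atTop (𝓝 0) :=
    tendsto_const_div_atTop_nhds_zero_nat _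
  refine tendsto_iff_norm_sub_tendsto_zero.2 (squeeze_zero' (Eventually.of_forall fun n =>
    norm_nonneg _) ?_ h0)
  filter_upwards [eventually_gt_atTop 0] with n hn
  have hn' : (0 : ℝ) < n := by exact_mod_cast hn
  have h := abs_choose_sub_le q m n
  have e : ((n - q).choose m : ℝ) / (n : ℝ) ^ m - 1 / m.factorial =
      (((n - q).choose m : ℝ) - (n : ℝ) ^ m / m.factorial) / (n : ℝ) ^ m := by
    field_simp
  rw [e, Real.norm_eq_abs, abs_div, abs_of_pos (pow_pos hn' m), div_le_div_iff₀ (by positivity) hn']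
  calc _ ≤ m * (q + m) * (n : ℝ) ^ (m - 1) * n := by gcongr
    _ = m * (q + m) * (n : ℝ) ^ m := by
      rw [mul_assoc, ← pow_succ, Nat.sub_add_cancel hm]

/-- For a pattern with at least two blocks, the covariance of the number of occurrences with the
statistic of a corner: close to the left border only the first block of the pattern matters. -/
theorem exists_sign_le_expect_occ_mul_cornerStat {p : ℕ} (τ : Equiv.Perm (Fin p)) {X : Finset ℕ}
    (hX : X ⊆ Finset.Icc 1 (p - 1)) (hm : X.card + 2 ≤ p) :
    ∃ ε : ℝ, |ε| = 1 ∧ ∀ n s t : ℕ, t ≤ n → (t : ℝ) / n = 1 / (2 * p.factorial) →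
      1 / (4 * (p.factorial : ℝ) ^ 2) * (((n - X.card).choose (p - X.card) : ℝ) -
        ((n - s - X.card).choose (p - X.card) : ℝ)) -
        2 * p * ((s : ℝ) ^ 2 * (n : ℝ) ^ (p - X.card - 2) +
          p * p * (n : ℝ) ^ (p - X.card - 1)) ≤
      ε * 𝔼 σ : Equiv.Perm (Fin n), occ τ X σ * cornerStat n s t σ := by
  have hp : 0 < p := by omega
  -- the first element of the second block
  obtain ⟨x₀, hx₀, hx₀'⟩ : ∃ x ∈ Finset.Icc 1 (p - 1), x ∉ X := by
    by_contra! h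
    have := Finset.card_le_card (fun x hx => h x hx : Finset.Icc 1 (p - 1) ⊆ X)
    rw [Nat.card_Icc] at this
    omega
  have hex : ∃ x, 1 ≤ x ∧ x ∉ X := ⟨x₀, (Finset.mem_Icc.1 hx₀).1, hx₀'⟩
  classical
  set r := Nat.find hex with hr
  have hr1 : 1 ≤ r ∧ r ∉ X := Nat.find_spec hex
  have hrmin : ∀ x, 1 ≤ x → x < r → x ∈ X := fun x h1 h2 => by
    by_contra h3
    exact Nat.find_min hex h2 ⟨h1, h3⟩
  have hrp : r < p := by
    have h1 : r ≤ x₀ := Nat.find_min' hex ⟨(Finset.mem_Icc.1 hx₀).1, hx₀'⟩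
    have h2 := Finset.mem_Icc.1 hx₀
    omega
  set B : Finset (Fin p) := Finset.univ.filter fun a => (a : ℕ) < r with hB
  have hBne : B.Nonempty := ⟨⟨0, hp⟩, by simp [hB]; omega⟩
  have hBuniv : B ≠ Finset.univ := fun h => by
    have : (⟨r, hrp⟩ : Fin p) ∈ B := h ▸ Finset.mem_univ _
    simp [hB] at this
  obtain ⟨ε, hε, hsign⟩ := exists_sign_le_sum_lowCov τ B hBne hBuniv
  refine ⟨ε, hε, fun n s t ht htn => ?_⟩
  set δ : ℝ := 1 / (4 * (p.factorial : ℝ) ^ 2) with hδ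
  have hδ1 : δ ≤ 1 := by
    have hF : (1 : ℝ) ≤ p.factorial := by exact_mod_cast p.factorial_pos
    rw [hδ, div_le_one (by positivity)]
    nlinarith
  have hp1 : (1 : ℝ) ≤ p := by exact_mod_cast hp
  -- the words that straddle the border
  set A : Finset (Fin n) := Finset.univ.filter fun x => s ≤ (x : ℕ) + p ∧ (x : ℕ) < s with hA
  have hAcard : A.card ≤ p := by
    rw [← Finset.card_map Fin.valEmbedding]
    refine (Finset.card_le_card (t := Finset.Ico (s - p) s) fun x hx => ?_).trans ?_
    · obtain ⟨y, hy, rfl⟩ := Finset.mem_map.1 hx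
      have := (Finset.mem_filter.1 hy).2
      rw [Finset.mem_Ico, Fin.valEmbedding_apply]
      omega
    · rw [Nat.card_Ico]; omega
  set G := (Pos X p n).filter fun i => s ≤ (i ⟨0, hp⟩ : ℕ) with hG
  set B1 := (Pos X p n).filter fun i => (i ⟨0, hp⟩ : ℕ) < s ∧ (i ⟨r, hrp⟩ : ℕ) < s with hB1
  set B2 := (Pos X p n).filter fun i => ∃ a, i a ∈ A with hB2
  have hterm : ∀ i ∈ Pos X p n, δ * (1 - (if i ∈ G then 1 else 0)) -
      2 * p * ((if i ∈ B1 then 1 else 0) + (if i ∈ B2 then 1 else 0)) ≤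
      ε * ∑ a with (i a : ℕ) < s, lowCov τ t i a := by
    intro i hi
    have hmono := Pos.strictMono hi
    by_cases hiG : i ∈ G
    · have h0 : (Finset.univ.filter fun a => (i a : ℕ) < s) = ∅ := by
        refine Finset.filter_eq_empty_iff.2 fun a _ => ?_
        have h1 := (Finset.mem_filter.1 hiG).2
        have h2 : (i ⟨0, hp⟩ : ℕ) ≤ i a := hmono.monotone (Fin.le_def.2 (Nat.zero_le _))
        omega
      rw [h0, Finset.sum_empty, if_pos hiG]
      split_ifs <;> nlinarith
    · have hi0 : (i ⟨0, hp⟩ : ℕ) < s := by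
        by_contra h
        exact hiG (Finset.mem_filter.2 ⟨hi, not_lt.1 h⟩)
      by_cases hbad : i ∈ B1 ∨ i ∈ B2
      · have h1 : |ε * ∑ a with (i a : ℕ) < s, lowCov τ t i a| ≤ p := by
          rw [abs_mul, hε, one_mul]
          refine (Finset.abs_sum_le_sum_abs _ _).trans
            ((Finset.sum_le_card_nsmul _ _ 1 fun a _ => abs_lowCov_le τ ht i a).trans ?_)
          rw [nsmul_eq_mul, mul_one]
          exact_mod_cast (Finset.card_le_univ _).trans (by simp)
        have h2 := (abs_le.1 h1).1
        have h3 : (1 : ℝ) ≤ (if i ∈ B1 then 1 else 0) + (if i ∈ B2 then 1 else 0) := by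
          rcases hbad with h | h
          · rw [if_pos h]; split_ifs <;> norm_num
          · rw [if_pos h]; split_ifs <;> norm_num
        rw [if_neg hiG]
        nlinarith
      · push Not at hbad
        rw [if_neg hiG, if_neg hbad.1, if_neg hbad.2]
        have hir : s ≤ (i ⟨r, hrp⟩ : ℕ) := by
          by_contra h
          exact hbad.1 (Finset.mem_filter.2 ⟨hi, hi0, not_le.1 h⟩)
        have hi0' : (i ⟨0, hp⟩ : ℕ) + p < s := by
          by_contra h
          refine hbad.2 (Finset.mem_filter.2 ⟨hi, ⟨0, hp⟩, ?_⟩)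
          rw [hA, Finset.mem_filter]
          exact ⟨Finset.mem_univ _, not_lt.1 h, hi0⟩
        have h0 : (Finset.univ.filter fun a => (i a : ℕ) < s) = B := by
          ext a
          simp only [hB, Finset.mem_filter, Finset.mem_univ, true_and]
          constructor
          · intro h
            by_contra h'
            have : (i ⟨r, hrp⟩ : ℕ) ≤ i a := hmono.monotone (Fin.le_def.2 (not_lt.1 h'))
            omega
          · intro h
            have := Pos_apply_of_forall_mem hi hp a fun x h1 h2 => hrmin x h1 (by omega)
            omega
        rw [h0]
        have := hsign n t ht htn i hmono.injective
        linarith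
  have hsum := Finset.sum_le_sum hterm
  rw [← Finset.mul_sum, ← expect_occ_mul_cornerStat τ X ht] at hsum
  refine le_trans ?_ hsum
  rw [Finset.sum_sub_distrib, ← Finset.mul_sum, ← Finset.mul_sum, Finset.sum_sub_distrib,
    Finset.sum_add_distrib]
  have hone : ∀ S : Finset (Fin p → Fin n), S ⊆ Pos X p n →
      ∑ i ∈ Pos X p n, (if i ∈ S then (1 : ℝ) else 0) = S.card := fun S hS => by
    rw [Finset.sum_boole, Finset.filter_mem_eq_inter, Finset.inter_eq_right.2 hS]
  rw [hone G (Finset.filter_subset _ _), hone B1 (Finset.filter_subset _ _),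
    hone B2 (Finset.filter_subset _ _), Finset.sum_const, card_Pos hX, nsmul_eq_mul, mul_one]
  have c1 : (G.card : ℝ) ≤ ((n - s - X.card).choose (p - X.card) : ℝ) := by
    exact_mod_cast card_Pos_le_apply_zero_le hX hp s
  have c2 : (B1.card : ℝ) ≤ (s : ℝ) ^ 2 * (n : ℝ) ^ (p - X.card - 2) := by
    have h0 : (0 : ℕ) ∉ X := fun h => by have := Finset.mem_Icc.1 (hX h); omega
    have := card_Pos_two_lt_le (n := n) hX (a := ⟨0, hp⟩) (b := ⟨r, hrp⟩)
      (by simpa [blockStarts] using h0) (by simpa [blockStarts] using hr1.2)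
      (by simp only [ne_eq, Fin.mk.injEq]; omega) s
    exact_mod_cast this
  have c3 : (B2.card : ℝ) ≤ p * p * (n : ℝ) ^ (p - X.card - 1) := by
    have := (card_Pos_meet_le hX A).trans
      (Nat.mul_le_mul_right _ (Nat.mul_le_mul_right p hAcard))
    exact_mod_cast this
  have hδ0 : 0 ≤ δ := by positivity
  gcongr

theorem le_of_tendsto_occVar {p : ℕ} {τ : Equiv.Perm (Fin p)} {X : Finset ℕ} {d : ℕ} {V c : ℝ}
    (hV : Tendsto (fun n : ℕ => occVar τ X n / (n : ℝ) ^ d) atTop (𝓝 V)) {u : ℕ → ℕ}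
    (hu : Tendsto u atTop atTop)
    (h : ∀ᶠ k in atTop, c ≤ occVar τ X (u k) / (u k : ℝ) ^ d) : c ≤ V :=
  ge_of_tendsto (hV.comp hu) h

/-- The covariance with a corner of fixed small proportions is of order `n ^ m`, while the
statistic of the corner has variance at most `n`; the Cauchy-Schwarz inequality gives the order
`n ^ (2 m - 1)` for the variance of the pattern count. -/
theorem occVar_limit_pos_of_two_blocks {p : ℕ} (τ : Equiv.Perm (Fin p)) {X : Finset ℕ}
    (hX : X ⊆ Finset.Icc 1 (p - 1)) (hm : X.card + 2 ≤ p) {V : ℝ}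
    (hV : Tendsto (fun n : ℕ => occVar τ X n / (n : ℝ) ^ (2 * (p - X.card) - 1)) atTop (𝓝 V)) :
    0 < V := by
  obtain ⟨ε, hε, hcov⟩ := exists_sign_le_expect_occ_mul_cornerStat τ hX hm
  set q := X.card with hq
  set m := p - q with hmdef
  have hm2 : 2 ≤ m := by omega
  set δ : ℝ := 1 / (4 * (p.factorial : ℝ) ^ 2) with hδ
  have hδ0 : 0 < δ := by
    have := p.factorial_pos
    positivity
  -- the corner has horizontal extent `1 / E` and vertical extent `1 / H`; its width is so small
  -- that the words with two blocks inside it, a proportion `1 / E ^ 2`, are outweighed by those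
  -- with one
  set E : ℕ := 8 * p * m.factorial * p.factorial ^ 2 + 1 with hE
  set H : ℕ := 2 * p.factorial with hH
  have hE0 : (0 : ℝ) < E := by positivity
  clear_value E H
  have hH0 : 0 < H := by have := p.factorial_pos; omega
  have hm0 : (0 : ℝ) < m.factorial := by exact_mod_cast m.factorial_pos
  have hu : Tendsto (fun k : ℕ => E * H * k) atTop atTop :=
    tendsto_id.const_mul_atTop' (Nat.mul_pos (by omega) hH0)
  have hu' : Tendsto (fun k : ℕ => (E - 1) * H * k) atTop atTop := by
    refine tendsto_id.const_mul_atTop' (Nat.mul_pos ?_ hH0)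
    have h1 := m.factorial_pos
    have h2 := p.factorial_pos
    have : 0 < p := by omega
    rw [hE, Nat.add_sub_cancel]
    positivity
  set R : ℕ → ℝ := fun k => δ * (((E * H * k - q).choose m : ℝ) -
      ((E * H * k - H * k - q).choose m : ℝ)) - 2 * p * (((H * k : ℕ) : ℝ) ^ 2 *
        ((E * H * k : ℕ) : ℝ) ^ (m - 2) + p * p * ((E * H * k : ℕ) : ℝ) ^ (m - 1)) with hR
  set ℓ : ℝ := δ * (1 / m.factorial - (1 - 1 / (E : ℝ)) ^ m * (1 / m.factorial)) -
    2 * p * ((1 / (E : ℝ)) ^ 2 + 0) with hℓ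
  have hlim : Tendsto (fun k : ℕ => R k / ((E * H * k : ℕ) : ℝ) ^ m) atTop (𝓝 ℓ) := by
    have t1 := (tendsto_choose_div_pow q (by omega : 1 ≤ m)).comp hu
    have t2 := ((tendsto_choose_div_pow q (by omega : 1 ≤ m)).comp hu').const_mul
      ((1 - 1 / (E : ℝ)) ^ m)
    have t3 : Tendsto (fun k : ℕ => (p * p : ℝ) / ((E * H * k : ℕ) : ℝ)) atTop (𝓝 0) :=
      (tendsto_const_div_atTop_nhds_zero_nat (p * p : ℝ)).comp hu
    refine Tendsto.congr' ?_ (((t1.sub t2).const_mul δ).sub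
      (((tendsto_const_nhds (x := (1 / (E : ℝ)) ^ 2)).add t3).const_mul (2 * p : ℝ)))
    filter_upwards [eventually_gt_atTop 0] with k hk
    have hk0 : (0 : ℝ) < k := by exact_mod_cast hk
    have hHr : (0 : ℝ) < H := by exact_mod_cast hH0
    have hN : (0 : ℝ) < ((E * H * k : ℕ) : ℝ) := by push_cast; positivity
    have hsub : E * H * k - H * k = (E - 1) * H * k := by
      rw [mul_assoc, mul_assoc, Nat.sub_mul, one_mul]
    have hN' : (((E - 1) * H * k : ℕ) : ℝ) = (1 - 1 / (E : ℝ)) * ((E * H * k : ℕ) : ℝ) := by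
      have : ((E - 1 : ℕ) : ℝ) = E - 1 := by
        rw [Nat.cast_sub (by omega)]; simp
      push_cast
      rw [this]
      field_simp
    have hE1 : (0 : ℝ) < 1 - 1 / (E : ℝ) := by
      have h1 : (1 : ℝ) < E := by
        have h1 := m.factorial_pos
        have h2 := p.factorial_pos
        have h3 : 0 < p := by omega
        have : 0 < 8 * p * m.factorial * p.factorial ^ 2 := by positivity
        exact_mod_cast (by omega : 1 < E)
      rw [sub_pos, div_lt_one hE0]
      exact h1
    have hs : ((H * k : ℕ) : ℝ) = 1 / (E : ℝ) * ((E * H * k : ℕ) : ℝ) := by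
      push_cast; field_simp
    simp only [Function.comp_apply, hR]
    rw [hsub, hN', hs]
    set N : ℝ := ((E * H * k : ℕ) : ℝ) with hNdef
    have e1 : N ^ m = N ^ (m - 2) * N ^ 2 := by rw [← pow_add]; congr 1; omega
    have e2 : N ^ m = N ^ (m - 1) * N := by rw [← pow_succ]; congr 1; omega
    have a1 : (((E - 1) * H * k - q).choose m : ℝ) / N ^ m = (1 - 1 / (E : ℝ)) ^ m *
        ((((E - 1) * H * k - q).choose m : ℝ) / ((1 - 1 / (E : ℝ)) * N) ^ m) := by
      rw [mul_pow, mul_div_assoc', mul_div_mul_left _ _ (pow_ne_zero m hE1.ne')]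
    have a2 : (1 / (E : ℝ)) ^ 2 = (1 / (E : ℝ) * N) ^ 2 * N ^ (m - 2) / N ^ m := by
      rw [e1, mul_pow, eq_div_iff (by positivity)]
      ring
    have a3 : (p * p : ℝ) / N = p * p * N ^ (m - 1) / N ^ m := by
      rw [e2, div_eq_div_iff (by positivity) (by positivity)]
      ring
    rw [← a1, a2, a3]
    ring
  have hℓ0 : 0 < ℓ := by
    have h1 : (1 - 1 / (E : ℝ)) ^ m ≤ 1 - 1 / (E : ℝ) := by
      have h0 : (0 : ℝ) ≤ 1 - 1 / E := by
        rw [sub_nonneg, div_le_one hE0]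
        exact_mod_cast (by omega : 1 ≤ E)
      have h0' : (1 : ℝ) - 1 / E ≤ 1 := by
        have : (0 : ℝ) ≤ 1 / E := by positivity
        linarith
      exact pow_le_of_le_one h0 h0' (by omega)
    have h2 : δ * (1 / (E : ℝ) * (1 / m.factorial)) ≤
        δ * (1 / m.factorial - (1 - 1 / (E : ℝ)) ^ m * (1 / m.factorial)) := by
      have h3 : (0 : ℝ) ≤ 1 / m.factorial := by positivity
      refine mul_le_mul_of_nonneg_left ?_ hδ0.le
      nlinarith
    have h4 : 2 * p * ((1 / (E : ℝ)) ^ 2 + 0) < δ * (1 / (E : ℝ) * (1 / m.factorial)) := by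
      have h5 : (E : ℝ) = 8 * p * m.factorial * p.factorial ^ 2 + 1 := by
        rw [hE]; push_cast; ring
      have hpf : (0 : ℝ) < p.factorial := by exact_mod_cast p.factorial_pos
      have h6 : 2 * p * ((1 / (E : ℝ)) ^ 2 + 0) = (2 * p / E) * (1 / E) := by
        rw [add_zero]; field_simp
      have h7 : δ * (1 / (E : ℝ) * (1 / m.factorial)) = (δ / m.factorial) * (1 / E) := by
        field_simp
      rw [h6, h7]
      refine mul_lt_mul_of_pos_right ?_ (by positivity)
      rw [hδ, div_div, div_lt_div_iff₀ hE0 (by positivity), h5]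
      nlinarith
    rw [hℓ]
    linarith
  have hev := hlim.eventually_const_le (half_lt_self hℓ0)
  refine lt_of_lt_of_le (by positivity : 0 < (ℓ / 2) ^ 2) (le_of_tendsto_occVar hV hu ?_)
  filter_upwards [hev, eventually_gt_atTop 0] with k hk hk0
  have hHk : H * k ≤ E * H * k := by
    rw [mul_assoc]
    exact Nat.le_mul_of_pos_left _ (by omega)
  have hN : (0 : ℝ) < ((E * H * k : ℕ) : ℝ) := by
    have : 0 < E * H * k := Nat.mul_pos (Nat.mul_pos (by omega) hH0) hk0
    exact_mod_cast this
  have htle : E * k ≤ E * H * k := by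
    rw [mul_assoc]
    exact Nat.mul_le_mul_left _ (Nat.le_mul_of_pos_left _ hH0)
  have htn : ((E * k : ℕ) : ℝ) / ((E * H * k : ℕ) : ℝ) = 1 / (2 * p.factorial) := by
    have hk1 : (k : ℝ) ≠ 0 := by exact_mod_cast hk0.ne'
    have hHr : (H : ℝ) = 2 * p.factorial := by rw [hH]; push_cast; ring
    have : (H : ℝ) ≠ 0 := by exact_mod_cast hH0.ne'
    rw [← hHr]
    push_cast
    field_simp
  have h1 := hcov (E * H * k) (H * k) (E * k) htle htn
  change R k ≤ _ at h1
  set N : ℝ := ((E * H * k : ℕ) : ℝ) with hNdef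
  set Q := 𝔼 σ : Equiv.Perm (Fin (E * H * k)),
    occ τ X σ * cornerStat (E * H * k) (H * k) (E * k) σ with hQ
  have h2 : Q ^ 2 ≤ occVar τ X (E * H * k) * N :=
    (sq_expect_mul_le_occVar_mul τ X (expect_cornerStat htle)).trans
      (mul_le_mul_of_nonneg_left (expect_cornerStat_sq_le htle) (occVar_nonneg _ _ _))
  rw [le_div_iff₀ (by positivity)] at hk
  have h3 : (ℓ / 2 * N ^ m) ^ 2 ≤ Q ^ 2 := by
    have h4 : Q ^ 2 = (ε * Q) ^ 2 := by rw [mul_pow, ← sq_abs ε, hε]; ring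
    rw [h4]
    exact pow_le_pow_left₀ (by positivity) (hk.trans h1) 2
  rw [le_div_iff₀ (by positivity)]
  have h5 : (ℓ / 2) ^ 2 * N ^ (2 * m - 1) * N ≤ occVar τ X (E * H * k) * N := by
    refine le_trans (le_of_eq ?_) (h3.trans h2)
    rw [mul_assoc, ← pow_succ, mul_pow, ← pow_mul]
    congr 2
    omega
  exact le_of_mul_le_mul_right h5 hN

/-! ### Positivity of the limiting variance: consecutive patterns -/

section Windows

variable {p n : ℕ}

/-- The word of the `l` consecutive positions that start at `w`. -/
def interval {l w n : ℕ} (h : w + l ≤ n) : Fin l ↪ Fin n where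
  toFun a := ⟨w + a, by omega⟩
  inj' a b h := by
    have := congrArg Fin.val h
    simp only [Nat.add_left_cancel_iff] at this
    exact Fin.ext this

theorem interval_val {l w : ℕ} (h : w + l ≤ n) (a : Fin l) : (interval h a : ℕ) = w + a := rfl

theorem interval_mem_Pos {w : ℕ} (X : Finset ℕ) (h : w + p ≤ n) :
    (interval h : Fin p → Fin n) ∈ Pos X p n := by
  refine mem_Pos.2 ⟨fun a b hab => ?_, fun a b _ hb => ?_⟩
  · rw [Fin.lt_def, interval_val, interval_val]
    exact Nat.add_lt_add_left hab w
  · rw [interval_val, interval_val]; omega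

/-- The permutation of positions that acts as `τ` on the `p` positions from `w` on. -/
def windowPerm {w : ℕ} (τ : Equiv.Perm (Fin p)) (h : w + p ≤ n) : Equiv.Perm (Fin n) :=
  τ.viaFintypeEmbedding (interval h)

theorem windowPerm_interval {w : ℕ} (τ : Equiv.Perm (Fin p)) (h : w + p ≤ n) (a : Fin p) :
    windowPerm τ h (interval h a) = interval h (τ a) :=
  Equiv.Perm.viaFintypeEmbedding_apply_image _ _ _

theorem windowPerm_of_notMem {w : ℕ} (τ : Equiv.Perm (Fin p)) (h : w + p ≤ n) {x : Fin n}
    (hx : ¬ (w ≤ (x : ℕ) ∧ (x : ℕ) < w + p)) : windowPerm τ h x = x := by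
  refine Equiv.Perm.viaFintypeEmbedding_apply_notMem_range _ _ fun ⟨a, ha⟩ => hx ?_
  rw [← ha, interval_val]
  omega

/-- On a window where `σ` is increasing, rearranging the middle third according to a consecutive
pattern that is not increasing creates an occurrence and destroys none. -/
theorem occ_add_one_le_of_increasing {τ : Equiv.Perm (Fin p)} (hτ : τ ≠ 1) (hp : 0 < p) {w : ℕ}
    (h3 : w + 3 * p ≤ n) (h1 : w + p + p ≤ n) {σ : Equiv.Perm (Fin n)}
    (hσ : ∀ a b : Fin (3 * p), σ (interval h3 a) < σ (interval h3 b) ↔ a < b) :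
    occ τ (Finset.Icc 1 (p - 1)) σ + 1 ≤
      occ τ (Finset.Icc 1 (p - 1)) (σ * windowPerm τ h1) := by
  classical
  set X := Finset.Icc 1 (p - 1) with hX
  have hinc : ∀ x y : Fin n, w ≤ (x : ℕ) → (x : ℕ) < w + 3 * p → w ≤ (y : ℕ) →
      (y : ℕ) < w + 3 * p → (σ x < σ y ↔ x < y) := by
    intro x y hx hx' hy hy'
    have ex : interval h3 ⟨x - w, by omega⟩ = x := by
      ext; rw [interval_val]; simp only; omega
    have ey : interval h3 ⟨y - w, by omega⟩ = y := by
      ext; rw [interval_val]; simp only; omega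
    have := hσ ⟨x - w, by omega⟩ ⟨y - w, by omega⟩
    rw [ex, ey, Fin.lt_def (a := (⟨x - w, _⟩ : Fin (3 * p)))] at this
    rw [this, Fin.lt_def]
    simp only
    omega
  -- a word inside the window is not an occurrence in `σ`
  have hzero : ∀ i ∈ Pos X p n, (∀ a, w ≤ (i a : ℕ) ∧ (i a : ℕ) < w + 3 * p) →
      occInd τ i σ = 0 := by
    intro i hi hw
    have hmono := Pos.strictMono hi
    unfold occInd
    rw [if_neg]
    intro h
    refine hτ (perm_eq_of_lt_iff fun a b => ?_)
    rw [← h a b, hinc _ _ (hw a).1 (hw a).2 (hw b).1 (hw b).2, hmono.lt_iff_lt]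
    rfl
  set μ : Fin p → Fin n := ⇑(interval h1) with hμ
  have hμP : μ ∈ Pos X p n := interval_mem_Pos X h1
  have hμ0 : occInd τ μ σ = 0 := hzero μ hμP fun a => by
    rw [hμ, interval_val]; omega
  have hμ1 : occInd τ μ (σ * windowPerm τ h1) = 1 := by
    unfold occInd
    rw [if_pos]
    intro a b
    rw [Equiv.Perm.mul_apply, Equiv.Perm.mul_apply, hμ, windowPerm_interval, windowPerm_interval,
      hinc _ _ (by rw [interval_val]; omega) (by rw [interval_val]; omega)
        (by rw [interval_val]; omega) (by rw [interval_val]; omega), Fin.lt_def, interval_val,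
      interval_val, Fin.lt_def]
    omega
  have hrest : ∀ i ∈ (Pos X p n).erase μ,
      occInd τ i σ ≤ occInd τ i (σ * windowPerm τ h1) := by
    intro i hi
    have hiP := (Finset.mem_erase.1 hi).2
    by_cases hmeet : ∃ a, w + p ≤ (i a : ℕ) ∧ (i a : ℕ) < w + p + p
    · obtain ⟨a, ha⟩ := hmeet
      rw [hzero i hiP fun b => ?_]
      · exact occInd_nonneg _ _ _
      · have e : ∀ b : Fin p, (i b : ℕ) = i ⟨0, hp⟩ + b := fun b =>
          Pos_apply_of_forall_mem hiP hp b fun x hx hx' => by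
            rw [hX, Finset.mem_Icc]; omega
        have := e a
        have := e b
        omega
    · push Not at hmeet
      refine le_of_eq ?_
      have : ∀ a, windowPerm τ h1 (i a) = i a := fun a =>
        windowPerm_of_notMem τ h1 fun h => absurd (hmeet a h.1) (not_le.2 h.2)
      simp only [occInd, Equiv.Perm.mul_apply, this]
  rw [occ, occ, ← Finset.add_sum_erase _ _ hμP, ← Finset.add_sum_erase _ _ hμP, hμ0, hμ1]
  have := Finset.sum_le_sum hrest
  linarith

/-- The difference between the indicators that the middle third of a window, respectively the
window itself, is arranged like `τ`, respectively increasingly, the rest of the window being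
increasing. -/
noncomputable def windowStat {w : ℕ} (τ : Equiv.Perm (Fin p)) (h3 : w + 3 * p ≤ n)
    (h1 : w + p + p ≤ n) (σ : Equiv.Perm (Fin n)) : ℝ :=
  occInd 1 (interval h3) (σ * (windowPerm τ h1)⁻¹) - occInd 1 (interval h3) σ

theorem expect_windowStat {w : ℕ} (τ : Equiv.Perm (Fin p)) (h3 : w + 3 * p ≤ n)
    (h1 : w + p + p ≤ n) : 𝔼 σ : Equiv.Perm (Fin n), windowStat τ h3 h1 σ = 0 := by
  simp only [windowStat]
  rw [Finset.expect_sub_distrib, expect_perm_mul_right (occInd 1 (interval h3)), sub_self]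

theorem windowPerm_inv_mem {w : ℕ} (τ : Equiv.Perm (Fin p)) (h3 : w + 3 * p ≤ n)
    (h1 : w + p + p ≤ n) {x : Fin n} (hx : x ∈ Finset.univ.image (interval h3)) :
    (windowPerm τ h1)⁻¹ x ∈ Finset.univ.image (interval h3) := by
  have hmem : ∀ y : Fin n, y ∈ Finset.univ.image (interval h3) ↔
      w ≤ (y : ℕ) ∧ (y : ℕ) < w + 3 * p := by
    intro y
    rw [Finset.mem_image]
    constructor
    · rintro ⟨a, _, rfl⟩
      rw [interval_val]; omega
    · intro h
      exact ⟨⟨y - w, by omega⟩, Finset.mem_univ _, by ext; rw [interval_val]; simp only; omega⟩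
  set y := (windowPerm τ h1)⁻¹ x with hy
  have hyx : windowPerm τ h1 y = x := by simp [hy]
  by_cases h : w + p ≤ (y : ℕ) ∧ (y : ℕ) < w + p + p
  · rw [hmem]; omega
  · rw [windowPerm_of_notMem τ h1 h] at hyx
    rw [hyx]; exact hx

theorem orderDet_windowStat {w : ℕ} (τ : Equiv.Perm (Fin p)) (h3 : w + 3 * p ≤ n)
    (h1 : w + p + p ≤ n) : OrderDet (Finset.univ.image (interval h3)) (windowStat τ h3 h1) := by
  intro σ σ' h
  have := orderDet_occInd 1 (interval h3) σ σ' h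
  have h' := orderDet_occInd 1 (interval h3) (σ * (windowPerm τ h1)⁻¹) (σ' * (windowPerm τ h1)⁻¹)
    fun a ha b hb => h _ (windowPerm_inv_mem τ h3 h1 ha) _ (windowPerm_inv_mem τ h3 h1 hb)
  rw [windowStat, windowStat, this, h']

theorem abs_windowStat_le {w : ℕ} (τ : Equiv.Perm (Fin p)) (h3 : w + 3 * p ≤ n)
    (h1 : w + p + p ≤ n) (σ : Equiv.Perm (Fin n)) : |windowStat τ h3 h1 σ| ≤ 1 := by
  have a1 := occInd_nonneg 1 (interval h3) σ
  have a2 := occInd_le_one 1 (interval h3) σ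
  have a3 := occInd_nonneg 1 (interval h3) (σ * (windowPerm τ h1)⁻¹)
  have a4 := occInd_le_one 1 (interval h3) (σ * (windowPerm τ h1)⁻¹)
  rw [windowStat, abs_le]
  constructor <;> linarith

theorem le_expect_occ_mul_windowStat {τ : Equiv.Perm (Fin p)} (hτ : τ ≠ 1) (hp : 0 < p) {w : ℕ}
    (h3 : w + 3 * p ≤ n) (h1 : w + p + p ≤ n) :
    1 / ((3 * p).factorial : ℝ) ≤ 𝔼 σ : Equiv.Perm (Fin n),
      occ τ (Finset.Icc 1 (p - 1)) σ * windowStat τ h3 h1 σ := by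
  simp only [windowStat, mul_sub]
  rw [Finset.expect_sub_distrib, ← expect_perm_mul_right (fun σ => occ τ (Finset.Icc 1 (p - 1)) σ *
    occInd 1 (interval h3) (σ * (windowPerm τ h1)⁻¹)) (windowPerm τ h1)]
  simp only [mul_inv_cancel_right]
  rw [← Finset.expect_sub_distrib, ← expect_occInd (n := n) 1 (interval h3).injective]
  refine Finset.expect_le_expect fun σ _ => ?_
  unfold occInd
  split_ifs with h
  · have := occ_add_one_le_of_increasing hτ hp h3 h1 h
    linarith
  · simp

end Windows

/-- Disjoint windows contribute independent statistics, each with a covariance bounded below: a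
number of windows proportional to `n` gives a variance of order `n`. -/
theorem occVar_limit_pos_of_consecutive_of_ne_one {p : ℕ} {τ : Equiv.Perm (Fin p)} (hτ : τ ≠ 1)
    (hp : 0 < p) {V : ℝ}
    (hV : Tendsto (fun n : ℕ => occVar τ (Finset.Icc 1 (p - 1)) n / (n : ℝ) ^ 1) atTop (𝓝 V)) :
    0 < V := by
  set F : ℝ := ((3 * p).factorial : ℝ) with hF
  have hF0 : 0 < F := by
    rw [hF]
    exact_mod_cast (3 * p).factorial_pos
  have hp0 : (0 : ℝ) < p := by exact_mod_cast hp
  have hu : Tendsto (fun k : ℕ => 3 * p * k) atTop atTop :=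
    tendsto_id.const_mul_atTop' (by omega)
  refine lt_of_lt_of_le (by positivity : 0 < 1 / (3 * p * F ^ 2)) (le_of_tendsto_occVar hV hu ?_)
  filter_upwards [eventually_gt_atTop 0] with k hk
  have hk0 : (0 : ℝ) < k := by exact_mod_cast hk
  -- the windows are the `k` consecutive intervals of length `3 * p`
  have h3 : ∀ j : Fin k, 3 * p * j + 3 * p ≤ 3 * p * k := fun j => by
    rw [← Nat.mul_succ]; exact Nat.mul_le_mul_left _ j.2
  have h1 : ∀ j : Fin k, 3 * p * j + p + p ≤ 3 * p * k := fun j => by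
    have := h3 j; omega
  set Z : Equiv.Perm (Fin (3 * p * k)) → ℝ := fun σ =>
    ∑ j : Fin k, windowStat τ (h3 j) (h1 j) σ with hZ
  have hZ0 : 𝔼 σ, Z σ = 0 := by
    simp only [hZ, Finset.expect_sum_comm, expect_windowStat, Finset.sum_const_zero]
  have hcov : k / F ≤ 𝔼 σ, occ τ (Finset.Icc 1 (p - 1)) σ * Z σ := by
    simp only [hZ, Finset.mul_sum, Finset.expect_sum_comm]
    have := Finset.card_nsmul_le_sum Finset.univ (fun j : Fin k =>
      𝔼 σ, occ τ (Finset.Icc 1 (p - 1)) σ * windowStat τ (h3 j) (h1 j) σ) (1 / F)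
      fun j _ => le_expect_occ_mul_windowStat hτ hp (h3 j) (h1 j)
    rw [Finset.card_univ, Fintype.card_fin, nsmul_eq_mul, mul_one_div] at this
    exact this
  have hdisj : ∀ j j' : Fin k, j ≠ j' → Disjoint (Finset.univ.image (interval (h3 j)))
      (Finset.univ.image (interval (h3 j'))) := by
    intro j j' hjj
    rw [Finset.disjoint_left]
    intro x hx hx'
    obtain ⟨a, _, ha⟩ := Finset.mem_image.1 hx
    obtain ⟨b, _, hb⟩ := Finset.mem_image.1 hx'
    have e : 3 * p * (j : ℕ) + a = 3 * p * j' + b := by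
      rw [← interval_val (h3 j), ← interval_val (h3 j'), ha, hb]
    have hpos : 0 < 3 * p := by omega
    have d1 := Nat.mul_add_div hpos (j : ℕ) a
    have d2 := Nat.mul_add_div hpos (j' : ℕ) b
    rw [Nat.div_eq_of_lt a.2, add_zero] at d1
    rw [Nat.div_eq_of_lt b.2, add_zero] at d2
    exact hjj (Fin.ext (by rw [← d1, ← d2, e]))
  have hsq : 𝔼 σ, Z σ ^ 2 ≤ k := by
    have e1 : ∀ σ, Z σ ^ 2 = ∑ j : Fin k, ∑ j' : Fin k,
        windowStat τ (h3 j) (h1 j) σ * windowStat τ (h3 j') (h1 j') σ := fun σ => by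
      rw [sq, hZ, Finset.sum_mul_sum]
    simp only [e1, Finset.expect_sum_comm]
    have e2 : ∀ j ∈ (Finset.univ : Finset (Fin k)), ∑ j' : Fin k, 𝔼 σ,
        windowStat τ (h3 j) (h1 j) σ * windowStat τ (h3 j') (h1 j') σ ≤ 1 := by
      intro j _
      rw [Finset.sum_eq_single j]
      · refine Finset.expect_le Finset.univ_nonempty fun σ _ => (le_abs_self _).trans ?_
        rw [abs_mul]
        exact mul_le_one₀ (abs_windowStat_le _ _ _ σ) (abs_nonneg _) (abs_windowStat_le _ _ _ σ)
      · intro j' _ hj'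
        rw [expect_mul_of_disjoint (orderDet_windowStat τ (h3 j) (h1 j))
          (orderDet_windowStat τ (h3 j') (h1 j')) (hdisj j j' hj'.symm),
          expect_windowStat, zero_mul]
      · simp
    refine (Finset.sum_le_card_nsmul _ _ _ e2).trans ?_
    simp
  have hcs := sq_expect_mul_le_occVar_mul τ (Finset.Icc 1 (p - 1)) hZ0
  have hvar0 := occVar_nonneg τ (Finset.Icc 1 (p - 1)) (3 * p * k)
  have h5 : (k / F) ^ 2 ≤ occVar τ (Finset.Icc 1 (p - 1)) (3 * p * k) * k :=
    (pow_le_pow_left₀ (by positivity) hcov 2).trans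
      (hcs.trans (mul_le_mul_of_nonneg_left hsq hvar0))
  rw [pow_one, div_le_div_iff₀ (by positivity) (by push_cast; positivity)]
  rw [div_pow, div_le_iff₀ (by positivity)] at h5
  push_cast
  have h6 : (k : ℝ) ≤ occVar τ (Finset.Icc 1 (p - 1)) (3 * p * k) * F ^ 2 := by
    refine le_of_mul_le_mul_right ?_ hk0
    nlinarith
  nlinarith

theorem occInd_revPerm_mul {p n : ℕ} (τ : Equiv.Perm (Fin p)) (i : Fin p → Fin n)
    (σ : Equiv.Perm (Fin n)) :
    occInd (Fin.revPerm * τ) i (Fin.revPerm * σ) = occInd τ i σ := by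
  unfold occInd
  congr 1
  simp only [Equiv.Perm.mul_apply, Fin.revPerm_apply, Fin.rev_lt_rev, eq_iff_iff]
  exact ⟨fun h a b => h b a, fun h a b => h b a⟩

/-- Reflecting the values of the permutation reflects those of the pattern. -/
theorem occVar_revPerm_mul {p : ℕ} (τ : Equiv.Perm (Fin p)) (X : Finset ℕ) (n : ℕ) :
    occVar (Fin.revPerm * τ) X n = occVar τ X n := by
  have h : ∀ σ : Equiv.Perm (Fin n), occ (Fin.revPerm * τ) X (Fin.revPerm * σ) = occ τ X σ :=
    fun σ => by simp only [occ, occInd_revPerm_mul]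
  unfold occVar
  rw [← expect_perm_mul_left (fun σ => occ (Fin.revPerm * τ) X σ) Fin.revPerm,
    ← expect_perm_mul_left _ Fin.revPerm]
  simp only [h]

theorem occVar_limit_pos {p : ℕ} (hp : 2 ≤ p) (τ : Equiv.Perm (Fin p)) {X : Finset ℕ}
    (hX : X ⊆ Finset.Icc 1 (p - 1)) {V : ℝ}
    (hV : Tendsto (fun n : ℕ => occVar τ X n / (n : ℝ) ^ (2 * (p - X.card) - 1)) atTop (𝓝 V)) :
    0 < V := by
  by_cases hm : X.card + 2 ≤ p
  · exact occVar_limit_pos_of_two_blocks τ hX hm hV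
  · have hXe : X = Finset.Icc 1 (p - 1) :=
      Finset.eq_of_subset_of_card_le hX (by rw [Nat.card_Icc]; omega)
    subst hXe
    rw [Nat.card_Icc, show 2 * (p - (p - 1 + 1 - 1)) - 1 = 1 by omega] at hV
    -- the increasing pattern is replaced by the decreasing one
    by_cases hτ : τ = 1
    · refine occVar_limit_pos_of_consecutive_of_ne_one (τ := Fin.revPerm * τ) ?_ (by omega)
        (hV.congr fun n => by rw [occVar_revPerm_mul])
      intro h
      have := congrArg (fun e : Equiv.Perm (Fin p) => ((e ⟨0, by omega⟩ : Fin p) : ℕ)) h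
      simp [hτ, Fin.val_rev] at this
      omega
    · exact occVar_limit_pos_of_consecutive_of_ne_one hτ (by omega) hV

/-! ### Cycles, transpositions and averages over conjugacy classes -/

section Cycles

variable {n : ℕ}

theorem sameCycle_swap_mul {σ : Equiv.Perm (Fin n)} {a b : Fin n} (hab : ¬ σ.SameCycle a b) :
    (Equiv.swap a b * σ).SameCycle a b := by
  -- the orbit of `b` avoids `a` until it comes back to `b`, which is redirected to `a`
  obtain ⟨k, hk, hkb⟩ : ∃ k : ℕ, 0 < k ∧ (σ ^ k) b = b :=
    ⟨orderOf σ, orderOf_pos σ, by rw [pow_orderOf_eq_one]; rfl⟩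
  classical
  have hex : ∃ k : ℕ, 0 < k ∧ (σ ^ k) b = b := ⟨k, hk, hkb⟩
  obtain ⟨hm0, hmb⟩ := Nat.find_spec hex
  set m := Nat.find hex with hm
  have hne : ∀ j : ℕ, (σ ^ j) b ≠ a := fun j h =>
    hab (Equiv.Perm.SameCycle.symm ⟨j, by simpa using h⟩)
  have hstep : ∀ j : ℕ, j < m → ((Equiv.swap a b * σ) ^ j) b = (σ ^ j) b := by
    intro j
    induction j with
    | zero => simp
    | succ j ih =>
      intro hj
      rw [pow_succ', Equiv.Perm.mul_apply, ih (by omega), Equiv.Perm.mul_apply,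
        ← Equiv.Perm.mul_apply σ, ← pow_succ',
        Equiv.swap_apply_of_ne_of_ne (hne _)]
      exact fun h => Nat.find_min hex hj ⟨by omega, h⟩
  refine Equiv.Perm.SameCycle.symm ⟨m, ?_⟩
  obtain ⟨r, hr⟩ : ∃ r, m = r + 1 := ⟨m - 1, by omega⟩
  rw [zpow_natCast, hr, pow_succ', Equiv.Perm.mul_apply, hstep r (by omega),
    Equiv.Perm.mul_apply, ← Equiv.Perm.mul_apply σ, ← pow_succ', ← hr, hmb, Equiv.swap_apply_right]

theorem rel_of_sameCycle {σ : Equiv.Perm (Fin n)} {r : Setoid (Fin n)}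
    (h : ∀ x, r x (σ x)) {x y : Fin n} (hxy : σ.SameCycle x y) : r x y := by
  obtain ⟨k, -, rfl⟩ := hxy.exists_pow_eq'
  clear hxy
  induction k with
  | zero => exact r.refl x
  | succ k ih =>
    rw [pow_succ', Equiv.Perm.mul_apply]
    exact r.trans ih (h _)

/-- Multiplying by a transposition of elements of two different cycles merges these cycles. -/
theorem numCycles_swap_mul_lt {σ : Equiv.Perm (Fin n)} {a b : Fin n} (hab : ¬ σ.SameCycle a b) :
    numCycles (Equiv.swap a b * σ) < numCycles σ := by
  have hss := sameCycle_swap_mul hab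
  have hle : ∀ x y, σ.SameCycle x y → (Equiv.swap a b * σ).SameCycle x y := by
    intro x y hxy
    refine rel_of_sameCycle (r := Equiv.Perm.SameCycle.setoid (Equiv.swap a b * σ))
      (fun z => ?_) hxy
    have h1 : (Equiv.swap a b * σ).SameCycle z ((Equiv.swap a b * σ) z) :=
      Equiv.Perm.sameCycle_apply_right.2 (Equiv.Perm.SameCycle.refl _ _)
    change (Equiv.swap a b * σ).SameCycle z (σ z)
    rw [Equiv.Perm.mul_apply] at h1
    by_cases ha : σ z = a
    · rw [ha, Equiv.swap_apply_left] at h1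
      rw [ha]; exact h1.trans hss.symm
    · by_cases hb : σ z = b
      · rw [hb, Equiv.swap_apply_right] at h1
        rw [hb]; exact h1.trans hss
      · rwa [Equiv.swap_apply_of_ne_of_ne ha hb] at h1
  let f : Quotient (Equiv.Perm.SameCycle.setoid σ) →
      Quotient (Equiv.Perm.SameCycle.setoid (Equiv.swap a b * σ)) :=
    Quotient.map' id fun x y h => hle x y h
  have hsurj : Function.Surjective f := fun z => by
    induction z using Quotient.inductionOn' with
    | h x => exact ⟨Quotient.mk'' x, rfl⟩
  have hninj : ¬ Function.Injective f := fun hinj => hab <| by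
    have h1 : f (Quotient.mk'' a) = f (Quotient.mk'' b) := Quotient.sound' hss
    exact Quotient.exact' (hinj h1)
  unfold numCycles
  refine lt_of_le_of_ne (Nat.card_le_card_of_surjective f hsurj) fun h => hninj ?_
  exact ((Nat.bijective_iff_surjective_and_card f).2 ⟨hsurj, h.symm⟩).1

theorem exists_swap_numCycles_lt {σ : Equiv.Perm (Fin n)} (h : 1 < numCycles σ) :
    ∃ x y, numCycles (σ * Equiv.swap x y) < numCycles σ := by
  unfold numCycles at h
  have := Finite.one_lt_card_iff_nontrivial.1 h
  obtain ⟨u, w, huw⟩ := exists_pair_ne (Quotient (Equiv.Perm.SameCycle.setoid σ))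
  induction u using Quotient.inductionOn' with
  | h a =>
    induction w using Quotient.inductionOn' with
    | h b =>
      refine ⟨σ.symm a, σ.symm b, ?_⟩
      rw [Equiv.mul_swap_eq_swap_mul]
      simp only [Equiv.apply_symm_apply]
      exact numCycles_swap_mul_lt fun h => huw (Quotient.sound' h)

theorem sameCycle_of_numCycles_le_one {σ : Equiv.Perm (Fin n)} (h : numCycles σ ≤ 1)
    (x y : Fin n) : σ.SameCycle x y := by
  have := Finite.card_le_one_iff_subsingleton.1 h
  exact Quotient.exact' (Subsingleton.elim (Quotient.mk'' x : Quotient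
    (Equiv.Perm.SameCycle.setoid σ)) (Quotient.mk'' y))

theorem isConj_of_numCycles_le_one {σ ρ : Equiv.Perm (Fin n)} (hσ : numCycles σ ≤ 1)
    (hρ : numCycles ρ ≤ 1) : IsConj σ ρ := by
  rcases subsingleton_or_nontrivial (Fin n) with hn | hn
  · rw [Subsingleton.elim σ ρ]
  · have key : ∀ σ : Equiv.Perm (Fin n), numCycles σ ≤ 1 →
        σ.cycleType = {(Finset.univ : Finset (Fin n)).card} := by
      intro σ hσ
      have hmove : ∀ x, σ x ≠ x := fun x hx => by
        obtain ⟨y, hy⟩ := exists_ne x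
        obtain ⟨k, hk⟩ := sameCycle_of_numCycles_le_one hσ x y
        rw [Equiv.Perm.zpow_apply_eq_self_of_apply_eq_self hx] at hk
        exact hy hk.symm
      obtain ⟨x, -⟩ := exists_pair_ne (Fin n)
      have hc : σ.IsCycle := ⟨x, hmove x, fun y _ => sameCycle_of_numCycles_le_one hσ x y⟩
      rw [hc.cycleType]
      congr 2
      ext y
      simp [hmove y]
    rw [Equiv.Perm.isConj_iff_cycleType_eq, key σ hσ, key ρ hρ]

/-- The average of `f` over the conjugates of `σ`. -/
noncomputable def conjMean (f : Equiv.Perm (Fin n) → ℂ) (σ : Equiv.Perm (Fin n)) : ℂ :=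
  𝔼 π : Equiv.Perm (Fin n), f (π⁻¹ * σ * π)

theorem conjMean_eq_of_isConj (f : Equiv.Perm (Fin n) → ℂ) {σ ρ : Equiv.Perm (Fin n)}
    (h : IsConj σ ρ) : conjMean f σ = conjMean f ρ := by
  obtain ⟨c, rfl⟩ := isConj_iff.1 h
  unfold conjMean
  conv_rhs => rw [← expect_perm_mul_left _ c]
  simp [mul_assoc]

theorem norm_conjMean_le {f : Equiv.Perm (Fin n) → ℂ} (hf : ∀ σ, ‖f σ‖ ≤ 1)
    (σ : Equiv.Perm (Fin n)) : ‖conjMean f σ‖ ≤ 1 :=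
  norm_expect_le_of_forall_le fun _ => hf _

theorem norm_conjMean_mul_swap_sub_le {f : Equiv.Perm (Fin n) → ℂ} {c : ℝ}
    (hf : ∀ σ x y, ‖f (σ * Equiv.swap x y) - f σ‖ ≤ c) (σ : Equiv.Perm (Fin n)) (x y : Fin n) :
    ‖conjMean f (σ * Equiv.swap x y) - conjMean f σ‖ ≤ c := by
  refine norm_expect_sub_expect_le fun π => ?_
  have : π⁻¹ * (σ * Equiv.swap x y) * π =
      (π⁻¹ * σ * π) * Equiv.swap (π⁻¹ x) (π⁻¹ y) := by
    rw [mul_assoc (π⁻¹ * σ), Equiv.mul_swap_eq_swap_mul π]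
    simp [mul_assoc]
  rw [this]
  exact hf _ _ _

/-- Merging the cycles of `σ` one after the other leads to a long cycle. -/
theorem exists_numCycles_le_one_conjMean {f : Equiv.Perm (Fin n) → ℂ} {c : ℝ} (hc : 0 ≤ c)
    (hf : ∀ σ x y, ‖f (σ * Equiv.swap x y) - f σ‖ ≤ c) (σ : Equiv.Perm (Fin n)) :
    ∃ ρ, numCycles ρ ≤ 1 ∧ ‖conjMean f σ - conjMean f ρ‖ ≤ c * numCycles σ := by
  induction hk : numCycles σ using Nat.strong_induction_on generalizing σ with
  | _ k ih =>
    rcases Nat.lt_or_ge 1 k with h1 | h1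
    · obtain ⟨x, y, hxy⟩ := exists_swap_numCycles_lt (hk ▸ h1 : 1 < numCycles σ)
      rw [hk] at hxy
      obtain ⟨ρ, hρ, h2⟩ := ih _ hxy (σ * Equiv.swap x y) rfl
      refine ⟨ρ, hρ, ?_⟩
      have h3 := norm_conjMean_mul_swap_sub_le hf σ x y
      rw [norm_sub_rev] at h3
      have h4 : (numCycles (σ * Equiv.swap x y) : ℝ) + 1 ≤ k := by exact_mod_cast hxy
      refine (norm_sub_le_norm_sub_add_norm_sub _ _ _).trans ((add_le_add h3 h2).trans ?_)
      nlinarith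
    · exact ⟨σ, hk ▸ h1, by rw [sub_self, norm_zero]; positivity⟩

theorem exists_numCycles_le_one (n : ℕ) : ∃ ρ : Equiv.Perm (Fin n), numCycles ρ ≤ 1 := by
  obtain ⟨ρ, hρ, -⟩ := exists_numCycles_le_one_conjMean (f := fun _ : Equiv.Perm (Fin n) => 0)
    le_rfl (by simp) 1
  exact ⟨ρ, hρ⟩

/-- A statistic that changes little under transpositions has, on the conjugacy class of `σ`, almost
the same mean as on the class of the long cycles if `σ` has few cycles. -/
theorem norm_conjMean_sub_le {f : Equiv.Perm (Fin n) → ℂ} {c : ℝ} (hc : 0 ≤ c)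
    (hf : ∀ σ x y, ‖f (σ * Equiv.swap x y) - f σ‖ ≤ c) {ρ : Equiv.Perm (Fin n)}
    (hρ : numCycles ρ ≤ 1) (σ : Equiv.Perm (Fin n)) :
    ‖conjMean f σ - conjMean f ρ‖ ≤ c * numCycles σ := by
  obtain ⟨ρ', hρ', h⟩ := exists_numCycles_le_one_conjMean hc hf σ
  rwa [conjMean_eq_of_isConj f (isConj_of_numCycles_le_one hρ' hρ)] at h

theorem numCycles_decomposeFin_zero_le (e : Equiv.Perm (Fin n)) :
    numCycles (Equiv.Perm.decomposeFin.symm ((0 : Fin (n + 1)), e)) ≤ numCycles e + 1 := by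
  set σ := Equiv.Perm.decomposeFin.symm ((0 : Fin (n + 1)), e) with hσ
  have hs : ∀ x : Fin n, σ x.succ = (e x).succ := fun x => by
    rw [hσ, Equiv.Perm.decomposeFin_symm_apply_succ]; simp
  have hcyc : ∀ x y, e.SameCycle x y → σ.SameCycle x.succ y.succ := fun x y h =>
    rel_of_sameCycle (r := (Equiv.Perm.SameCycle.setoid σ).comap Fin.succ)
      (fun z => by
        change σ.SameCycle z.succ (e z).succ
        rw [← hs]
        exact Equiv.Perm.sameCycle_apply_right.2 (Equiv.Perm.SameCycle.refl _ _)) h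
  let f : Option (Quotient (Equiv.Perm.SameCycle.setoid e)) →
      Quotient (Equiv.Perm.SameCycle.setoid σ) := fun o =>
    o.elim (Quotient.mk'' 0) (Quotient.map' Fin.succ hcyc)
  have hsurj : Function.Surjective f := fun z => by
    induction z using Quotient.inductionOn' with
    | h x =>
      induction x using Fin.cases with
      | zero => exact ⟨none, rfl⟩
      | succ x => exact ⟨some (Quotient.mk'' x), rfl⟩
  have := Nat.card_le_card_of_surjective f hsurj
  rwa [Finite.card_option] at this

theorem numCycles_decomposeFin_le (a : Fin (n + 1)) (e : Equiv.Perm (Fin n)) :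
    numCycles (Equiv.Perm.decomposeFin.symm (a, e)) ≤ numCycles e + if a = 0 then 1 else 0 := by
  split_ifs with ha
  · rw [ha]; exact numCycles_decomposeFin_zero_le e
  · set σ := Equiv.Perm.decomposeFin.symm ((0 : Fin (n + 1)), e) with hσ
    have h0 : σ 0 = 0 := by rw [hσ, Equiv.Perm.decomposeFin_symm_apply_zero]
    -- a new point that is not fixed is merged into the cycle of `a`
    have hdec : Equiv.Perm.decomposeFin.symm (a, e) = Equiv.swap 0 a * σ := by
      ext x
      induction x using Fin.cases with
      | zero => simp [h0]
      | succ x => simp [hσ]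
    have hnot : ¬ σ.SameCycle 0 a := fun ⟨k, hk⟩ => ha <| by
      rw [Equiv.Perm.zpow_apply_eq_self_of_apply_eq_self h0] at hk
      exact hk.symm
    have h1 := numCycles_swap_mul_lt hnot
    have h2 : numCycles σ ≤ numCycles e + 1 := numCycles_decomposeFin_zero_le e
    rw [hdec]
    omega

/-- Inserting a new point into a uniform permutation creates a new cycle with probability
`1 / (n + 1)`. -/
theorem expect_numCycles_le_harmonic (n : ℕ) :
    𝔼 σ : Equiv.Perm (Fin n), (numCycles σ : ℝ) ≤ (harmonic n : ℝ) := by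
  induction n with
  | zero =>
    refine Finset.expect_le Finset.univ_nonempty fun σ _ => ?_
    simp [numCycles]
  | succ n ih =>
    have h1 : 𝔼 σ : Equiv.Perm (Fin (n + 1)), (numCycles σ : ℝ) =
        𝔼 z : Fin (n + 1) × Equiv.Perm (Fin n),
          (numCycles (Equiv.Perm.decomposeFin.symm z) : ℝ) :=
      Fintype.expect_equiv Equiv.Perm.decomposeFin _ _ fun σ => by rw [Equiv.symm_apply_apply]
    have h2 : 𝔼 z : Fin (n + 1) × Equiv.Perm (Fin n),
          (numCycles (Equiv.Perm.decomposeFin.symm z) : ℝ) ≤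
        𝔼 z : Fin (n + 1) × Equiv.Perm (Fin n),
          ((numCycles z.2 : ℝ) + if z.1 = 0 then 1 else 0) :=
      Finset.expect_le_expect fun z _ => by
        have := numCycles_decomposeFin_le z.1 z.2
        have h3 : ((numCycles z.2 + if z.1 = 0 then 1 else 0 : ℕ) : ℝ) =
          (numCycles z.2 : ℝ) + if z.1 = 0 then 1 else 0 := by push_cast; rfl
        rw [← h3]
        exact_mod_cast this
    rw [h1]
    refine h2.trans ?_
    rw [Finset.expect_add_distrib, ← Finset.univ_product_univ, Finset.expect_product,
      Finset.expect_product]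
    have h3 : 𝔼 a : Fin (n + 1), 𝔼 _e : Equiv.Perm (Fin n), (if a = 0 then (1 : ℝ) else 0) =
        1 / (n + 1) := by
      rw [Finset.expect_congr rfl fun a _ => Finset.expect_const Finset.univ_nonempty _,
        Fintype.expect_eq_sum_div_card]
      simp
    simp only [h3, Fintype.expect_const, harmonic_succ]
    push_cast
    rw [one_div]
    linarith

end Cycles

/-! ### The normalized count: transpositions and the uniform case -/

theorem abs_occ_mul_swap_sub_le {p n : ℕ} (τ : Equiv.Perm (Fin p)) {X : Finset ℕ}
    (hX : X ⊆ Finset.Icc 1 (p - 1)) (σ : Equiv.Perm (Fin n)) (x y : Fin n) :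
    |occ τ X (σ * Equiv.swap x y) - occ τ X σ| ≤ 2 * p * (n : ℝ) ^ (p - X.card - 1) := by
  rw [occ, occ, ← Finset.sum_sub_distrib,
    ← Finset.sum_filter_add_sum_filter_not _ fun i => ∃ a, i a ∈ ({x, y} : Finset (Fin n))]
  have h1 : ∑ i ∈ Pos X p n with ¬ ∃ a, i a ∈ ({x, y} : Finset (Fin n)),
      (occInd τ i (σ * Equiv.swap x y) - occInd τ i σ) = 0 := by
    refine Finset.sum_eq_zero fun i hi => ?_
    have hi' := (Finset.mem_filter.1 hi).2
    push Not at hi'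
    have : ∀ a, Equiv.swap x y (i a) = i a := fun a => by
      have := hi' a
      simp only [Finset.mem_insert, Finset.mem_singleton, not_or] at this
      exact Equiv.swap_apply_of_ne_of_ne this.1 this.2
    simp only [occInd, Equiv.Perm.mul_apply, this, sub_self]
  rw [h1, add_zero]
  refine (Finset.abs_sum_le_sum_abs _ _).trans
    ((Finset.sum_le_card_nsmul _ _ 1 fun i _ => ?_).trans ?_)
  · rw [abs_le]
    constructor <;> linarith [occInd_nonneg τ i σ, occInd_le_one τ i σ,
      occInd_nonneg τ i (σ * Equiv.swap x y), occInd_le_one τ i (σ * Equiv.swap x y)]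
  · rw [nsmul_eq_mul, mul_one]
    have h2 := (card_Pos_meet_le hX ({x, y} : Finset (Fin n))).trans
      (Nat.mul_le_mul_right _ (Nat.mul_le_mul_right p Finset.card_le_two))
    exact_mod_cast h2

section Normalized

variable {p : ℕ} (v : VincularPattern p)

theorem adj_card_lt (hp : 1 ≤ p) : v.adj.card < p := by
  have : v.adj.card ≤ p - 1 := by simpa using Finset.card_le_card v.adj_subset
  omega

theorem rpow_normalization (hp : 1 ≤ p) {n : ℕ} (hn : 0 < n) :
    (n : ℝ) ^ ((p : ℝ) - (v.adj.card : ℝ) - 1 / 2) = (n : ℝ) ^ (p - v.adj.card) / √n := by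
  have hn' : (0 : ℝ) < n := by exact_mod_cast hn
  rw [Real.rpow_sub hn', ← Nat.cast_sub (adj_card_lt v hp).le, Real.rpow_natCast,
    ← Real.sqrt_eq_rpow]

theorem normalizedOccurrences_eq (hp : 1 ≤ p) {n : ℕ} (hn : 0 < n) (σ : Equiv.Perm (Fin n)) :
    normalizedOccurrences v σ = (√n / (n : ℝ) ^ (p - v.adj.card)) * (occ v.perm v.adj σ -
      (n : ℝ) ^ (p - v.adj.card) / (p.factorial * (p - v.adj.card).factorial)) := by
  rw [normalizedOccurrences, rpow_normalization v hp hn, numOccurrences_eq_occ, div_div_eq_mul_div]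
  ring

/-- A transposition affects only the words that use one of two positions. -/
theorem abs_normalizedOccurrences_mul_swap_sub_le (hp : 1 ≤ p) {n : ℕ} (σ : Equiv.Perm (Fin n))
    (x y : Fin n) :
    |normalizedOccurrences v (σ * Equiv.swap x y) - normalizedOccurrences v σ| ≤
      2 * p / √n := by
  have hn : 0 < n := x.pos
  have hn' : (0 : ℝ) < n := by exact_mod_cast hn
  have hm := adj_card_lt v hp
  rw [normalizedOccurrences_eq v hp hn, normalizedOccurrences_eq v hp hn, ← mul_sub,
    sub_sub_sub_cancel_right, abs_mul, abs_of_nonneg (by positivity)]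
  refine (mul_le_mul_of_nonneg_left (abs_occ_mul_swap_sub_le v.perm v.adj_subset σ x y)
    (by positivity)).trans (le_of_eq ?_)
  have e : (n : ℝ) ^ (p - v.adj.card) = (n : ℝ) ^ (p - v.adj.card - 1) * n := by
    rw [← pow_succ]; congr 1; omega
  have hs : √(n : ℝ) * √n = n := Real.mul_self_sqrt hn'.le
  rw [e, eq_div_iff (by positivity), div_mul_eq_mul_div, div_mul_eq_mul_div,
    div_eq_iff (by positivity)]
  linear_combination (2 * p * (n : ℝ) ^ (p - v.adj.card - 1)) * hs

theorem tendsto_const_div_sqrt (c : ℝ) :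
    Tendsto (fun n : ℕ => c / √(n : ℝ)) atTop (𝓝 0) :=
  tendsto_const_nhds.div_atTop
    (Real.tendsto_sqrt_atTop.comp tendsto_natCast_atTop_atTop)

/-- The central limit theorem for uniform permutations, in terms of characteristic functions. -/
theorem tendsto_expect_cis_normalizedOccurrences (hp : 1 ≤ p) {V : ℝ}
    (hV : Tendsto (fun n : ℕ => occVar v.perm v.adj n / (n : ℝ) ^ (2 * (p - v.adj.card) - 1))
      atTop (𝓝 V)) (t : ℝ) :
    Tendsto (fun n : ℕ => 𝔼 σ : Equiv.Perm (Fin n), cis (t * normalizedOccurrences v σ)) atTop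
      (𝓝 (Complex.exp (-(V : ℂ) * t ^ 2 / 2))) := by
  set m := p - v.adj.card with hm
  have hm1 : 1 ≤ m := by have := adj_card_lt v hp; omega
  set c : ℕ → ℝ := fun n => √n / (n : ℝ) ^ m with hc
  set μ : ℕ → ℝ := fun n => 𝔼 σ : Equiv.Perm (Fin n), occ v.perm v.adj σ with hμ
  set d : ℕ → ℝ := fun n => c n * (μ n - (n : ℝ) ^ m / (p.factorial * m.factorial)) with hd
  -- the error made in the centring is negligible
  have hd0 : Tendsto d atTop (𝓝 0) := by
    refine squeeze_zero_norm' ?_ (tendsto_const_div_sqrt (m * (v.adj.card + m)))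
    filter_upwards [eventually_gt_atTop 0] with n hn
    have hn' : (0 : ℝ) < n := by exact_mod_cast hn
    have hF : (1 : ℝ) ≤ p.factorial := by exact_mod_cast p.factorial_pos
    have h1 := abs_choose_sub_le v.adj.card m n
    have e1 : μ n - (n : ℝ) ^ m / (p.factorial * m.factorial) =
        (((n - v.adj.card).choose m : ℝ) - (n : ℝ) ^ m / m.factorial) / p.factorial := by
      simp only [hμ]
      rw [expect_occ v.perm v.adj_subset, ← hm]
      field_simp
    have hs : √(n : ℝ) * √n = n := Real.mul_self_sqrt hn'.le
    have hc0 : 0 ≤ c n := by simp only [hc]; positivity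
    rw [Real.norm_eq_abs]
    simp only [hd]
    rw [e1, abs_mul, abs_of_nonneg hc0, abs_div, abs_of_pos (by positivity : (0 : ℝ) < p.factorial)]
    calc c n * (|((n - v.adj.card).choose m : ℝ) - (n : ℝ) ^ m / m.factorial| / p.factorial)
        ≤ c n * (m * (v.adj.card + m) * (n : ℝ) ^ (m - 1)) := by
          gcongr
          exact (div_le_self (abs_nonneg _) hF).trans h1
      _ = m * (v.adj.card + m) / √n := by
          have e : (n : ℝ) ^ m = (n : ℝ) ^ (m - 1) * n := by
            rw [← pow_succ, Nat.sub_add_cancel hm1]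
          simp only [hc]
          rw [e, eq_div_iff (by positivity), div_mul_eq_mul_div, div_mul_eq_mul_div,
            div_eq_iff (by positivity)]
          linear_combination (m * (v.adj.card + m) * (n : ℝ) ^ (m - 1)) * hs
  have hvar : Tendsto (fun n : ℕ => Complex.exp
      (-((c n ^ 2 * occVar v.perm v.adj n : ℝ) : ℂ) * t ^ 2 / 2)) atTop
      (𝓝 (Complex.exp (-(V : ℂ) * t ^ 2 / 2))) := by
    have h1 : Tendsto (fun n : ℕ => c n ^ 2 * occVar v.perm v.adj n) atTop (𝓝 V) := by
      refine hV.congr' ?_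
      filter_upwards [eventually_gt_atTop 0] with n hn
      have hn' : (0 : ℝ) < n := by exact_mod_cast hn
      have e : ((n : ℝ) ^ m) ^ 2 = (n : ℝ) ^ (2 * m - 1) * n := by
        rw [← pow_mul, ← pow_succ]; congr 1; omega
      simp only [hc]
      rw [div_pow, Real.sq_sqrt hn'.le, e]
      field_simp
    have h2 : Continuous fun x : ℝ => Complex.exp (-(x : ℂ) * t ^ 2 / 2) := by fun_prop
    exact (h2.tendsto V).comp h1
  have hmain : Tendsto (fun n : ℕ => 𝔼 σ : Equiv.Perm (Fin n),
      cis (t * (c n * (occ v.perm v.adj σ - μ n)))) atTop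
      (𝓝 (Complex.exp (-(V : ℂ) * t ^ 2 / 2))) := by
    have h1 : Tendsto (fun n : ℕ => 𝔼 σ : Equiv.Perm (Fin n),
        cis (t * (c n * (occ v.perm v.adj σ - μ n))) - Complex.exp
        (-((c n ^ 2 * occVar v.perm v.adj n : ℝ) : ℂ) * t ^ 2 / 2)) atTop (𝓝 0) := by
      refine squeeze_zero_norm' ?_ (tendsto_const_div_sqrt (5 * p ^ 4 * |t| ^ 3))
      filter_upwards [eventually_gt_atTop 0] with n hn
      have hn' : (0 : ℝ) < n := by exact_mod_cast hn
      have hc0 : 0 ≤ c n := by simp only [hc]; positivity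
      refine (norm_expect_cis_occ_sub_le v.perm v.adj (c n) v.adj_subset hc0 t).trans
        (le_of_eq ?_)
      have hs : √(n : ℝ) * √n = n := Real.mul_self_sqrt hn'.le
      have e : (n : ℝ) ^ m = (n : ℝ) ^ (m - 1) * n := by
        rw [← pow_succ, Nat.sub_add_cancel hm1]
      have hsp : 0 < √(n : ℝ) := Real.sqrt_pos.2 hn'
      have e4 : √(n : ℝ) ^ 4 = (n : ℝ) ^ 2 := by
        rw [show √(n : ℝ) ^ 4 = (√(n : ℝ) * √n) ^ 2 by ring, hs]
      simp only [hc]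
      rw [← hm, e]
      field_simp
      linear_combination |t| ^ 3 * e4
    have h2 := h1.add hvar
    simpa using h2
  have hdiff : Tendsto (fun n : ℕ => 𝔼 σ : Equiv.Perm (Fin n),
      cis (t * normalizedOccurrences v σ) - 𝔼 σ : Equiv.Perm (Fin n),
      cis (t * (c n * (occ v.perm v.adj σ - μ n)))) atTop (𝓝 0) := by
    have h0 : Tendsto (fun n => |t| * |d n|) atTop (𝓝 0) := by
      simpa using hd0.abs.const_mul |t|
    refine squeeze_zero_norm' ?_ h0
    filter_upwards [eventually_gt_atTop 0] with n hn
    refine norm_expect_sub_expect_le fun σ => (norm_cis_sub_cis_le _ _).trans (le_of_eq ?_)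
    rw [normalizedOccurrences_eq v hp hn, ← mul_sub, abs_mul]
    congr 2
    simp only [hd, hc, ← hm]
    ring
  have := hdiff.add hmain
  simpa using this

end Normalized

/-! ### From uniform to conjugation invariant permutations -/

section Universality

theorem sqrt_eq_rpow_one_div_two (n : ℕ) : (n : ℝ) ^ (1 / (2 : ℝ)) = √n :=
  (Real.sqrt_eq_rpow _).symm

theorem integrable_comp_perm {n : ℕ} {Ω : Type*} [MeasurableSpace Ω] {P : Measure Ω}
    [IsProbabilityMeasure P] {σ : Ω → Equiv.Perm (Fin n)} (hσ : Measurable σ) {E : Type*}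
    [NormedAddCommGroup E] (f : Equiv.Perm (Fin n) → E) : Integrable (fun ω => f (σ ω)) P := by
  have h1 : Integrable f (P.map σ) := by
    have := Measure.isProbabilityMeasure_map (μ := P) hσ.aemeasurable
    exact Integrable.of_finite
  exact h1.comp_measurable hσ

/-- Under a conjugation invariant law, a statistic has the same mean as its average over conjugacy
classes. -/
theorem integral_eq_integral_conjMean {n : ℕ} {Ω : Type*} [MeasurableSpace Ω] {P : Measure Ω}
    [IsProbabilityMeasure P] {σ : Ω → Equiv.Perm (Fin n)} (hσ : Measurable σ)
    (hinv : ∀ π : Equiv.Perm (Fin n), IdentDistrib σ (fun ω => π⁻¹ * σ ω * π) P P)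
    (f : Equiv.Perm (Fin n) → ℂ) : ∫ ω, f (σ ω) ∂P = ∫ ω, conjMean f (σ ω) ∂P := by
  have h1 : ∀ π : Equiv.Perm (Fin n), ∫ ω, f (π⁻¹ * σ ω * π) ∂P = ∫ ω, f (σ ω) ∂P := fun π =>
    (((hinv π).comp (measurable_of_finite f)).integral_eq).symm
  simp only [conjMean, Fintype.expect_eq_sum_div_card]
  rw [integral_div, integral_finsetSum _ fun π _ =>
    integrable_comp_perm hσ fun s => f (π⁻¹ * s * π)]
  simp only [h1]
  rw [Finset.sum_const, Finset.card_univ, nsmul_eq_mul, mul_div_cancel_left₀]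
  exact_mod_cast Fintype.card_ne_zero

/-- The universality principle: for a statistic that a transposition changes by `O(1 / √n)`, every
conjugation invariant permutation with `o(√n)` cycles behaves like a uniform long cycle. -/
theorem tendsto_integral_sub_conjMean {Ω : ℕ → Type*} [∀ n, MeasurableSpace (Ω n)]
    {P : ∀ n, Measure (Ω n)} [∀ n, IsProbabilityMeasure (P n)]
    {σ : ∀ n, Ω n → Equiv.Perm (Fin n)} (hσ : ∀ n, Measurable (σ n)) (h : HInvProb 2 P σ)
    {f : ∀ n, Equiv.Perm (Fin n) → ℂ} (hf1 : ∀ n s, ‖f n s‖ ≤ 1) {C : ℝ} (hC : 0 ≤ C)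
    (hf : ∀ n s x y, ‖f n (s * Equiv.swap x y) - f n s‖ ≤ C / √n)
    {ρ : ∀ n, Equiv.Perm (Fin n)} (hρ : ∀ n, numCycles (ρ n) ≤ 1) :
    Tendsto (fun n => ∫ ω, f n (σ n ω) ∂P n - conjMean (f n) (ρ n)) atTop (𝓝 0) := by
  obtain ⟨hinv, hprob⟩ := h
  rw [tendsto_zero_iff_norm_tendsto_zero]
  -- the bound obtained by cutting at `ε √n` cycles
  have hbound : ∀ ε : ℝ, 0 < ε → ∀ n : ℕ, 1 ≤ n →
      ‖∫ ω, f n (σ n ω) ∂P n - conjMean (f n) (ρ n)‖ ≤ C * ε +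
        2 * (P n).real {ω | ε ≤ |(numCycles (σ n ω) : ℝ) / (n : ℝ) ^ (1 / (2 : ℝ))|} := by
    intro ε hε n hn
    have hn' : (0 : ℝ) < √n := Real.sqrt_pos.2 (by exact_mod_cast hn)
    set S : Set (Ω n) := {ω | ε ≤ |(numCycles (σ n ω) : ℝ) / (n : ℝ) ^ (1 / (2 : ℝ))|} with hS
    have hSm : MeasurableSet S :=
      (hσ n) (MeasurableSpace.measurableSet_top (s :=
        {s : Equiv.Perm (Fin n) | ε ≤ |(numCycles s : ℝ) / (n : ℝ) ^ (1 / (2 : ℝ))|}))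
    rw [integral_eq_integral_conjMean (hσ n) (hinv n hn)]
    have e1 : ∫ ω, conjMean (f n) (σ n ω) ∂P n - conjMean (f n) (ρ n) =
        ∫ ω, (conjMean (f n) (σ n ω) - conjMean (f n) (ρ n)) ∂P n := by
      rw [integral_sub (integrable_comp_perm (hσ n) _) (integrable_const _)]
      simp
    rw [e1]
    refine (norm_integral_le_integral_norm _).trans ?_
    have e2 : ∀ ω, ‖conjMean (f n) (σ n ω) - conjMean (f n) (ρ n)‖ ≤
        C * ε + 2 * S.indicator (fun _ => (1 : ℝ)) ω := by
      intro ω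
      by_cases hω : ω ∈ S
      · rw [Set.indicator_of_mem hω]
        have := norm_sub_le (conjMean (f n) (σ n ω)) (conjMean (f n) (ρ n))
        have := norm_conjMean_le (hf1 n) (σ n ω)
        have := norm_conjMean_le (hf1 n) (ρ n)
        have : 0 ≤ C * ε := by positivity
        linarith
      · rw [Set.indicator_of_notMem hω, mul_zero, add_zero]
        refine (norm_conjMean_sub_le (by positivity) (hf n) (hρ n) (σ n ω)).trans ?_
        have h1 : (numCycles (σ n ω) : ℝ) / √n < ε := by
          have : |(numCycles (σ n ω) : ℝ) / (n : ℝ) ^ (1 / (2 : ℝ))| < ε := not_le.1 hω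
          rw [sqrt_eq_rpow_one_div_two] at this
          exact lt_of_abs_lt this
        rw [div_mul_eq_mul_div, mul_div_assoc]
        gcongr
    have hi : Integrable (fun ω => 2 * S.indicator (fun _ => (1 : ℝ)) ω) (P n) :=
      ((integrable_const (1 : ℝ)).indicator hSm).const_mul 2
    refine (integral_mono (integrable_comp_perm (hσ n)
      fun s => ‖conjMean (f n) s - conjMean (f n) (ρ n)‖)
      ((integrable_const (C * ε)).add hi) e2).trans (le_of_eq ?_)
    simp only [Pi.add_apply]
    rw [integral_add (integrable_const _) hi, integral_const_mul (2 : ℝ),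
      integral_indicator_const _ hSm]
    simp
  rw [Metric.tendsto_atTop]
  intro η hη
  set ε : ℝ := η / (2 * (C + 1)) with hεdef
  have hε : 0 < ε := by positivity
  have hCε : C * ε < η / 2 := by
    have : (C + 1) * ε = η / 2 := by
      rw [hεdef]; field_simp
    nlinarith
  have hlim := (ENNReal.tendsto_toReal ENNReal.zero_ne_top).comp (hprob ε hε)
  obtain ⟨N, hN⟩ := (Metric.tendsto_atTop.1 hlim) (η / 4) (by positivity)
  refine ⟨max N 1, fun n hn => ?_⟩
  have h1 := hN n (le_of_max_le_left hn)
  have h2 := hbound ε hε n (le_of_max_le_right hn)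
  rw [Real.dist_eq, Function.comp_apply, ENNReal.toReal_zero, sub_zero] at h1
  have h3 := (le_abs_self _).trans_lt h1
  rw [Real.dist_eq, sub_zero, abs_of_nonneg (norm_nonneg _)]
  rw [measureReal_def] at h2
  linarith

theorem integral_uniform {n : ℕ} {E : Type*} [NormedAddCommGroup E] [NormedSpace ℝ E]
    [CompleteSpace E] (f : Equiv.Perm (Fin n) → E) :
    ∫ s, f s ∂(PMF.uniformOfFintype (Equiv.Perm (Fin n))).toMeasure =
      ((Fintype.card (Equiv.Perm (Fin n)) : ℝ)⁻¹) • ∑ s, f s := by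
  rw [PMF.integral_eq_sum, Finset.smul_sum]
  simp

/-- The uniform permutation is conjugation invariant and has `O(log n)` cycles on average. -/
theorem hInvProb_uniform :
    HInvProb 2 (fun n : ℕ => (PMF.uniformOfFintype (Equiv.Perm (Fin n))).toMeasure)
      (fun _ s => s) := by
  refine ⟨fun n _ π => ?_, fun ε hε => ?_⟩
  · refine ⟨aemeasurable_id, (measurable_of_finite _).aemeasurable, ?_⟩
    refine Measure.ext_of_singleton fun s => ?_
    change Measure.map (fun x => x) _ {s} = Measure.map (fun ω => π⁻¹ * ω * π) _ {s}
    rw [Measure.map_id', Measure.map_apply (measurable_of_finite _) (MeasurableSet.singleton s)]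
    have : (fun ω : Equiv.Perm (Fin n) => π⁻¹ * ω * π) ⁻¹' {s} = {π * s * π⁻¹} := by
      ext ω
      simp only [Set.mem_preimage, Set.mem_singleton_iff]
      constructor
      · rintro rfl; group
      · rintro rfl; group
    rw [this, PMF.toMeasure_apply_singleton _ _ (MeasurableSet.singleton _),
      PMF.toMeasure_apply_singleton _ _ (MeasurableSet.singleton _)]
    simp
  · -- Markov's inequality; the mean number of cycles is at most the harmonic number
    set μ : ∀ n : ℕ, Measure (Equiv.Perm (Fin n)) := fun n =>
      (PMF.uniformOfFintype (Equiv.Perm (Fin n))).toMeasure with hμ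
    have hreal : Tendsto (fun n : ℕ => (μ n).real
        {s | ε ≤ |(numCycles s : ℝ) / (n : ℝ) ^ (1 / (2 : ℝ))|}) atTop (𝓝 0) := by
      have hb : Tendsto (fun n : ℕ => ε⁻¹ * ((1 + Real.log n) / √n)) atTop (𝓝 0) := by
        have h1 : Tendsto (fun n : ℕ => Real.log n / √n) atTop (𝓝 0) := by
          have := (isLittleO_log_rpow_atTop (by norm_num : (0 : ℝ) < 1 / 2)).tendsto_div_nhds_zero
          simp only [← Real.sqrt_eq_rpow] at this
          exact this.comp tendsto_natCast_atTop_atTop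
        have h2 := ((tendsto_const_div_sqrt 1).add h1).const_mul ε⁻¹
        simpa [add_div] using h2
      refine squeeze_zero' (Eventually.of_forall fun n => measureReal_nonneg) ?_ hb
      filter_upwards [eventually_gt_atTop 0] with n hn
      have hn' : (0 : ℝ) < √n := Real.sqrt_pos.2 (by exact_mod_cast hn)
      have hm := mul_meas_ge_le_integral_of_nonneg (μ := μ n)
        (f := fun s => |(numCycles s : ℝ) / (n : ℝ) ^ (1 / (2 : ℝ))|)
        (ae_of_all _ fun s => abs_nonneg _) Integrable.of_finite ε
      have hint : ∫ s, |(numCycles s : ℝ) / (n : ℝ) ^ (1 / (2 : ℝ))| ∂μ n ≤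
          (1 + Real.log n) / √n := by
        rw [sqrt_eq_rpow_one_div_two]
        have e : ∀ s : Equiv.Perm (Fin n), |(numCycles s : ℝ) / √n| = (numCycles s : ℝ) / √n :=
          fun s => abs_of_nonneg (by positivity)
        simp only [e]
        rw [integral_div, hμ, integral_uniform]
        have h3 := (expect_numCycles_le_harmonic n).trans (harmonic_le_one_add_log n)
        rw [Fintype.expect_eq_sum_div_card] at h3
        rw [smul_eq_mul, inv_mul_eq_div]
        gcongr
      rw [inv_mul_eq_div, le_div_iff₀ hε, mul_comm]
      exact hm.trans hint
    have := ENNReal.tendsto_ofReal hreal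
    rw [ENNReal.ofReal_zero] at this
    refine this.congr fun n => ?_
    rw [ofReal_measureReal]

end Universality

/-- Convergence of the characteristic functions to the one of a centred Gaussian law implies
convergence in distribution. -/
theorem tendstoInDistribution_gaussianReal_of_cis {Ω : ℕ → Type*} [∀ n, MeasurableSpace (Ω n)]
    {P : ∀ n, Measure (Ω n)} [∀ n, IsProbabilityMeasure (P n)] {X : ∀ n, Ω n → ℝ}
    (hX : ∀ n, Measurable (X n)) {V : NNReal}
    (h : ∀ t : ℝ, Tendsto (fun n => ∫ ω, cis (t * X n ω) ∂P n) atTop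
      (𝓝 (Complex.exp (-((V : ℝ) : ℂ) * t ^ 2 / 2)))) :
    TendstoInDistribution X atTop (id : ℝ → ℝ) P (gaussianReal 0 V) where
  forall_aemeasurable n := (hX n).aemeasurable
  aemeasurable_limit := aemeasurable_id
  tendsto := by
    refine ProbabilityMeasure.tendsto_of_tendsto_charFun fun t => ?_
    simp only [ProbabilityMeasure.coe_mk, Measure.map_id, charFun_gaussianReal]
    have e : Complex.exp ((t : ℂ) * (0 : ℝ) * Complex.I - ((V : ℝ) : ℂ) * t ^ 2 / 2) =
        Complex.exp (-((V : ℝ) : ℂ) * t ^ 2 / 2) := by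
      congr 1; push_cast; ring
    refine (h t).congr' ?_ |>.trans (le_of_eq (by rw [← e]))
    refine Eventually.of_forall fun n => ?_
    change _ = charFun (Measure.map (X n) (P n)) t
    rw [charFun_apply_real, integral_map (hX n).aemeasurable]
    · simp only [cis]
      congr 1
      ext ω
      push_cast
      ring_nf
    · fun_prop

theorem mainTheorem4 (p : ℕ) (hp : 1 ≤ p) (v : VincularPattern p) :
    ∃ V : NNReal, (2 ≤ p → 0 < V) ∧
      -- `V` is the limiting variance for uniform random permutations
      TendstoInDistribution
        (fun (n : ℕ) (π : Equiv.Perm (Fin n)) => normalizedOccurrences v π) atTop (id : ℝ → ℝ)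
        (fun n : ℕ => (PMF.uniformOfFintype (Equiv.Perm (Fin n))).toMeasure) (gaussianReal 0 V) ∧
      -- the same `V` for every sequence that satisfies the hypothesis
      ∀ (Ω : ℕ → Type*) [∀ n, MeasurableSpace (Ω n)] (P : ∀ n, Measure (Ω n))
        [∀ n, IsProbabilityMeasure (P n)] (σ : ∀ n, Ω n → Equiv.Perm (Fin n)),
        (∀ n, Measurable (σ n)) → HInvProb 2 P σ →
          TendstoInDistribution (fun n ω => normalizedOccurrences v (σ n ω)) atTop
            (id : ℝ → ℝ) P (gaussianReal 0 V) := by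
  obtain ⟨V, hV⟩ := exists_tendsto_occVar v.perm v.adj_subset
  have hV0 : 0 ≤ V := ge_of_tendsto' hV fun n =>
    div_nonneg (occVar_nonneg _ _ n) (by positivity)
  lift V to NNReal using hV0
  have hunif : ∀ t : ℝ, Tendsto (fun n : ℕ =>
      ∫ s, cis (t * normalizedOccurrences v s)
        ∂(PMF.uniformOfFintype (Equiv.Perm (Fin n))).toMeasure) atTop
      (𝓝 (Complex.exp (-((V : ℝ) : ℂ) * t ^ 2 / 2))) := fun t => by
    refine (tendsto_expect_cis_normalizedOccurrences v hp hV t).congr fun n => ?_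
    rw [integral_uniform, Fintype.expect_eq_sum_div_card, Complex.real_smul, Complex.ofReal_inv,
      inv_mul_eq_div]
    simp
  choose ρ hρ using exists_numCycles_le_one
  have hf1 : ∀ (t : ℝ) (n : ℕ) (s : Equiv.Perm (Fin n)),
      ‖cis (t * normalizedOccurrences v s)‖ ≤ 1 := fun t n s => (norm_cis _).le
  have hf : ∀ (t : ℝ) (n : ℕ) (s : Equiv.Perm (Fin n)) (x y : Fin n),
      ‖cis (t * normalizedOccurrences v (s * Equiv.swap x y)) -
        cis (t * normalizedOccurrences v s)‖ ≤ |t| * (2 * p) / √n := fun t n s x y => by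
    refine (norm_cis_sub_cis_le _ _).trans ?_
    rw [← mul_sub, abs_mul, mul_div_assoc]
    exact mul_le_mul_of_nonneg_left
      (abs_normalizedOccurrences_mul_swap_sub_le v hp s x y) (abs_nonneg t)
  refine ⟨V, fun hp2 => ?_, ?_, ?_⟩
  · exact_mod_cast occVar_limit_pos hp2 v.perm v.adj_subset hV
  · exact tendstoInDistribution_gaussianReal_of_cis (fun n => measurable_of_finite _) hunif
  · intro Ω _ P _ σ hσ h
    refine tendstoInDistribution_gaussianReal_of_cis (P := P)
      (X := fun n ω => normalizedOccurrences v (σ n ω))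
      (fun n => (measurable_of_finite (normalizedOccurrences v)).comp (hσ n)) fun t => ?_
    -- both sequences are compared with the uniform long cycle
    have hC : 0 ≤ |t| * (2 * p) := by positivity
    have h1 := tendsto_integral_sub_conjMean hσ h (hf1 t) hC (hf t) hρ
    have h2 := tendsto_integral_sub_conjMean
      (P := fun n : ℕ => (PMF.uniformOfFintype (Equiv.Perm (Fin n))).toMeasure)
      (σ := fun _ s => s) (fun _ => measurable_id) hInvProb_uniform (hf1 t) hC (hf t) hρ
    have h3 := (h1.sub h2).add (hunif t)
    simpa using h3
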